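/- Let $N\ge 3$. Let $V:(0,\infty)\to[0,\infty)$ and $K:(0,\infty)\to(0,\infty)$ be continuous, and suppose there is $C>0$ with $V(r)\le C/r^2$ for all $r\in(0,1)$. Suppose that there are $\alpha_0,\alpha_\infty\in\mathbb R$, $\beta_0,\beta_\infty\in[0,1]$ and $R_1,R_2>0$ such that $$\sup_{0<r<R_1}\frac{K(r)}{r^{\alpha_0}V(r)^{\beta_0}}<\infty,\qquad \sup_{r>R_2}\frac{K(r)}{r^{\alpha_\infty}V(r)^{\beta_\infty}}<\infty$$ (with $V^0=1$, and the quotient being $+\infty$ where the denominator vanishes). Let $q_1,q_2\in\mathbb R$ satisfy $$4<q_1<2\,\frac{2\alpha_0+2N-\beta_0(N+2)}{N-2},\qquad q_2>\max\Big\{4,\;4\,\frac{\alpha_\infty+N-2\beta_\infty}{N-2}\Big\}.$$ Let $g:\mathbb R\to\mathbb R$ be continuous, put $G(t)=\int_0^t g(s)\,ds$, and assume: there is $\theta>2$ with $0\le 2\theta G(t)\le g(t)t$ for all $t\in\mathbb R$; there is $t_0>0$ with $G(t_0)>0$; and there is $C>0$ with $|g(t)|\le C\min\{|t|^{q_1-1},|t|^{q_2-1}\}$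 for all $t\in\mathbb R$. Let $f:\mathbb R\to\mathbb R$ be the solution of $f'=1/\sqrt{1+2f^2}$, $f(0)=0$. Let $D_r^{1,2}(\mathbb R^N)$ be the completion, as a space of functions, of the space $C^\infty_{c,r}(\mathbb R^N)$ of radial smooth compactly supported functions in the norm $\|u\|_{1,2}=(\int|\nabla u|^2dx)^{1/2}$, and let $$E=\Big\{u\in D_r^{1,2}(\mathbb R^N):\int_{\mathbb R^N}V(|x|)f(u)^2dx<\infty\Big\},\qquad \|u\|=\|u\|_{1,2}+\inf_{k>0}\frac1k\Big[1+\int_{\mathbb R^N}V(|x|)f(ku)^2dx\Big].$$ Then $K(|x|)G(f(v))$ is integrable for every $v\in E$, and the functional $I:E\to\mathbb R$, $$I(u)=\frac12\int_{\mathbb R^N}|\nabla u|^2dx+\frac12\int_{\mathbb R^N}V(|x|)f(u)^2dx-\int_{\mathbb R^N}K(|x|)G(f(u))\,dx,$$ has a nonnegative critical point $u\ne0$: $I$ is Fréchet differentiable at $u$ with respect to $\|\cdot\|$ and $I'(u)=0$. Moreover, for a suitable representative of $u$, the function $w=f(u)$ is a nonnegative solution of $$-\Delta w+V(|x|)w-w\,\Delta(w^2)=K(|x|)g(w)$$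 in both of the following senses: $w\in C^2(\mathbb R^N\setminus\{0\})$ and the equation holds at every $x\neq0$; and $w\in D_r^{1,2}(\mathbb R^N)$, $\int_{\mathbb R^N} V(|x|)w^2dx<\infty$ and, for every $h\in C^\infty_{c,r}(\mathbb R^N)$, $$\int_{\mathbb R^N}(1+2w^2)\nabla w\cdot\nabla h\,dx+\int_{\mathbb R^N}2w|\nabla w|^2h\,dx+\int_{\mathbb R^N}V(|x|)wh\,dx=\int_{\mathbb R^N}K(|x|)g(w)h\,dx,$$ all the integrands being integrable. -/

import Mathlib

open MeasureTheory Filter Topology Set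
open scoped ENNReal ContDiff

noncomputable section

namespace QuasilinearSchrodinger

/-! ## The change of variable `f`, solution of `f' = 1 / √(1 + 2 f²)`, `f 0 = 0` -/

/-- The inverse of the change of variable, `w ↦ ∫₀ʷ √(1 + 2 s²) ds`. -/
def invChange (w : ℝ) : ℝ := ∫ s in (0 : ℝ)..w, √(1 + 2 * s ^ 2)

theorem hasDerivAt_invChange (w : ℝ) : HasDerivAt invChange (√(1 + 2 * w ^ 2)) w := by
  have hc : Continuous fun s : ℝ => √(1 + 2 * s ^ 2) := by fun_prop
  exact intervalIntegral.integral_hasDerivAt_right (hc.intervalIntegrable _ _)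
    hc.aestronglyMeasurable.stronglyMeasurableAtFilter hc.continuousAt

theorem sqrt_one_add_pos (w : ℝ) : 0 < √(1 + 2 * w ^ 2) := Real.sqrt_pos.2 (by positivity)

theorem strictMono_invChange : StrictMono invChange :=
  strictMono_of_hasDerivAt_pos hasDerivAt_invChange sqrt_one_add_pos

theorem continuous_invChange : Continuous invChange :=
  continuous_iff_continuousAt.2 fun w => (hasDerivAt_invChange w).continuousAt

theorem monotone_invChange_sub : Monotone fun w => invChange w - w := by
  refine monotone_of_hasDerivAt_nonneg (f' := fun w => √(1 + 2 * w ^ 2) - 1)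
    (fun w => (hasDerivAt_invChange w).sub (hasDerivAt_id w)) fun w => ?_
  have : (1 : ℝ) ≤ √(1 + 2 * w ^ 2) := Real.one_le_sqrt.2 (by nlinarith [sq_nonneg w])
  simpa using this

theorem surjective_invChange : Function.Surjective invChange := by
  have h0 : invChange 0 = 0 := by simp [invChange]
  refine continuous_invChange.surjective ?_ ?_
  · refine tendsto_atTop_mono' _ ?_ tendsto_id
    filter_upwards [eventually_ge_atTop 0] with w hw
    have := monotone_invChange_sub hw
    simp only [h0] at this
    simp only [id]; linarith
  · refine tendsto_atBot_mono' _ ?_ tendsto_id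
    filter_upwards [eventually_le_atBot 0] with w hw
    have := monotone_invChange_sub hw
    simp only [h0] at this
    simp only [id]; linarith

/-- The change of variable `f : ℝ → ℝ`. -/
def dualChange : ℝ → ℝ :=
  (strictMono_invChange.orderIsoOfSurjective invChange surjective_invChange).symm

theorem invChange_dualChange (t : ℝ) : invChange (dualChange t) = t :=
  (strictMono_invChange.orderIsoOfSurjective invChange surjective_invChange).apply_symm_apply t

/-- `f` solves the Cauchy problem. -/
theorem dualChange_spec :
    dualChange 0 = 0 ∧ ∀ t, HasDerivAt dualChange (1 / √(1 + 2 * dualChange t ^ 2)) t := by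
  refine ⟨strictMono_invChange.injective ?_, fun t => ?_⟩
  · rw [invChange_dualChange]; simp [invChange]
  · rw [one_div]
    exact HasDerivAt.of_local_left_inverse
      (OrderIso.continuous _).continuousAt (hasDerivAt_invChange _) (sqrt_one_add_pos _).ne'
      (Eventually.of_forall invChange_dualChange)

/-- `f` is the only solution of the Cauchy problem. -/
theorem dualChange_unique {f : ℝ → ℝ} (h0 : f 0 = 0)
    (hf : ∀ t, HasDerivAt f (1 / √(1 + 2 * f t ^ 2)) t) : f = dualChange := by
  have hd : ∀ t, HasDerivAt (fun t => invChange (f t) - t) 0 t := fun t => by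
    have h := ((hasDerivAt_invChange (f t)).comp t (hf t)).sub (hasDerivAt_id t)
    rwa [mul_one_div_cancel (sqrt_one_add_pos _).ne', sub_self] at h
  funext t
  have h := is_const_of_deriv_eq_zero (fun t => (hd t).differentiableAt) (fun t => (hd t).deriv) t 0
  apply strictMono_invChange.injective
  rw [invChange_dualChange]
  simp only [h0, sub_zero] at h
  have h' : invChange 0 = 0 := by simp [invChange]
  linarith

/-! ## Radial test functions and the space `D_r^{1,2}` -/

/-- `C_{c,r}^∞(ℝ^N)`: smooth compactly supported radial functions. -/
structure IsRadialTest {N : ℕ} (φ : EuclideanSpace ℝ (Fin N) → ℝ) : Prop where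
  smooth : ContDiff ℝ ∞ φ
  compact : HasCompactSupport φ
  radial : ∀ x y, ‖x‖ = ‖y‖ → φ x = φ y

/-- The critical Sobolev exponent `2N / (N - 2)`, used for `N ≥ 3`. -/
def sobolevExp (N : ℕ) : ℝ≥0∞ := ENNReal.ofReal (2 * N / (N - 2))

/-- `u` belongs to `D_r^{1,2}(ℝ^N)` with weak gradient `v`: there are radial test functions `φₙ`
with `φₙ → u` in `L^{2N/(N-2)}` and `∇φₙ → v` in `L²`. By the Sobolev inequality a sequence of test
functions whose gradients are Cauchy in `L²` converges in `L^{2N/(N-2)}`, so this is the usual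
realization, as a space of functions, of the completion of `C_{c,r}^∞` in the norm
`(∫ |∇φ|²)^{1/2}`. -/
def HasRadialGrad {N : ℕ} (u : EuclideanSpace ℝ (Fin N) → ℝ)
    (v : EuclideanSpace ℝ (Fin N) → EuclideanSpace ℝ (Fin N)) : Prop :=
  MemLp u (sobolevExp N) volume ∧ MemLp v 2 volume ∧
    ∃ φ : ℕ → EuclideanSpace ℝ (Fin N) → ℝ, (∀ n, IsRadialTest (φ n)) ∧
      Tendsto (fun n => eLpNorm (φ n - u) (sobolevExp N) volume) atTop (𝓝 0) ∧
      Tendsto (fun n => eLpNorm (gradient (φ n) - v) 2 volume) atTop (𝓝 0)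

/-- The space `D_r^{1,2}(ℝ^N)`; functions that agree almost everywhere represent the same
element. -/
def D12r (N : ℕ) : Set (EuclideanSpace ℝ (Fin N) → ℝ) := {u | ∃ v, HasRadialGrad u v}

open Classical in
/-- The weak gradient of `u ∈ D_r^{1,2}` (determined up to a null set). -/
def wgrad {N : ℕ} (u : EuclideanSpace ℝ (Fin N) → ℝ) :
    EuclideanSpace ℝ (Fin N) → EuclideanSpace ℝ (Fin N) :=
  if h : ∃ v, HasRadialGrad u v then h.choose else 0

/-! ## The Orlicz–Sobolev space `E` -/

/-- `E`: the functions `u ∈ D_r^{1,2}` with `∫ V(|x|) f(u)² dx < ∞`. -/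
def spaceE (N : ℕ) (V : ℝ → ℝ) : Set (EuclideanSpace ℝ (Fin N) → ℝ) :=
  {u | u ∈ D12r N ∧ Integrable (fun x => V ‖x‖ * dualChange (u x) ^ 2) volume}

/-- `‖u‖_{1,2} = (∫ |∇u|²)^{1/2}`. -/
def norm12 {N : ℕ} (u : EuclideanSpace ℝ (Fin N) → ℝ) : ℝ := √(∫ x, ‖wgrad u x‖ ^ 2)

/-- The Orlicz norm `‖u‖_o = inf_{k > 0} (1 / k) (1 + ∫ V(|x|) f(k u)² dx)`; for `u ∈ E` all the
integrals are finite, since `f(2 t)² ≤ 4 f(t)²`. -/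
def normO {N : ℕ} (V : ℝ → ℝ) (u : EuclideanSpace ℝ (Fin N) → ℝ) : ℝ :=
  ⨅ k : Ioi (0 : ℝ), 1 / (k : ℝ) * (1 + ∫ x, V ‖x‖ * dualChange ((k : ℝ) * u x) ^ 2)

/-- The norm of `E`. -/
def normE {N : ℕ} (V : ℝ → ℝ) (u : EuclideanSpace ℝ (Fin N) → ℝ) : ℝ := norm12 u + normO V u

/-! ## The functional and its critical points -/

/-- `G(t) = ∫₀ᵗ g(s) ds`. -/
def primG (g : ℝ → ℝ) (t : ℝ) : ℝ := ∫ s in (0 : ℝ)..t, g s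

/-- `I(u) = ½ ∫ |∇u|² + ½ ∫ V(|x|) f(u)² - ∫ K(|x|) G(f(u))`. -/
def functionalI {N : ℕ} (V K g : ℝ → ℝ) (u : EuclideanSpace ℝ (Fin N) → ℝ) : ℝ :=
  1 / 2 * (∫ x, ‖wgrad u x‖ ^ 2) + 1 / 2 * (∫ x, V ‖x‖ * dualChange (u x) ^ 2)
    - ∫ x, K ‖x‖ * primG g (dualChange (u x))

/-- `u ∈ E` is a critical point of `I : E → ℝ`: `I` is Fréchet differentiable at `u`, with respect
to the norm of `E`, and `I'(u) = 0`, that is, `I(u + h) - I(u) = o(‖h‖)` as `h → 0` in `E`. -/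
def IsCriticalPoint {N : ℕ} (V K g : ℝ → ℝ) (u : EuclideanSpace ℝ (Fin N) → ℝ) : Prop :=
  u ∈ spaceE N V ∧ ∀ ε > 0, ∃ δ > 0, ∀ h ∈ spaceE N V, normE V h < δ →
    |functionalI V K g (u + h) - functionalI V K g u| ≤ ε * normE V h

/-! ## Solutions of the quasilinear equation -/

/-- `w` is of class `C²` away from the origin and satisfies
`-Δw + V(|x|) w - w Δ(w²) = K(|x|) g(w)` at every `x ≠ 0`. -/
def IsClassicalSolution {N : ℕ} (V K g : ℝ → ℝ) (w : EuclideanSpace ℝ (Fin N) → ℝ) : Prop :=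
  ContDiffOn ℝ 2 w {0}ᶜ ∧ ∀ x, x ≠ 0 →
    -Laplacian.laplacian w x + V ‖x‖ * w x - w x * Laplacian.laplacian (fun y => w y ^ 2) x
      = K ‖x‖ * g (w x)

/-- `w ∈ D_r^{1,2}`, `∫ V(|x|) w² dx < ∞`, and `w` satisfies the weak form of the equation on
`ℝ^N` against all radial test functions, all the integrals being convergent. -/
def IsWeakSolution {N : ℕ} (V K g : ℝ → ℝ) (w : EuclideanSpace ℝ (Fin N) → ℝ) : Prop :=
  w ∈ D12r N ∧ Integrable (fun x => V ‖x‖ * w x ^ 2) volume ∧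
  ∀ h : EuclideanSpace ℝ (Fin N) → ℝ, IsRadialTest h →
    Integrable (fun x => (1 + 2 * w x ^ 2) * inner ℝ (wgrad w x) (gradient h x)) volume ∧
    Integrable (fun x => 2 * w x * ‖wgrad w x‖ ^ 2 * h x) volume ∧
    Integrable (fun x => V ‖x‖ * w x * h x) volume ∧
    Integrable (fun x => K ‖x‖ * g (w x) * h x) volume ∧
    (∫ x, (1 + 2 * w x ^ 2) * inner ℝ (wgrad w x) (gradient h x))
        + (∫ x, 2 * w x * ‖wgrad w x‖ ^ 2 * h x) + (∫ x, V ‖x‖ * w x * h x)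
      = ∫ x, K ‖x‖ * g (w x) * h x

/-! ## Hypotheses -/

/-- Hypothesis (H) on the potentials `V : (0,∞) → [0,∞)` and `K : (0,∞) → (0,∞)`. -/
structure HypH (V K : ℝ → ℝ) : Prop where
  V_cont : ContinuousOn V (Ioi 0)
  K_cont : ContinuousOn K (Ioi 0)
  V_nonneg : ∀ r, 0 < r → 0 ≤ V r
  K_pos : ∀ r, 0 < r → 0 < K r
  V_bound : ∃ C > 0, ∀ r ∈ Ioo (0 : ℝ) 1, V r ≤ C / r ^ 2

/-- `q₀*(α, β)`. -/
def qZero (N : ℕ) (α β : ℝ) : ℝ := (2 * α + 2 * N - β * (N + 2)) / (N - 2)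

/-- `q_∞*(α, β)`. -/
def qInfty (N : ℕ) (α β : ℝ) : ℝ := 2 * ((α + N - 2 * β) / (N - 2))

/-- Hypothesis (h₁): `K / (r^{α₀} V^{β₀})` is bounded near `0` and `K / (r^{α_∞} V^{β_∞})` is
bounded near infinity. The bounds are multiplied out, so that they fail, as they should, where
`V = 0` and the exponent of `V` is positive (a quotient by `0` would be `0` here); `V^0 = 1`. -/
structure HypOne (V K : ℝ → ℝ) (α₀ β₀ αi βi : ℝ) : Prop where
  β₀_mem : β₀ ∈ Icc (0 : ℝ) 1
  βi_mem : βi ∈ Icc (0 : ℝ) 1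
  near_zero : ∃ R₁ > 0, ∃ C : ℝ, ∀ r ∈ Ioo 0 R₁, K r ≤ C * (r ^ α₀ * V r ^ β₀)
  near_infty : ∃ R₂ > 0, ∃ C : ℝ, ∀ r, R₂ < r → K r ≤ C * (r ^ αi * V r ^ βi)

/-- Hypothesis (h₂). -/
structure HypTwo (N : ℕ) (α₀ β₀ αi βi q₁ q₂ : ℝ) : Prop where
  four_lt : 4 < q₁
  lt_zero : q₁ < 2 * qZero N α₀ β₀
  gt_infty : max 4 (2 * qInfty N αi βi) < q₂

/-- Hypotheses (g₁), (g₂), (g₃), (g_{q₁,q₂}) on the nonlinearity. -/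
structure HypG (g : ℝ → ℝ) (q₁ q₂ : ℝ) : Prop where
  cont : Continuous g
  superlinear : ∃ θ > 2, ∀ t, 0 ≤ 2 * θ * primG g t ∧ 2 * θ * primG g t ≤ g t * t
  pos : ∃ t₀ > 0, 0 < primG g t₀
  growth : ∃ C > 0, ∀ t, |g t| ≤ C * min (|t| ^ (q₁ - 1)) (|t| ^ (q₂ - 1))

end QuasilinearSchrodinger

end

open QuasilinearSchrodinger

open MeasureTheory Filter Topology Set
open scoped ENNReal ContDiff

noncomputable section

namespace QuasilinearSchrodinger

/-! ## The radial measure -/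

/-! The substitution `w = f(u)` turns the quasilinear equation into the semilinear one `-Δu + V f(u)
f'(u) = K g(f(u)) f'(u)`, whose energy is `I`. A function of `D_r^{1,2}` is determined by its radial
derivative `ψ ∈ L²(r^{N-1} dr)` through `u(r) = -∫_r^∞ ψ`, so the variational problem lives on the
half line, with measure `rMeas N`. Two one-dimensional inequalities carry the analysis: the decay
`|u(r)| ≤ c ‖ψ‖ r^{-(N-2)/2}` (`abs_tailInt_le`) and Hardy's inequality (`hardy`); together they
also give the Sobolev embedding.

The Orlicz structure of `E` can be avoided. As a set, `E` is the Hilbert space `RadSpace N V` of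
those `u` with `∫ |∇u|² + V u² < ∞`. Near the origin `V ≤ C / r²`, so Hardy controls `V u²` by the
gradient; for `r ≥ 1` the function `u` is bounded, and there `f(u)²` is comparable with `u²`
(`exists_V_sq_le`, `exists_rad_of_mem_spaceE`). Moreover the Hilbert norm is at most a constant
times the norm of `E` (`exists_norm_le_normE`). This one-sided bound is enough to turn a zero of the
derivative on the Hilbert space into a critical point on `E` (`isCriticalPoint_of_radGrad_eq_zero`).

On the Hilbert space the functional has a mountain pass geometry, and Ekeland's principle on the
space of paths gives almost critical points `xₙ` at levels in a bounded interval `[c, B]` with `c >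
0` (`mountain_pass`). The superlinearity exponent `θ > 2` bounds their energy (`radI_sub_le`), hence
their norm. The compactness comes from the nonlinear term: the condition on `q₁` makes it integrable
near `0`, and the condition on `q₂` makes its tail beyond `R` of order `R^{-σ}` on bounded sets
(`exists_growthBound`, `tail_estimate`), so its gradient maps weakly convergent sequences to
convergent ones (`tendsto_kGrad`). The gradient of the `V` part is weakly continuous, so a weak
limit of `xₙ` is critical. Strong convergence of `xₙ` is not needed: if the limit were `0`, pairing
the gradient at `xₙ` with `xₙ` would force the energy to `0`, below the level `c`.

For the sign, `g` is replaced by `t ↦ g (max t 0)` and the equation is tested with a smooth cut-off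
of the negative part (`val_nonneg_of_critical`). The du Bois-Reymond lemma shows that the critical
point solves a second order differential equation on `(0, ∞)` (`critical_regularity`). From it the
classical equation for `w` follows by calculus, and the weak formulation against `h` is the critical
point equation tested with `h / f'(u) = h √(1 + 2 w²)`. -/

/-- The image of Lebesgue measure on `ℝ^N` under the norm. -/
def rMeas (N : ℕ) : Measure ℝ :=
  Measure.map (fun x : EuclideanSpace ℝ (Fin N) => ‖x‖) volume

/-- The area of the unit sphere of `ℝ^N`. -/
def sphereArea (N : ℕ) : ℝ :=
  N * (volume : Measure (EuclideanSpace ℝ (Fin N))).real (Metric.ball 0 1)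

theorem sphereArea_pos {N : ℕ} (hN : 1 ≤ N) : 0 < sphereArea N := by
  have h : (volume : Measure (EuclideanSpace ℝ (Fin N))) (Metric.ball 0 1) ≠ 0 :=
    (Metric.measure_ball_pos _ _ one_pos).ne'
  have h' : (volume : Measure (EuclideanSpace ℝ (Fin N))) (Metric.ball 0 1) ≠ ⊤ :=
    measure_ball_lt_top.ne
  have : (0 : ℝ) < N := by exact_mod_cast hN
  exact mul_pos this (ENNReal.toReal_pos h h')

theorem measurable_norm_euclidean (N : ℕ) :
    Measurable (fun x : EuclideanSpace ℝ (Fin N) => ‖x‖) := measurable_norm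

/-- Polar coordinates: off the origin, which is a null set, Lebesgue measure is the product of the
surface measure of the unit sphere and `r^{N-1} dr`. The integrand depends on `r` alone, so the
sphere contributes only its total mass. -/
theorem rMeas_eq {N : ℕ} (hN : 1 ≤ N) :
    rMeas N = (volume.restrict (Ioi (0 : ℝ))).withDensity
      (fun r => ENNReal.ofReal (sphereArea N * r ^ (N - 1))) := by
  have : Nonempty (Fin N) := ⟨⟨0, hN⟩⟩
  have hdim : Module.finrank ℝ (EuclideanSpace ℝ (Fin N)) = N := by simp
  set E := EuclideanSpace ℝ (Fin N)
  ext s hs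
  rw [rMeas, Measure.map_apply (measurable_norm_euclidean N) hs,
    withDensity_apply _ hs, Measure.restrict_restrict hs]
  have hmp := (volume : Measure E).measurePreserving_homeomorphUnitSphereProd
  rw [hdim] at hmp
  have h1 : (volume : Measure E) ((fun x : E => ‖x‖) ⁻¹' s)
      = ∫⁻ x : E, s.indicator 1 ‖x‖ := by
    rw [← lintegral_indicator_one ((measurable_norm_euclidean N) hs)]
    rfl
  have hmi : Measurable (s.indicator (1 : ℝ → ℝ≥0∞)) := measurable_one.indicator hs
  have hmi2 : Measurable fun x : Metric.sphere (0 : E) 1 × Ioi (0 : ℝ) =>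
      s.indicator (1 : ℝ → ℝ≥0∞) x.2.1 :=
    hmi.comp (measurable_subtype_coe.comp measurable_snd)
  have hmi3 : Measurable fun r : Ioi (0 : ℝ) => s.indicator (1 : ℝ → ℝ≥0∞) r.1 :=
    hmi.comp measurable_subtype_coe
  have h2 : ∫⁻ x : E, s.indicator (1 : ℝ → ℝ≥0∞) ‖x‖
      = ∫⁻ x : ({(0 : E)}ᶜ : Set E), s.indicator (1 : ℝ → ℝ≥0∞) ‖x.1‖ ∂((volume : Measure E).comap Subtype.val) := by
    rw [lintegral_subtype_comap (measurableSet_singleton _).compl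
      (fun x : E => s.indicator (1 : ℝ → ℝ≥0∞) ‖x‖), restrict_compl_singleton]
  have h3 : ∫⁻ x : ({(0 : E)}ᶜ : Set E), s.indicator (1 : ℝ → ℝ≥0∞) ‖x.1‖ ∂((volume : Measure E).comap Subtype.val)
      = ∫⁻ x, s.indicator (1 : ℝ → ℝ≥0∞) x.2.1
        ∂((volume : Measure E).toSphere.prod (Measure.volumeIoiPow (N - 1))) := by
    rw [← hmp.lintegral_comp hmi2]
    simp
  have h4 : ∫⁻ x, s.indicator (1 : ℝ → ℝ≥0∞) x.2.1
        ∂((volume : Measure E).toSphere.prod (Measure.volumeIoiPow (N - 1)))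
      = (volume : Measure E).toSphere univ *
        ∫⁻ r, s.indicator (1 : ℝ → ℝ≥0∞) r.1 ∂(Measure.volumeIoiPow (N - 1)) := by
    rw [lintegral_prod _ hmi2.aemeasurable]
    simp [mul_comm]
  have h5 : ∫⁻ r, s.indicator (1 : ℝ → ℝ≥0∞) r.1 ∂(Measure.volumeIoiPow (N - 1))
      = ∫⁻ r in s ∩ Ioi 0, ENNReal.ofReal (r ^ (N - 1)) := by
    rw [Measure.volumeIoiPow, lintegral_withDensity_eq_lintegral_mul _ (by fun_prop) hmi3]
    have := lintegral_subtype_comap (μ := (volume : Measure ℝ)) measurableSet_Ioi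
      (s := Ioi (0 : ℝ)) (fun r : ℝ => ENNReal.ofReal (r ^ (N - 1)) * s.indicator 1 r)
    refine Eq.trans this ?_
    rw [← Measure.restrict_restrict hs, ← lintegral_indicator hs]
    refine lintegral_congr fun r => ?_
    by_cases hr : r ∈ s <;> simp [hr]
  rw [h1, h2, h3, h4, h5, Measure.toSphere_apply_univ, hdim]
  have h6 : (N : ℝ≥0∞) * (volume : Measure E) (Metric.ball 0 1) = ENNReal.ofReal (sphereArea N) := by
    rw [sphereArea, ENNReal.ofReal_mul (by positivity), ENNReal.ofReal_natCast, measureReal_def,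
      ENNReal.ofReal_toReal measure_ball_lt_top.ne]
  rw [h6, ← lintegral_const_mul _ (by fun_prop)]
  refine lintegral_congr fun r => ?_
  rw [ENNReal.ofReal_mul (sphereArea_pos hN).le]

theorem rMeas_lintegral {N : ℕ} (hN : 1 ≤ N) {F : ℝ → ℝ≥0∞} (hF : AEMeasurable F (rMeas N)) :
    ∫⁻ r, F r ∂(rMeas N)
      = ENNReal.ofReal (sphereArea N) * ∫⁻ r in Ioi 0, ENNReal.ofReal (r ^ (N - 1)) * F r := by
  rw [rMeas_eq hN] at hF ⊢
  rw [lintegral_withDensity_eq_lintegral_mul₀' (by fun_prop) hF,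
    ← lintegral_const_mul' _ _ ENNReal.ofReal_ne_top]
  refine lintegral_congr fun r => ?_
  simp only [Pi.mul_apply]
  rw [ENNReal.ofReal_mul (sphereArea_pos hN).le, mul_assoc]

/-- The density is positive on `(0, ∞)`, so the null sets are those of Lebesgue measure there. -/
theorem rMeas_ae_iff {N : ℕ} (hN : 1 ≤ N) {P : ℝ → Prop} :
    (∀ᵐ r ∂(rMeas N), P r) ↔ ∀ᵐ r ∂(volume.restrict (Ioi (0 : ℝ))), P r := by
  rw [rMeas_eq hN, ae_withDensity_iff' (by fun_prop)]
  refine eventually_congr ?_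
  filter_upwards [ae_restrict_mem measurableSet_Ioi] with r hr
  have : ENNReal.ofReal (sphereArea N * r ^ (N - 1)) ≠ 0 := by
    have := sphereArea_pos hN
    have hr' : (0 : ℝ) < r := hr
    simp only [ne_eq, ENNReal.ofReal_eq_zero, not_le]; positivity
  simp [this]

theorem rMeas_absolutelyContinuous {N : ℕ} (hN : 1 ≤ N) :
    rMeas N ≪ volume.restrict (Ioi (0 : ℝ)) := by
  rw [rMeas_eq hN]; exact withDensity_absolutelyContinuous _ _

theorem absolutelyContinuous_rMeas {N : ℕ} (hN : 1 ≤ N) :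
    volume.restrict (Ioi (0 : ℝ)) ≪ rMeas N :=
  Measure.ae_le_iff_absolutelyContinuous.1 fun _ h => (rMeas_ae_iff hN).1 h

theorem rMeas_ae_pos {N : ℕ} (hN : 1 ≤ N) : ∀ᵐ r ∂(rMeas N), 0 < r :=
  (rMeas_ae_iff hN).2 (ae_restrict_mem measurableSet_Ioi)

theorem rMeas_aestronglyMeasurable {N : ℕ} (hN : 1 ≤ N) {F : ℝ → ℝ}
    (hF : ContinuousOn F (Ioi 0)) : AEStronglyMeasurable F (rMeas N) :=
  (hF.aestronglyMeasurable measurableSet_Ioi).mono_ac (rMeas_absolutelyContinuous hN)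

theorem rMeas_integrable_iff {N : ℕ} (hN : 1 ≤ N) {F : ℝ → ℝ} :
    Integrable F (rMeas N) ↔ IntegrableOn (fun r => r ^ (N - 1) * F r) (Ioi 0) := by
  have hk := sphereArea_pos hN
  rw [rMeas_eq hN, integrable_withDensity_iff_integrable_smul' (by fun_prop)
    (Eventually.of_forall fun _ => ENNReal.ofReal_lt_top)]
  rw [IntegrableOn, ← integrable_const_mul_iff (c := sphereArea N) (isUnit_iff_ne_zero.2 hk.ne')
    (fun r => r ^ (N - 1) * F r)]
  refine integrable_congr ?_
  filter_upwards [ae_restrict_mem measurableSet_Ioi] with r hr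
  have hr' : (0 : ℝ) < r := hr
  rw [ENNReal.toReal_ofReal (by positivity), smul_eq_mul, mul_assoc]

theorem rMeas_integral {N : ℕ} (hN : 1 ≤ N) (F : ℝ → ℝ) :
    ∫ r, F r ∂(rMeas N) = sphereArea N * ∫ r in Ioi 0, r ^ (N - 1) * F r := by
  have hk := sphereArea_pos hN
  rw [rMeas_eq hN, integral_withDensity_eq_integral_toReal_smul (by fun_prop)
    (Eventually.of_forall fun _ => ENNReal.ofReal_lt_top), ← integral_const_mul]
  refine integral_congr_ae ?_
  filter_upwards [ae_restrict_mem measurableSet_Ioi] with r hr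
  have hr' : (0 : ℝ) < r := hr
  rw [ENNReal.toReal_ofReal (by positivity), smul_eq_mul, mul_assoc]

instance rMeas_sFinite (N : ℕ) : SFinite (rMeas N) := by
  unfold rMeas; infer_instance

theorem integral_comp_norm {N : ℕ} {F : ℝ → ℝ} (hF : AEStronglyMeasurable F (rMeas N)) :
    ∫ x : EuclideanSpace ℝ (Fin N), F ‖x‖ = ∫ r, F r ∂(rMeas N) :=
  (integral_map (measurable_norm_euclidean N).aemeasurable hF).symm

theorem integrable_comp_norm_iff {N : ℕ} {F : ℝ → ℝ} (hF : AEStronglyMeasurable F (rMeas N)) :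
    Integrable (fun x : EuclideanSpace ℝ (Fin N) => F ‖x‖) ↔ Integrable F (rMeas N) :=
  (integrable_map_measure hF (measurable_norm_euclidean N).aemeasurable).symm

theorem ae_comp_norm {N : ℕ} {P : ℝ → Prop} (h : ∀ᵐ r ∂(rMeas N), P r) :
    ∀ᵐ x : EuclideanSpace ℝ (Fin N), P ‖x‖ :=
  ae_of_ae_map (measurable_norm_euclidean N).aemeasurable h

theorem eLpNorm_comp_norm {N : ℕ} {F : ℝ → ℝ} {p : ℝ≥0∞}
    (hF : AEStronglyMeasurable F (rMeas N)) :
    eLpNorm (fun x : EuclideanSpace ℝ (Fin N) => F ‖x‖) p volume = eLpNorm F p (rMeas N) :=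
  (eLpNorm_map_measure hF (measurable_norm_euclidean N).aemeasurable).symm

/-! ## Primitives vanishing at infinity -/

/-- `-∫_r^∞ ψ`: the primitive of `ψ` that vanishes at infinity. -/
def tailInt (ψ : ℝ → ℝ) (r : ℝ) : ℝ := -∫ s in Ioi r, ψ s

/-- The decay rate `r^{-(N-2)/2}` of radial functions. -/
def decay (N : ℕ) (r : ℝ) : ℝ := r ^ (-((N : ℝ) - 2) / 2)

/-- The `L²` norm with respect to the radial measure. -/
def dnorm (N : ℕ) (ψ : ℝ → ℝ) : ℝ := √(∫ r, ψ r ^ 2 ∂(rMeas N))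

theorem dnorm_nonneg (N : ℕ) (ψ : ℝ → ℝ) : 0 ≤ dnorm N ψ := Real.sqrt_nonneg _

theorem dnorm_sq (N : ℕ) (ψ : ℝ → ℝ) : dnorm N ψ ^ 2 = ∫ r, ψ r ^ 2 ∂(rMeas N) :=
  Real.sq_sqrt (integral_nonneg fun _ => sq_nonneg _)

theorem decay_pos (N : ℕ) {r : ℝ} (hr : 0 < r) : 0 < decay N r := Real.rpow_pos_of_pos hr _

theorem decay_le_one {N : ℕ} (hN : 3 ≤ N) {r : ℝ} (hr : 1 ≤ r) : decay N r ≤ 1 := by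
  have : (3 : ℝ) ≤ N := by exact_mod_cast hN
  exact Real.rpow_le_one_of_one_le_of_nonpos hr (by linarith)

theorem lintegral_rpow_Ioi {γ r : ℝ} (hγ : 1 < γ) (hr : 0 < r) :
    ∫⁻ s in Ioi r, ENNReal.ofReal (s ^ (-γ)) = ENNReal.ofReal (r ^ (1 - γ) / (γ - 1)) := by
  rw [← ofReal_integral_eq_lintegral_ofReal (integrableOn_Ioi_rpow_of_lt (by linarith) hr),
    integral_Ioi_rpow_of_lt (by linarith) hr]
  · congr 1
    rw [show -γ + 1 = -(γ - 1) by ring, show 1 - γ = -(γ - 1) by ring, neg_div_neg_eq]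
  · filter_upwards [ae_restrict_mem measurableSet_Ioi] with s hs
    exact (Real.rpow_pos_of_pos (hr.trans hs) _).le

theorem lintegral_rpow_Ioo {β r : ℝ} (hβ : -1 < β) (hr : 0 < r) :
    ∫⁻ s in Ioo 0 r, ENNReal.ofReal (s ^ β) = ENNReal.ofReal (r ^ (β + 1) / (β + 1)) := by
  have hi : IntegrableOn (fun s : ℝ => s ^ β) (Ioo 0 r) := by
    have := intervalIntegral.intervalIntegrable_rpow' (a := 0) (b := r) hβ
    exact ((intervalIntegrable_iff_integrableOn_Ioc_of_le hr.le).1 this).mono_set Ioo_subset_Ioc_self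
  rw [← ofReal_integral_eq_lintegral_ofReal hi, ← integral_Ioc_eq_integral_Ioo,
    ← intervalIntegral.integral_of_le hr.le, integral_rpow (Or.inl hβ),
    Real.zero_rpow (by linarith), sub_zero]
  filter_upwards [ae_restrict_mem measurableSet_Ioo] with s hs
  exact (Real.rpow_pos_of_pos hs.1 _).le

/-- Cauchy–Schwarz applied to `|ψ| = s^{γ/2} |ψ| · s^{-γ/2}`. The exponent stays free because two
values are used: `γ = N - 1` gives the pointwise decay and `γ = N / 2` gives Hardy's inequality. -/
theorem sq_lintegral_Ioi_le {ψ : ℝ → ℝ} (hψ : AEMeasurable ψ (volume.restrict (Ioi (0 : ℝ))))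
    {γ r : ℝ} (hγ : 1 < γ) (hr : 0 < r) :
    (∫⁻ s in Ioi r, ‖ψ s‖ₑ) ^ 2 ≤
      (∫⁻ s in Ioi r, ENNReal.ofReal (s ^ γ) * ‖ψ s‖ₑ ^ 2)
        * ENNReal.ofReal (r ^ (1 - γ) / (γ - 1)) := by
  have hψ' : AEMeasurable ψ (volume.restrict (Ioi r)) :=
    hψ.mono_measure (Measure.restrict_mono (Ioi_subset_Ioi hr.le) le_rfl)
  have hm : AEMeasurable (fun s => ENNReal.ofReal (s ^ (γ / 2)) * ‖ψ s‖ₑ)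
      (volume.restrict (Ioi r)) := by
    have : Measurable fun s : ℝ => ENNReal.ofReal (s ^ (γ / 2)) := by fun_prop
    exact this.aemeasurable.mul hψ'.enorm
  have hm2 : AEMeasurable (fun s : ℝ => ENNReal.ofReal (s ^ (-(γ / 2))))
      (volume.restrict (Ioi r)) := by
    have : Measurable fun s : ℝ => ENNReal.ofReal (s ^ (-(γ / 2))) := by fun_prop
    exact this.aemeasurable
  have h := ENNReal.lintegral_mul_le_Lp_mul_Lq (volume.restrict (Ioi r))
    Real.HolderConjugate.two_two hm hm2
  have e1 : ∫⁻ s in Ioi r, ((fun s => ENNReal.ofReal (s ^ (γ / 2)) * ‖ψ s‖ₑ)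
      * (fun s : ℝ => ENNReal.ofReal (s ^ (-(γ / 2))))) s = ∫⁻ s in Ioi r, ‖ψ s‖ₑ := by
    refine setLIntegral_congr_fun measurableSet_Ioi fun s hs => ?_
    have hs' : 0 < s := hr.trans hs
    simp only [Pi.mul_apply]
    rw [mul_right_comm, ← ENNReal.ofReal_mul (Real.rpow_pos_of_pos hs' _).le,
      ← Real.rpow_add hs', add_neg_cancel, Real.rpow_zero, ENNReal.ofReal_one, one_mul]
  have e2 : ∫⁻ s in Ioi r, (ENNReal.ofReal (s ^ (γ / 2)) * ‖ψ s‖ₑ) ^ (2 : ℝ)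
      = ∫⁻ s in Ioi r, ENNReal.ofReal (s ^ γ) * ‖ψ s‖ₑ ^ 2 := by
    refine setLIntegral_congr_fun measurableSet_Ioi fun s hs => ?_
    have hs' : 0 < s := hr.trans hs
    rw [ENNReal.rpow_two, mul_pow, ← ENNReal.ofReal_pow (Real.rpow_pos_of_pos hs' _).le,
      ← Real.rpow_natCast, ← Real.rpow_mul hs'.le]
    norm_num
  have e3 : ∫⁻ s in Ioi r, (ENNReal.ofReal (s ^ (-(γ / 2)))) ^ (2 : ℝ)
      = ENNReal.ofReal (r ^ (1 - γ) / (γ - 1)) := by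
    rw [← lintegral_rpow_Ioi hγ hr]
    refine setLIntegral_congr_fun measurableSet_Ioi fun s hs => ?_
    have hs' : 0 < s := hr.trans hs
    rw [ENNReal.rpow_two, ← ENNReal.ofReal_pow (Real.rpow_pos_of_pos hs' _).le,
      ← Real.rpow_natCast, ← Real.rpow_mul hs'.le]
    congr 2; push_cast; ring
  rw [e1, e2, e3] at h
  calc _ ≤ _ := pow_le_pow_left' h 2
    _ = _ := by
      rw [mul_pow, ← ENNReal.rpow_two, ← ENNReal.rpow_two, ← ENNReal.rpow_mul, ← ENNReal.rpow_mul]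
      norm_num

/-! ### Pointwise decay and Hardy's inequality for primitives of square integrable functions. -/

section Energy

variable {N : ℕ} {ψ : ℝ → ℝ}

theorem aemeasurable_of_memLp (hN : 1 ≤ N) (hψ : MemLp ψ 2 (rMeas N)) :
    AEMeasurable ψ (volume.restrict (Ioi (0 : ℝ))) :=
  (hψ.aestronglyMeasurable.mono_ac (absolutelyContinuous_rMeas hN)).aemeasurable

theorem lintegral_energy (hN : 1 ≤ N) (hψ : MemLp ψ 2 (rMeas N)) :
    ∫⁻ s in Ioi 0, ENNReal.ofReal (s ^ ((N : ℝ) - 1)) * ‖ψ s‖ₑ ^ 2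
      = ENNReal.ofReal (dnorm N ψ ^ 2 / sphereArea N) := by
  have hk := sphereArea_pos hN
  have h1 : ENNReal.ofReal (∫ r, ψ r ^ 2 ∂(rMeas N)) = ∫⁻ r, ‖ψ r‖ₑ ^ 2 ∂(rMeas N) := by
    rw [ofReal_integral_eq_lintegral_ofReal hψ.integrable_sq
      (Eventually.of_forall fun _ => sq_nonneg _)]
    refine lintegral_congr fun r => ?_
    rw [← ofReal_norm, ← ENNReal.ofReal_pow (norm_nonneg _), Real.norm_eq_abs, sq_abs]
  rw [rMeas_lintegral hN (hψ.aestronglyMeasurable.enorm.pow_const 2)] at h1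
  rw [dnorm_sq, ENNReal.ofReal_div_of_pos hk, h1, mul_comm (ENNReal.ofReal _),
    ENNReal.mul_div_cancel_right]
  · refine setLIntegral_congr_fun measurableSet_Ioi fun s hs => ?_
    have : s ^ ((N : ℝ) - 1) = s ^ (N - 1) := by
      rw [← Real.rpow_natCast]; congr 1; push_cast [Nat.cast_sub hN]; ring
    rw [this]
  · simpa using hk
  · exact ENNReal.ofReal_ne_top

/-- The constant in the pointwise bound. -/
def decayConst (N : ℕ) : ℝ := √(1 / (sphereArea N * ((N : ℝ) - 2)))

theorem decayConst_nonneg (N : ℕ) : 0 ≤ decayConst N := Real.sqrt_nonneg _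

/-- With weight exponent `N - 1` the first Cauchy–Schwarz factor is the energy and the second is
`r^{2-N} / (N - 2)`, finite since `N ≥ 3`. This also shows that `ψ` is integrable at infinity, so
`tailInt ψ` is a genuine integral. -/
theorem lintegral_Ioi_le (hN : 3 ≤ N) (hψ : MemLp ψ 2 (rMeas N)) {r : ℝ} (hr : 0 < r) :
    ∫⁻ s in Ioi r, ‖ψ s‖ₑ ≤ ENNReal.ofReal (decayConst N * dnorm N ψ * decay N r) := by
  have hN' : (3 : ℝ) ≤ N := by exact_mod_cast hN
  have hk := sphereArea_pos (N := N) (by omega)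
  have h := sq_lintegral_Ioi_le (aemeasurable_of_memLp (by omega) hψ)
    (γ := (N : ℝ) - 1) (by linarith) hr
  have h2 : ∫⁻ s in Ioi r, ENNReal.ofReal (s ^ ((N : ℝ) - 1)) * ‖ψ s‖ₑ ^ 2
      ≤ ENNReal.ofReal (dnorm N ψ ^ 2 / sphereArea N) := by
    rw [← lintegral_energy (by omega) hψ]
    exact lintegral_mono_set (Ioi_subset_Ioi hr.le)
  have h3 := h.trans (mul_le_mul_left h2 _)
  rw [← ENNReal.ofReal_mul (by positivity)] at h3
  have h4 : dnorm N ψ ^ 2 / sphereArea N * (r ^ (1 - ((N : ℝ) - 1)) / ((N : ℝ) - 1 - 1))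
      = (decayConst N * dnorm N ψ * decay N r) ^ 2 := by
    have hd : decay N r ^ 2 = r ^ (1 - ((N : ℝ) - 1)) := by
      rw [decay, ← Real.rpow_natCast, ← Real.rpow_mul hr.le]; congr 1; push_cast; ring
    have hn : (0 : ℝ) < (N : ℝ) - 2 := by linarith
    rw [mul_pow, mul_pow, hd, decayConst, Real.sq_sqrt (by positivity)]
    rw [show (N : ℝ) - 1 - 1 = N - 2 by ring]
    field_simp
  rw [h4, ENNReal.ofReal_pow (by
    have := dnorm_nonneg N ψ; have := decayConst_nonneg N; have := decay_pos N hr; positivity)] at h3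
  exact (ENNReal.pow_le_pow_left_iff two_ne_zero).1 h3

theorem integrableOn_Ioi (hN : 3 ≤ N) (hψ : MemLp ψ 2 (rMeas N)) {r : ℝ} (hr : 0 < r) :
    IntegrableOn ψ (Ioi r) := by
  refine ⟨((aemeasurable_of_memLp (by omega) hψ).mono_measure
    (Measure.restrict_mono (Ioi_subset_Ioi hr.le) le_rfl)).aestronglyMeasurable, ?_⟩
  exact (lintegral_Ioi_le hN hψ hr).trans_lt ENNReal.ofReal_lt_top

theorem abs_tailInt_le (hN : 3 ≤ N) (hψ : MemLp ψ 2 (rMeas N)) {r : ℝ} (hr : 0 < r) :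
    |tailInt ψ r| ≤ decayConst N * dnorm N ψ * decay N r := by
  have h0 : 0 ≤ decayConst N * dnorm N ψ * decay N r := by
    have := dnorm_nonneg N ψ; have := decayConst_nonneg N; have := decay_pos N hr; positivity
  rw [tailInt, abs_neg, ← Real.norm_eq_abs]
  refine (ENNReal.ofReal_le_ofReal_iff h0).1 ?_
  rw [ofReal_norm]
  exact (enorm_integral_le_lintegral_enorm _).trans (lintegral_Ioi_le hN hψ hr)

theorem continuousOn_tailInt (hN : 3 ≤ N) (hψ : MemLp ψ 2 (rMeas N)) :
    ContinuousOn (tailInt ψ) (Ioi 0) := by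
  intro r hr
  have hr' : (0 : ℝ) < r := hr
  have h := IntegrableOn.continuousOn_Ici_primitive_Ioi (integrableOn_Ioi hN hψ (half_pos hr'))
  have h2 := (h.continuousAt (Ici_mem_nhds (half_lt_self hr'))).neg
  exact h2.continuousWithinAt

theorem tailInt_sub (hN : 3 ≤ N) (hψ : MemLp ψ 2 (rMeas N)) {a b : ℝ} (ha : 0 < a) (hb : 0 < b) :
    tailInt ψ b - tailInt ψ a = ∫ x in a..b, ψ x := by
  have := intervalIntegral.integral_interval_add_Ioi (integrableOn_Ioi hN hψ ha)
    (integrableOn_Ioi hN hψ hb)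
  simp only [tailInt]; linarith

/-- Cauchy–Schwarz inside, with weight exponent `N / 2`, and then Tonelli: both one-dimensional
power integrals that appear equal a power divided by `N / 2 - 1`, which produces the square of that
constant. -/
theorem hardy_lintegral (hN : 3 ≤ N) (hψ : MemLp ψ 2 (rMeas N)) :
    ∫⁻ r in Ioi 0, ENNReal.ofReal (r ^ ((N : ℝ) - 3)) * (∫⁻ s in Ioi r, ‖ψ s‖ₑ) ^ 2
      ≤ ENNReal.ofReal (1 / ((N : ℝ) / 2 - 1) ^ 2) *
        ∫⁻ s in Ioi 0, ENNReal.ofReal (s ^ ((N : ℝ) - 1)) * ‖ψ s‖ₑ ^ 2 := by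
  have hN' : (3 : ℝ) ≤ N := by exact_mod_cast hN
  have hm := aemeasurable_of_memLp (by omega) hψ
  set γ : ℝ := (N : ℝ) / 2 with hγ
  have hγ1 : 1 < γ := by rw [hγ]; linarith
  set h : ℝ → ℝ≥0∞ := fun s => ENNReal.ofReal (s ^ γ) * ‖ψ s‖ₑ ^ 2 with hh
  set k : ℝ → ℝ≥0∞ := fun r => ENNReal.ofReal (r ^ (γ - 2)) with hk
  have hkm : Measurable k := by fun_prop
  have hhm : AEMeasurable h (volume.restrict (Ioi (0 : ℝ))) := by
    have : Measurable fun s : ℝ => ENNReal.ofReal (s ^ γ) := by fun_prop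
    exact this.aemeasurable.mul (hm.enorm.pow_const 2)
  have step1 : ∫⁻ r in Ioi 0, ENNReal.ofReal (r ^ ((N : ℝ) - 3)) * (∫⁻ s in Ioi r, ‖ψ s‖ₑ) ^ 2
      ≤ ENNReal.ofReal (1 / (γ - 1)) * ∫⁻ r in Ioi 0, k r * ∫⁻ s in Ioi r, h s := by
    rw [← lintegral_const_mul' _ _ ENNReal.ofReal_ne_top]
    refine setLIntegral_mono' measurableSet_Ioi fun r hr => ?_
    have hr' : (0 : ℝ) < r := hr
    calc _ ≤ ENNReal.ofReal (r ^ ((N : ℝ) - 3)) * ((∫⁻ s in Ioi r, h s)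
          * ENNReal.ofReal (r ^ (1 - γ) / (γ - 1))) := by
          gcongr
          exact sq_lintegral_Ioi_le hm hγ1 hr
      _ = _ := by
          have e : ENNReal.ofReal (r ^ ((N : ℝ) - 3)) * ENNReal.ofReal (r ^ (1 - γ) / (γ - 1))
              = ENNReal.ofReal (1 / (γ - 1)) * k r := by
            rw [hk, ← ENNReal.ofReal_mul (by positivity), ← ENNReal.ofReal_mul (by
              have : 0 < γ - 1 := by linarith
              positivity)]
            congr 1
            rw [← mul_div_assoc, ← Real.rpow_add hr', div_mul_eq_mul_div, one_mul]
            congr 2; rw [hγ]; ring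
          rw [mul_comm (∫⁻ s in Ioi r, h s), ← mul_assoc, e, mul_assoc]
  -- Tonelli on the region `0 < r < s`.
  have step2 : ∫⁻ r in Ioi 0, k r * ∫⁻ s in Ioi r, h s
      = ∫⁻ s in Ioi 0, h s * ∫⁻ r in Ioo 0 s, k r := by
    have e1 : ∀ r ∈ Ioi (0 : ℝ), k r * ∫⁻ s in Ioi r, h s
        = ∫⁻ s in Ioi 0, (Ioi r).indicator (fun s => k r * h s) s := by
      intro r hr
      have hr' : (0 : ℝ) < r := hr
      rw [lintegral_indicator measurableSet_Ioi, Measure.restrict_restrict measurableSet_Ioi,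
        inter_eq_left.2 (Ioi_subset_Ioi hr'.le), lintegral_const_mul' _ _ ENNReal.ofReal_ne_top]
    have e2 : ∀ s ∈ Ioi (0 : ℝ), h s * ∫⁻ r in Ioo 0 s, k r
        = ∫⁻ r in Ioi 0, (Ioi r).indicator (fun s => k r * h s) s := by
      intro s hs
      have : (fun r => (Ioi r).indicator (fun s => k r * h s) s)
          = (Iio s).indicator (fun r => h s * k r) := by
        funext r
        by_cases hrs : r < s <;> simp [indicator, hrs, mul_comm]
      rw [this, lintegral_indicator measurableSet_Iio, Measure.restrict_restrict measurableSet_Iio,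
        inter_comm, Ioi_inter_Iio, lintegral_const_mul _ hkm]
    rw [setLIntegral_congr_fun measurableSet_Ioi e1, setLIntegral_congr_fun measurableSet_Ioi e2]
    refine lintegral_lintegral_swap ?_
    have : Function.uncurry (fun r s => (Ioi r).indicator (fun s => k r * h s) s)
        = {p : ℝ × ℝ | p.1 < p.2}.indicator (fun p => k p.1 * h p.2) := by
      funext p
      by_cases hp : p.1 < p.2 <;> simp [Function.uncurry, indicator, hp]
    rw [this]
    refine AEMeasurable.indicator ?_ (measurableSet_lt measurable_fst measurable_snd)
    exact (hkm.comp measurable_fst).aemeasurable.mul hhm.comp_snd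
  have step3 : ∫⁻ s in Ioi 0, h s * ∫⁻ r in Ioo 0 s, k r
      = ENNReal.ofReal (1 / (γ - 1)) *
        ∫⁻ s in Ioi 0, ENNReal.ofReal (s ^ ((N : ℝ) - 1)) * ‖ψ s‖ₑ ^ 2 := by
    rw [← lintegral_const_mul' _ _ ENNReal.ofReal_ne_top]
    refine setLIntegral_congr_fun measurableSet_Ioi fun s hs => ?_
    have hs' : (0 : ℝ) < s := hs
    simp only [hk]
    rw [lintegral_rpow_Ioo (by linarith) hs', hh]
    have e : ENNReal.ofReal (s ^ γ) * ENNReal.ofReal (s ^ (γ - 2 + 1) / (γ - 2 + 1))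
        = ENNReal.ofReal (1 / (γ - 1)) * ENNReal.ofReal (s ^ ((N : ℝ) - 1)) := by
      rw [← ENNReal.ofReal_mul (by positivity), ← ENNReal.ofReal_mul (by
        have : 0 < γ - 1 := by linarith
        positivity)]
      congr 1
      rw [← mul_div_assoc, ← Real.rpow_add hs', div_mul_eq_mul_div, one_mul]
      rw [show γ + (γ - 2 + 1) = (N : ℝ) - 1 by rw [hγ]; ring, show γ - 2 + 1 = γ - 1 by ring]
    simp only
    rw [mul_right_comm, e, mul_assoc]
  calc _ ≤ _ := step1
    _ = ENNReal.ofReal (1 / (γ - 1)) * (ENNReal.ofReal (1 / (γ - 1)) *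
        ∫⁻ s in Ioi 0, ENNReal.ofReal (s ^ ((N : ℝ) - 1)) * ‖ψ s‖ₑ ^ 2) := by rw [step2, step3]
    _ = _ := by
      rw [← mul_assoc, ← ENNReal.ofReal_mul (by
        have : 0 < γ - 1 := by linarith
        positivity)]
      congr 2
      rw [div_mul_div_comm, one_mul, sq]

/-- The constant in Hardy's inequality. -/
def hardyConst (N : ℕ) : ℝ := 1 / ((N : ℝ) / 2 - 1) ^ 2

theorem hardyConst_nonneg (N : ℕ) : 0 ≤ hardyConst N := by unfold hardyConst; positivity

theorem aestronglyMeasurable_tailInt (hN : 3 ≤ N) (hψ : MemLp ψ 2 (rMeas N)) :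
    AEStronglyMeasurable (tailInt ψ) (rMeas N) :=
  rMeas_aestronglyMeasurable (by omega) (continuousOn_tailInt hN hψ)

theorem hardy_lintegral_rMeas (hN : 3 ≤ N) (hψ : MemLp ψ 2 (rMeas N)) :
    ∫⁻ r, ENNReal.ofReal (tailInt ψ r ^ 2 / r ^ 2) ∂(rMeas N)
      ≤ ENNReal.ofReal (hardyConst N * dnorm N ψ ^ 2) := by
  have hk := sphereArea_pos (N := N) (by omega)
  have hm : AEStronglyMeasurable (fun r => tailInt ψ r ^ 2 / r ^ 2) (rMeas N) := by
    refine rMeas_aestronglyMeasurable (by omega)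
      (((continuousOn_tailInt hN hψ).pow 2).div (by fun_prop) fun r hr => ?_)
    have hr' : (0 : ℝ) < r := hr
    positivity
  rw [rMeas_lintegral (by omega) hm.aemeasurable.ennreal_ofReal]
  have h1 : ∫⁻ r in Ioi 0, ENNReal.ofReal (r ^ (N - 1)) * ENNReal.ofReal (tailInt ψ r ^ 2 / r ^ 2)
      ≤ ∫⁻ r in Ioi 0, ENNReal.ofReal (r ^ ((N : ℝ) - 3)) * (∫⁻ s in Ioi r, ‖ψ s‖ₑ) ^ 2 := by
    refine setLIntegral_mono' measurableSet_Ioi fun r hr => ?_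
    have hr' : (0 : ℝ) < r := hr
    have e : ENNReal.ofReal (r ^ (N - 1)) * ENNReal.ofReal (tailInt ψ r ^ 2 / r ^ 2)
        = ENNReal.ofReal (r ^ ((N : ℝ) - 3)) * ‖tailInt ψ r‖ₑ ^ 2 := by
      rw [← ofReal_norm, ← ENNReal.ofReal_pow (norm_nonneg _), Real.norm_eq_abs, sq_abs,
        ← ENNReal.ofReal_mul (by positivity), ← ENNReal.ofReal_mul (by positivity)]
      congr 1
      rw [show (N : ℝ) - 3 = ((N - 1 : ℕ) : ℝ) - (2 : ℕ) by
        push_cast [Nat.cast_sub (show 1 ≤ N by omega)]; ring, Real.rpow_sub hr',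
        Real.rpow_natCast, Real.rpow_natCast]
      ring
    rw [e]
    gcongr
    rw [tailInt, enorm_neg]
    exact enorm_integral_le_lintegral_enorm _
  calc _ ≤ ENNReal.ofReal (sphereArea N) * (ENNReal.ofReal (hardyConst N) *
        ENNReal.ofReal (dnorm N ψ ^ 2 / sphereArea N)) := by
        gcongr
        rw [← lintegral_energy (by omega) hψ]
        exact h1.trans (hardy_lintegral hN hψ)
    _ = _ := by
        rw [← ENNReal.ofReal_mul (hardyConst_nonneg N), ← ENNReal.ofReal_mul hk.le]
        congr 1; field_simp

theorem integrable_hardy (hN : 3 ≤ N) (hψ : MemLp ψ 2 (rMeas N)) :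
    Integrable (fun r => tailInt ψ r ^ 2 / r ^ 2) (rMeas N) := by
  have hm : AEStronglyMeasurable (fun r => tailInt ψ r ^ 2 / r ^ 2) (rMeas N) := by
    refine rMeas_aestronglyMeasurable (by omega)
      (((continuousOn_tailInt hN hψ).pow 2).div (by fun_prop) fun r hr => ?_)
    have hr' : (0 : ℝ) < r := hr
    positivity
  refine ⟨hm, ?_⟩
  rw [hasFiniteIntegral_iff_ofReal (Eventually.of_forall fun r => by positivity)]
  exact (hardy_lintegral_rMeas hN hψ).trans_lt ENNReal.ofReal_lt_top

theorem hardy (hN : 3 ≤ N) (hψ : MemLp ψ 2 (rMeas N)) :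
    ∫ r, tailInt ψ r ^ 2 / r ^ 2 ∂(rMeas N) ≤ hardyConst N * dnorm N ψ ^ 2 := by
  have h := hardy_lintegral_rMeas hN hψ
  rw [← ofReal_integral_eq_lintegral_ofReal (integrable_hardy hN hψ)
    (Eventually.of_forall fun r => by positivity)] at h
  exact (ENNReal.ofReal_le_ofReal_iff (mul_nonneg (hardyConst_nonneg N) (sq_nonneg _))).1 h

end Energy

/-! ### Linearity, differentiation and uniqueness of primitives. -/

theorem tailInt_congr {N : ℕ} (hN : 1 ≤ N) {ψ φ : ℝ → ℝ} (h : ψ =ᵐ[rMeas N] φ) {r : ℝ}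
    (hr : 0 < r) : tailInt ψ r = tailInt φ r := by
  have h' : ψ =ᵐ[volume.restrict (Ioi (0 : ℝ))] φ := (rMeas_ae_iff hN).1 h
  rw [tailInt, tailInt]
  congr 1
  exact integral_congr_ae (ae_restrict_of_ae_restrict_of_subset (Ioi_subset_Ioi hr.le) h')

theorem tailInt_add {N : ℕ} (hN : 3 ≤ N) {ψ φ : ℝ → ℝ} (hψ : MemLp ψ 2 (rMeas N))
    (hφ : MemLp φ 2 (rMeas N)) {r : ℝ} (hr : 0 < r) :
    tailInt (ψ + φ) r = tailInt ψ r + tailInt φ r := by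
  have := integral_add (integrableOn_Ioi hN hψ hr) (integrableOn_Ioi hN hφ hr)
  simp only [tailInt, Pi.add_apply, this]; ring

theorem tailInt_const_mul (c : ℝ) (ψ : ℝ → ℝ) (r : ℝ) :
    tailInt (fun s => c * ψ s) r = c * tailInt ψ r := by
  simp only [tailInt, integral_const_mul]; ring

/-- Lebesgue differentiation. Since `ψ` need not be integrable at `0`, it is applied to the
truncations to `(1 / (n + 1), ∞)`, and countably many null sets are discarded. -/
theorem ae_hasDerivAt_tailInt {N : ℕ} (hN : 3 ≤ N) {ψ : ℝ → ℝ} (hψ : MemLp ψ 2 (rMeas N)) :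
    ∀ᵐ r, 0 < r → HasDerivAt (tailInt ψ) (ψ r) r := by
  have key : ∀ n : ℕ, ∀ᵐ r, 1 / ((n : ℝ) + 1) < r → HasDerivAt (tailInt ψ) (ψ r) r := by
    intro n
    set a : ℝ := 1 / ((n : ℝ) + 1) with ha
    have ha0 : 0 < a := by positivity
    have hi : Integrable ((Ioi a).indicator ψ) :=
      (integrable_indicator_iff measurableSet_Ioi).2 (integrableOn_Ioi hN hψ ha0)
    filter_upwards [LocallyIntegrable.ae_hasDerivAt_integral hi.locallyIntegrable] with r hr har
    have h1 := (hr a).add_const (tailInt ψ a)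
    have h2 : (Ioi a).indicator ψ r = ψ r := indicator_of_mem (by simpa using har) _
    rw [h2] at h1
    refine h1.congr_of_eventuallyEq ?_
    filter_upwards [Ioi_mem_nhds har] with s hs
    rw [← sub_eq_iff_eq_add, tailInt_sub hN hψ ha0 (ha0.trans hs)]
    refine intervalIntegral.integral_congr_ae (Eventually.of_forall fun t ht => ?_)
    rw [uIoc_of_le (le_of_lt hs)] at ht
    exact (indicator_of_mem (by simpa using ht.1) _).symm
  filter_upwards [ae_all_iff.2 key] with r hr h0
  obtain ⟨n, hn⟩ := exists_nat_one_div_lt h0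
  exact hr n hn

/-- A primitive determines its derivative; this is what makes the weak gradient unique. -/
theorem ae_eq_of_tailInt_eq {N : ℕ} (hN : 3 ≤ N) {ψ φ : ℝ → ℝ} (hψ : MemLp ψ 2 (rMeas N))
    (hφ : MemLp φ 2 (rMeas N)) (h : ∀ r, 0 < r → tailInt ψ r = tailInt φ r) :
    ψ =ᵐ[rMeas N] φ := by
  refine (rMeas_ae_iff (by omega)).2 ?_
  rw [ae_restrict_iff' measurableSet_Ioi]
  filter_upwards [ae_hasDerivAt_tailInt hN hψ, ae_hasDerivAt_tailInt hN hφ] with r h1 h2 hr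
  refine (h1 hr).unique ((h2 hr).congr_of_eventuallyEq ?_)
  filter_upwards [Ioi_mem_nhds hr] with s hs using h s hs

/-- Continuous functions on `(0, ∞)` that agree almost everywhere agree. -/
theorem eq_of_ae_eq_of_continuousOn {N : ℕ} (hN : 1 ≤ N) {F G : ℝ → ℝ}
    (hF : ContinuousOn F (Ioi 0)) (hG : ContinuousOn G (Ioi 0)) (h : F =ᵐ[rMeas N] G)
    {r : ℝ} (hr : 0 < r) : F r = G r :=
  Measure.eqOn_open_of_ae_eq ((rMeas_ae_iff hN).1 h) isOpen_Ioi hF hG hr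

/-! ## The radial Hilbert space -/

section Space

variable (N : ℕ) [hN : Fact (3 ≤ N)] (V : ℝ → ℝ)

theorem three_le : 3 ≤ N := hN.out

theorem one_le_dim : 1 ≤ N := by have := hN.out; omega

theorem tailInt_coe_add (a b : Lp ℝ 2 (rMeas N)) {r : ℝ} (hr : 0 < r) :
    tailInt ⇑(a + b) r = tailInt a r + tailInt b r := by
  rw [← tailInt_add hN.out (Lp.memLp a) (Lp.memLp b) hr]
  exact tailInt_congr (one_le_dim N) (Lp.coeFn_add a b) hr

theorem tailInt_coe_smul (c : ℝ) (a : Lp ℝ 2 (rMeas N)) {r : ℝ} (hr : 0 < r) :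
    tailInt ⇑(c • a) r = c * tailInt a r := by
  rw [← tailInt_const_mul]
  exact tailInt_congr (one_le_dim N) (Lp.coeFn_smul c a) hr

theorem tailInt_coe_zero {r : ℝ} (hr : 0 < r) : tailInt ⇑(0 : Lp ℝ 2 (rMeas N)) r = 0 := by
  have := tailInt_coe_smul N 0 (0 : Lp ℝ 2 (rMeas N)) hr
  simpa using this

/-- The pairs `(U', √V U)` in `L² × L²`, where `U` vanishes at infinity. -/
def radSpace : Submodule ℝ (WithLp 2 (Lp ℝ 2 (rMeas N) × Lp ℝ 2 (rMeas N))) where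
  carrier := {p | (p.snd : ℝ → ℝ) =ᵐ[rMeas N] fun r => √(V r) * tailInt p.fst r}
  zero_mem' := by
    show ⇑(0 : Lp ℝ 2 (rMeas N)) =ᵐ[rMeas N] fun r => √(V r) * tailInt ⇑(0 : Lp ℝ 2 (rMeas N)) r
    filter_upwards [Lp.coeFn_zero ℝ 2 (rMeas N), rMeas_ae_pos (one_le_dim N)] with r h hr
    rw [h, tailInt_coe_zero N hr]; simp
  add_mem' := by
    intro p q hp hq
    show ⇑(p.snd + q.snd) =ᵐ[rMeas N] fun r => √(V r) * tailInt ⇑(p.fst + q.fst) r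
    filter_upwards [Lp.coeFn_add p.snd q.snd, rMeas_ae_pos (one_le_dim N), hp, hq]
      with r h hr h1 h2
    rw [h, tailInt_coe_add N _ _ hr, Pi.add_apply, h1, h2]; ring
  smul_mem' := by
    intro c p hp
    show ⇑(c • p.snd) =ᵐ[rMeas N] fun r => √(V r) * tailInt ⇑(c • p.fst) r
    filter_upwards [Lp.coeFn_smul c p.snd, rMeas_ae_pos (one_le_dim N), hp] with r h hr h1
    rw [h, tailInt_coe_smul N _ _ hr, Pi.smul_apply, h1, smul_eq_mul]; ring

/-- The Hilbert space of radial functions `U` with `∫ |U'|² + V U² < ∞`. -/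
abbrev RadSpace : Type := radSpace N V

/-- Convergence of the first components in `L²` forces pointwise convergence of their primitives by
the decay estimate, while the second components converge almost everywhere along a subsequence; so
the relation between the two survives in the limit. Completeness of the radial space follows. -/
theorem isClosed_radSpace :
    IsClosed (radSpace N V : Set (WithLp 2 (Lp ℝ 2 (rMeas N) × Lp ℝ 2 (rMeas N)))) := by
  refine IsSeqClosed.isClosed fun x p hx hlim => ?_
  have hf : Tendsto (fun n => (x n).fst) atTop (𝓝 p.fst) :=
    ((WithLp.prod_continuous_ofLp 2 _ _).fst.tendsto p).comp hlim
  have hs : Tendsto (fun n => (x n).snd) atTop (𝓝 p.snd) :=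
    ((WithLp.prod_continuous_ofLp 2 _ _).snd.tendsto p).comp hlim
  obtain ⟨ns, hns, hae⟩ := (tendstoInMeasure_of_tendsto_Lp hs).exists_seq_tendsto_ae
  have hT : ∀ r, 0 < r → Tendsto (fun n => tailInt (x n).fst r) atTop (𝓝 (tailInt p.fst r)) := by
    intro r hr
    rw [tendsto_iff_norm_sub_tendsto_zero]
    have hb : ∀ n, ‖tailInt (x n).fst r - tailInt p.fst r‖
        ≤ decayConst N * ‖(x n).fst - p.fst‖ * decay N r := by
      intro n
      have e : tailInt (x n).fst r - tailInt p.fst r = tailInt ⇑((x n).fst - p.fst) r := by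
        have := tailInt_coe_add N ((x n).fst - p.fst) p.fst hr
        rw [sub_add_cancel] at this
        linarith
      have hd : dnorm N ⇑((x n).fst - p.fst) = ‖(x n).fst - p.fst‖ := by
        rw [dnorm, Real.sqrt_eq_iff_mul_self_eq (integral_nonneg fun _ => sq_nonneg _)
          (norm_nonneg _), ← real_inner_self_eq_norm_mul_norm, L2.inner_def]
        simp [sq]
      rw [e, Real.norm_eq_abs, ← hd]
      exact abs_tailInt_le hN.out (Lp.memLp _) hr
    refine squeeze_zero (fun _ => norm_nonneg _) hb ?_
    have h0 := (tendsto_iff_norm_sub_tendsto_zero.1 hf).const_mul (decayConst N)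
    simpa using h0.mul_const (decay N r)
  show (p.snd : ℝ → ℝ) =ᵐ[rMeas N] fun r => √(V r) * tailInt p.fst r
  filter_upwards [hae, ae_all_iff.2 hx, rMeas_ae_pos (one_le_dim N)] with r h1 h2 hr
  refine tendsto_nhds_unique h1 ?_
  have := ((hT r hr).comp hns.tendsto_atTop).const_mul √(V r)
  refine this.congr fun n => ?_
  exact (h2 (ns n)).symm

instance : CompleteSpace (RadSpace N V) := (isClosed_radSpace N V).completeSpace_coe

variable {N V}

/-- The derivative of an element of `RadSpace`. -/
def der (p : RadSpace N V) : ℝ → ℝ := p.1.fst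

/-- The values of an element of `RadSpace`. -/
def val (p : RadSpace N V) : ℝ → ℝ := tailInt (der p)

theorem memLp_der (p : RadSpace N V) : MemLp (der p) 2 (rMeas N) := Lp.memLp _

theorem snd_ae (p : RadSpace N V) :
    (p.1.snd : ℝ → ℝ) =ᵐ[rMeas N] fun r => √(V r) * val p r := p.2

theorem continuousOn_val (p : RadSpace N V) : ContinuousOn (val p) (Ioi 0) :=
  continuousOn_tailInt hN.out (memLp_der p)

theorem val_add (p q : RadSpace N V) {r : ℝ} (hr : 0 < r) : val (p + q) r = val p r + val q r :=
  tailInt_coe_add N _ _ hr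

theorem val_smul (c : ℝ) (p : RadSpace N V) {r : ℝ} (hr : 0 < r) :
    val (c • p) r = c * val p r :=
  tailInt_coe_smul N c _ hr

theorem val_zero {r : ℝ} (hr : 0 < r) : val (0 : RadSpace N V) r = 0 :=
  tailInt_coe_zero N hr

theorem val_sub (p q : RadSpace N V) {r : ℝ} (hr : 0 < r) : val (p - q) r = val p r - val q r := by
  have := val_add (p - q) q hr
  rw [sub_add_cancel] at this
  linarith

theorem integrable_der_mul (p q : RadSpace N V) :
    Integrable (fun r => der p r * der q r) (rMeas N) :=
  (memLp_der p).integrable_mul (memLp_der q)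

theorem sqrt_mul_sqrt_ae (hV : ∀ r, 0 < r → 0 ≤ V r) (p q : RadSpace N V) :
    (fun r => p.1.snd r * q.1.snd r) =ᵐ[rMeas N] fun r => V r * (val p r * val q r) := by
  filter_upwards [snd_ae p, snd_ae q, rMeas_ae_pos (one_le_dim N)] with r h1 h2 hr
  rw [h1, h2]
  have := Real.mul_self_sqrt (hV r hr)
  linear_combination (val p r * val q r) * this

theorem integrable_V_mul (hV : ∀ r, 0 < r → 0 ≤ V r) (p q : RadSpace N V) :
    Integrable (fun r => V r * (val p r * val q r)) (rMeas N) :=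
  ((Lp.memLp p.1.snd).integrable_mul (Lp.memLp q.1.snd)).congr (sqrt_mul_sqrt_ae hV p q)

theorem inner_eq (hV : ∀ r, 0 < r → 0 ≤ V r) (p q : RadSpace N V) :
    inner ℝ p q = ∫ r, der p r * der q r ∂(rMeas N)
      + ∫ r, V r * (val p r * val q r) ∂(rMeas N) := by
  rw [Submodule.coe_inner, WithLp.prod_inner_apply, L2.inner_def, L2.inner_def]
  congr 1
  · refine integral_congr_ae (Eventually.of_forall fun r => ?_)
    simp [der, mul_comm]
  · refine integral_congr_ae ?_
    filter_upwards [sqrt_mul_sqrt_ae hV p q] with r hr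
    rw [← hr]; simp [mul_comm]

theorem norm_sq_eq (hV : ∀ r, 0 < r → 0 ≤ V r) (p : RadSpace N V) :
    ‖p‖ ^ 2 = dnorm N (der p) ^ 2 + ∫ r, V r * val p r ^ 2 ∂(rMeas N) := by
  rw [← real_inner_self_eq_norm_sq, inner_eq hV, dnorm_sq]
  simp only [sq]

theorem dnorm_der_le (hV : ∀ r, 0 < r → 0 ≤ V r) (p : RadSpace N V) : dnorm N (der p) ≤ ‖p‖ := by
  refine (sq_le_sq₀ (dnorm_nonneg N _) (norm_nonneg _)).1 ?_
  rw [norm_sq_eq hV]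
  have : 0 ≤ ∫ r, V r * val p r ^ 2 ∂(rMeas N) := by
    refine integral_nonneg_of_ae ?_
    filter_upwards [rMeas_ae_pos (one_le_dim N)] with r hr
    exact mul_nonneg (hV r hr) (sq_nonneg _)
  linarith

theorem integral_V_sq_le (hV : ∀ r, 0 < r → 0 ≤ V r) (p : RadSpace N V) :
    ∫ r, V r * val p r ^ 2 ∂(rMeas N) ≤ ‖p‖ ^ 2 := by
  rw [norm_sq_eq hV]
  have := sq_nonneg (dnorm N (der p))
  linarith

theorem abs_val_le_dnorm (p : RadSpace N V) {r : ℝ} (hr : 0 < r) :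
    |val p r| ≤ decayConst N * dnorm N (der p) * decay N r :=
  abs_tailInt_le hN.out (memLp_der p) hr

theorem abs_val_le (hV : ∀ r, 0 < r → 0 ≤ V r) (p : RadSpace N V) {r : ℝ} (hr : 0 < r) :
    |val p r| ≤ decayConst N * ‖p‖ * decay N r := by
  refine (abs_val_le_dnorm p hr).trans ?_
  have := decay_pos N hr
  have := decayConst_nonneg N
  have := dnorm_der_le hV p
  gcongr

theorem integrable_V_abs (hV : ∀ r, 0 < r → 0 ≤ V r) (p q : RadSpace N V) :
    Integrable (fun r => V r * (|val p r| * |val q r|)) (rMeas N) := by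
  refine (integrable_V_mul hV p q).norm.congr ?_
  filter_upwards [rMeas_ae_pos (one_le_dim N)] with r hr
  rw [Real.norm_eq_abs, abs_mul, abs_mul, abs_of_nonneg (hV r hr)]

/-- Cauchy–Schwarz for the weight `V`, in the form with absolute values needed for dominations: by
homogeneity both vectors may be taken of norm one, and then `2 |x| |y| ≤ x² + y²` suffices. -/
theorem integral_V_abs_le (hV : ∀ r, 0 < r → 0 ≤ V r) (p q : RadSpace N V) :
    ∫ r, V r * (|val p r| * |val q r|) ∂(rMeas N) ≤ ‖p‖ * ‖q‖ := by
  have key : ∀ p q : RadSpace N V, ‖p‖ ≤ 1 → ‖q‖ ≤ 1 →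
      ∫ r, V r * (|val p r| * |val q r|) ∂(rMeas N) ≤ 1 := by
    intro p q hp hq
    have h1 := integral_V_sq_le hV p
    have h2 := integral_V_sq_le hV q
    have hi : ∀ p : RadSpace N V, Integrable (fun r => V r * val p r ^ 2) (rMeas N) := fun p => by
      simpa only [sq] using integrable_V_mul hV p p
    calc _ ≤ ∫ r, (1 / 2 * (V r * val p r ^ 2) + 1 / 2 * (V r * val q r ^ 2)) ∂(rMeas N) := by
          refine integral_mono_ae (integrable_V_abs hV p q)
            (((hi p).const_mul _).add ((hi q).const_mul _)) ?_
          filter_upwards [rMeas_ae_pos (one_le_dim N)] with r hr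
          have := hV r hr
          have h3 := sq_nonneg (|val p r| - |val q r|)
          have h4 := sq_abs (val p r)
          have h5 := sq_abs (val q r)
          nlinarith [mul_nonneg this h3]
      _ = 1 / 2 * ∫ r, V r * val p r ^ 2 ∂(rMeas N)
          + 1 / 2 * ∫ r, V r * val q r ^ 2 ∂(rMeas N) := by
          rw [integral_add ((hi p).const_mul _) ((hi q).const_mul _), integral_const_mul,
            integral_const_mul]
      _ ≤ 1 := by nlinarith [norm_nonneg p, norm_nonneg q]
  rcases eq_or_ne p 0 with rfl | hp
  · rw [integral_congr_ae (g := fun _ => 0)]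
    · simp
    · filter_upwards [rMeas_ae_pos (one_le_dim N)] with r hr
      simp [val_zero hr]
  rcases eq_or_ne q 0 with rfl | hq
  · rw [integral_congr_ae (g := fun _ => 0)]
    · simp
    · filter_upwards [rMeas_ae_pos (one_le_dim N)] with r hr
      simp [val_zero hr]
  have hp' := norm_pos_iff.2 hp
  have hq' := norm_pos_iff.2 hq
  have h := key (‖p‖⁻¹ • p) (‖q‖⁻¹ • q) (by rw [norm_smul, norm_inv, norm_norm, inv_mul_cancel₀ hp'.ne'])
    (by rw [norm_smul, norm_inv, norm_norm, inv_mul_cancel₀ hq'.ne'])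
  have e : ∫ r, V r * (|val (‖p‖⁻¹ • p) r| * |val (‖q‖⁻¹ • q) r|) ∂(rMeas N)
      = (‖p‖⁻¹ * ‖q‖⁻¹) * ∫ r, V r * (|val p r| * |val q r|) ∂(rMeas N) := by
    rw [← integral_const_mul]
    refine integral_congr_ae ?_
    filter_upwards [rMeas_ae_pos (one_le_dim N)] with r hr
    rw [val_smul _ _ hr, val_smul _ _ hr, abs_mul, abs_mul, abs_of_pos (inv_pos.2 hp'),
      abs_of_pos (inv_pos.2 hq')]
    ring
  rw [e, ← mul_inv, inv_mul_le_iff₀ (by positivity), mul_one] at h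
  exact h

/-- The element of `RadSpace` with given derivative. -/
def mkRad (ψ : ℝ → ℝ) (hψ : MemLp ψ 2 (rMeas N))
    (hv : MemLp (fun r => √(V r) * tailInt ψ r) 2 (rMeas N)) : RadSpace N V :=
  ⟨WithLp.toLp 2 (hψ.toLp ψ, hv.toLp _), by
    show ⇑(hv.toLp _) =ᵐ[rMeas N] fun r => √(V r) * tailInt ⇑(hψ.toLp ψ) r
    filter_upwards [hv.coeFn_toLp, rMeas_ae_pos (one_le_dim N)] with r h hr
    rw [h, tailInt_congr (one_le_dim N) hψ.coeFn_toLp hr]⟩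

theorem der_mkRad {ψ : ℝ → ℝ} (hψ : MemLp ψ 2 (rMeas N))
    (hv : MemLp (fun r => √(V r) * tailInt ψ r) 2 (rMeas N)) :
    der (mkRad ψ hψ hv) =ᵐ[rMeas N] ψ := hψ.coeFn_toLp

theorem val_mkRad {ψ : ℝ → ℝ} (hψ : MemLp ψ 2 (rMeas N))
    (hv : MemLp (fun r => √(V r) * tailInt ψ r) 2 (rMeas N)) {r : ℝ} (hr : 0 < r) :
    val (mkRad ψ hψ hv) r = tailInt ψ r :=
  tailInt_congr (one_le_dim N) hψ.coeFn_toLp hr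

end Space

/-! ## Ekeland's principle and the mountain pass theorem -/

/-- **Ekeland's variational principle.** -/
theorem ekeland {X : Type*} [MetricSpace X] [CompleteSpace X] {Φ : X → ℝ}
    (hΦ : LowerSemicontinuous Φ) (hb : BddBelow (range Φ)) {ε : ℝ} (hε : 0 < ε) (x₀ : X) :
    ∃ x, Φ x ≤ Φ x₀ ∧ ∀ y, Φ x ≤ Φ y + ε * dist x y := by
  -- `y ∈ S x` is Ekeland's order. The sets are closed and decrease along the order; choosing at
  -- each stage a point that almost minimizes `Φ` on the current set makes their diameters shrink
  -- geometrically.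
  set S : X → Set X := fun x => {y | Φ y + ε * dist x y ≤ Φ x} with hS
  have hself : ∀ x, x ∈ S x := fun x => by simp [hS]
  have htrans : ∀ x y z, y ∈ S x → z ∈ S y → z ∈ S x := by
    intro x y z h1 h2
    simp only [hS, mem_ofPred_eq] at h1 h2 ⊢
    nlinarith [dist_triangle x y z]
  have hclosed : ∀ x, IsClosed (S x) := by
    intro x
    have : LowerSemicontinuous fun y => Φ y + ε * dist x y :=
      hΦ.add (by fun_prop : Continuous fun y => ε * dist x y).lowerSemicontinuous
    exact this.isClosed_preimage (Φ x)
  have hex : ∀ (n : ℕ) (x : X), ∃ y ∈ S x, ∀ z ∈ S x, Φ y ≤ Φ z + (1 / 2) ^ n := by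
    intro n x
    have hne : (Φ '' S x).Nonempty := ⟨_, x, hself x, rfl⟩
    have hbd : BddBelow (Φ '' S x) := hb.mono (image_subset_range _ _)
    obtain ⟨_, ⟨y, hy, rfl⟩, hlt⟩ := exists_lt_of_csInf_lt hne
      (lt_add_of_pos_right (sInf (Φ '' S x)) (by positivity : (0 : ℝ) < (1 / 2) ^ n))
    exact ⟨y, hy, fun z hz => hlt.le.trans (by
      have := csInf_le hbd ⟨z, hz, rfl⟩
      linarith)⟩
  choose nxt hn1 hn2 using hex
  set u : ℕ → X := fun n => Nat.rec x₀ (fun k x => nxt k x) n with hu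
  have hu1 : ∀ n, u (n + 1) ∈ S (u n) := fun n => hn1 n (u n)
  have hu2 : ∀ n, ∀ z ∈ S (u n), Φ (u (n + 1)) ≤ Φ z + (1 / 2) ^ n := fun n => hn2 n (u n)
  have hmem : ∀ n k, u (n + k) ∈ S (u n) := by
    intro n k
    induction k with
    | zero => exact hself _
    | succ k ih => exact htrans _ _ _ ih (hu1 (n + k))
  have hdist : ∀ n, ∀ z ∈ S (u (n + 1)), ε * dist (u (n + 1)) z ≤ (1 / 2) ^ n := by
    intro n z hz
    have h1 := hu2 n z (htrans _ _ _ (hu1 n) hz)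
    simp only [hS, mem_ofPred_eq] at hz
    linarith
  have hd1 : ∀ n, dist (u (n + 1)) (u (n + 1 + 1)) ≤ ε⁻¹ * (1 / 2) ^ n := by
    intro n
    rw [← div_eq_inv_mul, le_div_iff₀ hε, mul_comm]
    exact hdist n _ (hu1 (n + 1))
  have hc : CauchySeq fun n => u (n + 1) :=
    cauchySeq_of_le_geometric (1 / 2) ε⁻¹ (by norm_num) hd1
  obtain ⟨x, hx⟩ := cauchySeq_tendsto_of_complete hc
  have hxS : ∀ n, x ∈ S (u n) := by
    intro n
    refine (hclosed (u n)).mem_of_tendsto hx ?_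
    filter_upwards [eventually_ge_atTop n] with k hk
    obtain ⟨j, rfl⟩ := Nat.exists_eq_add_of_le hk
    exact hmem n (j + 1)
  refine ⟨x, ?_, fun y => ?_⟩
  · have := hxS 0
    simp only [hS, mem_ofPred_eq] at this
    have h0 : u 0 = x₀ := rfl
    rw [h0] at this
    nlinarith [dist_nonneg (x := x₀) (y := x)]
  -- A point below the limit lies in every set of the decreasing sequence, so it is the limit
  -- itself; for any other point the claim is the negation of membership.
  · by_cases hy : y ∈ S x
    · have h1 : ∀ n, dist (u (n + 1)) y ≤ ε⁻¹ * (1 / 2) ^ n := by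
        intro n
        rw [← div_eq_inv_mul, le_div_iff₀ hε, mul_comm]
        exact hdist n _ (htrans _ _ _ (hxS (n + 1)) hy)
      have h2 : Tendsto (fun n => dist (u (n + 1)) y) atTop (𝓝 0) := by
        refine squeeze_zero (fun _ => dist_nonneg) h1 ?_
        simpa using (tendsto_pow_atTop_nhds_zero_of_lt_one (by norm_num : (0 : ℝ) ≤ 1 / 2)
          (by norm_num)).const_mul ε⁻¹
      have h3 := tendsto_nhds_unique hx (tendsto_iff_dist_tendsto_zero.2 h2)
      subst h3
      simp
    · simp only [hS, mem_ofPred_eq, not_le] at hy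
      exact hy.le

section MountainPass

variable {H : Type*} [NormedAddCommGroup H] [InnerProductSpace ℝ H]

theorem exists_mean_value {I : H → ℝ} {I' : H → StrongDual ℝ H}
    (hd : ∀ x v (t : ℝ), HasDerivAt (fun t : ℝ => I (x + t • v)) (I' (x + t • v) v) t) (x v : H) :
    ∃ θ ∈ Ioo (0 : ℝ) 1, I (x + v) - I x = I' (x + θ • v) v := by
  obtain ⟨θ, hθ, h⟩ := exists_hasDerivAt_eq_slope (fun t : ℝ => I (x + t • v))
    (fun t => I' (x + t • v) v) one_pos
    (fun t _ => (hd x v t).continuousAt.continuousWithinAt) (fun t _ => hd x v t)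
  refine ⟨θ, hθ, ?_⟩
  rw [h]; simp

/-- The functionals below are differentiated along lines only; with a continuous, hence locally
bounded, derivative the mean value theorem gives continuity. -/
theorem continuous_of_line_deriv {I : H → ℝ} {I' : H → StrongDual ℝ H}
    (hd : ∀ x v (t : ℝ), HasDerivAt (fun t : ℝ => I (x + t • v)) (I' (x + t • v) v) t)
    (hc : Continuous I') : Continuous I := by
  rw [continuous_iff_continuousAt]
  intro x
  have h1 : ∀ᶠ y in 𝓝 x, ‖I' y‖ < ‖I' x‖ + 1 :=
    (hc.norm.continuousAt (x := x)).eventually_lt continuousAt_const (by linarith)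
  obtain ⟨δ, hδ, hb⟩ := Metric.eventually_nhds_iff.1 h1
  rw [ContinuousAt, tendsto_iff_norm_sub_tendsto_zero]
  have h2 : Tendsto (fun y => (‖I' x‖ + 1) * ‖y - x‖) (𝓝 x) (𝓝 0) := by
    have : Continuous fun y => (‖I' x‖ + 1) * ‖y - x‖ := by fun_prop
    simpa using this.tendsto x
  refine squeeze_zero' (Eventually.of_forall fun _ => norm_nonneg _) ?_ h2
  filter_upwards [Metric.ball_mem_nhds x hδ] with y hy
  obtain ⟨θ, hθ, h⟩ := exists_mean_value hd x (y - x)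
  rw [add_sub_cancel] at h
  rw [h]
  refine (ContinuousLinearMap.le_opNorm _ _).trans ?_
  gcongr
  refine (hb ?_).le
  rw [dist_eq_norm, add_sub_cancel_left, norm_smul, Real.norm_eq_abs, abs_of_pos hθ.1]
  rw [mem_ball_iff_norm] at hy
  nlinarith [norm_nonneg (y - x), hθ.2]

/-- **Mountain pass theorem**, without compactness: almost critical points at a level bounded
below by the height of the pass. -/
theorem mountain_pass [CompleteSpace H] {I : H → ℝ} {I' : H → StrongDual ℝ H}
    (hd : ∀ x v (t : ℝ), HasDerivAt (fun t : ℝ => I (x + t • v)) (I' (x + t • v) v) t)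
    (hc : Continuous I') (h0 : I 0 ≤ 0) {ρ c : ℝ} (hρ : 0 < ρ) (hcpos : 0 < c)
    (hsph : ∀ x, ‖x‖ = ρ → c ≤ I x) {e : H} (he : ρ < ‖e‖) (hIe : I e ≤ 0) :
    ∃ B, ∀ ε > 0, ∃ x, c ≤ I x ∧ I x ≤ B ∧ ‖I' x‖ ≤ ε := by
  have hIc := continuous_of_line_deriv hd hc
  set P : Set C(unitInterval, H) := {γ | γ 0 = 0 ∧ γ 1 = e} with hP
  have hPcl : IsClosed P :=
    (isClosed_eq (continuous_eval_const _) continuous_const).inter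
      (isClosed_eq (continuous_eval_const _) continuous_const)
  have : CompleteSpace P := hPcl.completeSpace_coe
  -- A supremum of the continuous functions `γ ↦ I (γ s)`, hence lower semicontinuous, which is all
  -- that Ekeland's principle requires.
  set Φ : P → ℝ := fun γ => ⨆ s : unitInterval, I (γ.1 s) with hΦ
  have hbd : ∀ γ : C(unitInterval, H), BddAbove (range fun s => I (γ s)) := fun γ =>
    (isCompact_range (hIc.comp γ.continuous)).bddAbove
  have hle : ∀ (γ : P) s, I (γ.1 s) ≤ Φ γ := fun γ s => le_ciSup (hbd γ.1) s
  have hmax : ∀ γ : P, ∃ s, I (γ.1 s) = Φ γ := by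
    intro γ
    obtain ⟨s, -, hs⟩ := isCompact_univ.exists_isMaxOn (univ_nonempty (α := unitInterval))
      (hIc.comp γ.1.continuous).continuousOn
    exact ⟨s, le_antisymm (hle γ s) (ciSup_le fun t => hs (mem_univ t))⟩
  have hlsc : LowerSemicontinuous Φ := by
    refine lowerSemicontinuous_ciSup (fun γ => hbd γ.1) fun s => ?_
    exact (hIc.comp ((continuous_eval_const s).comp
      continuous_subtype_val)).lowerSemicontinuous
  have hlow : ∀ γ : P, c ≤ Φ γ := by
    intro γ
    have hcn : Continuous fun s => ‖γ.1 s‖ := γ.1.continuous.norm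
    have hmem : ρ ∈ Icc ‖γ.1 0‖ ‖γ.1 1‖ := by
      rw [γ.2.1, γ.2.2, norm_zero]; exact ⟨hρ.le, he.le⟩
    obtain ⟨s, hs⟩ := mem_range_of_exists_le_of_exists_ge hcn ⟨0, hmem.1⟩ ⟨1, hmem.2⟩
    exact (hsph _ hs).trans (hle γ s)
  set γ₀ : P := ⟨⟨fun s => (s : ℝ) • e, by fun_prop⟩, by simp [hP]⟩ with hγ₀
  refine ⟨Φ γ₀, fun ε hε => ?_⟩
  obtain ⟨γ, hγ1, hγ2⟩ := ekeland hlsc ⟨c, by rintro _ ⟨γ, rfl⟩; exact hlow γ⟩ hε γ₀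
  set M := Φ γ with hM
  have hMpos : 0 < M := hcpos.trans_le (hlow γ)
  set G : H → H := fun x => (InnerProductSpace.toDual ℝ H).symm (I' x) with hG
  have hGc : Continuous G := (InnerProductSpace.toDual ℝ H).symm.continuous.comp hc
  have hGn : ∀ x, ‖G x‖ = ‖I' x‖ := fun x => (InnerProductSpace.toDual ℝ H).symm.norm_map _
  have hGi : ∀ x v, I' x v = inner ℝ (G x) v := fun x v => by
    rw [hG]; simp
  -- The cut-off vanishes where `I ≤ 0`, in particular at both ends, so the deformed path stays
  -- admissible; it equals `1` where the maximum is attained.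
  set χ : unitInterval → ℝ := fun s => max 0 (I (γ.1 s)) / M with hχ
  have hχ0 : ∀ s, 0 ≤ χ s := fun s => by positivity
  have hχ1 : ∀ s, χ s ≤ 1 := fun s => by
    rw [hχ]; exact (div_le_one hMpos).2 (max_le hMpos.le (hle γ s))
  -- A descent field of norm at most one along the path. The maximum with `ε` in the denominator
  -- keeps it continuous where the gradient vanishes.
  set w : C(unitInterval, H) :=
    ⟨fun s => -(χ s / max ‖G (γ.1 s)‖ ε) • G (γ.1 s), by
      have h1 : Continuous fun s => G (γ.1 s) := hGc.comp γ.1.continuous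
      have h2 : Continuous χ := (continuous_const.max (hIc.comp γ.1.continuous)).div_const _
      exact ((h2.div (h1.norm.max continuous_const)
        fun s => (lt_max_of_lt_right hε).ne').neg).smul h1⟩ with hw
  have hws : ∀ s, w s = -(χ s / max ‖G (γ.1 s)‖ ε) • G (γ.1 s) := fun s => rfl
  have hw1 : ∀ s, ‖w s‖ ≤ 1 := by
    intro s
    have hm : 0 < max ‖G (γ.1 s)‖ ε := lt_max_of_lt_right hε
    rw [hws, norm_smul, norm_neg, Real.norm_eq_abs, abs_of_nonneg (div_nonneg (hχ0 s) hm.le),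
      div_mul_eq_mul_div, div_le_one hm]
    calc χ s * ‖G (γ.1 s)‖ ≤ 1 * ‖G (γ.1 s)‖ := by gcongr; exact hχ1 s
      _ ≤ _ := by rw [one_mul]; exact le_max_left _ _
  have hend : ∀ s, I (γ.1 s) ≤ 0 → w s = 0 := by
    intro s hs
    have : χ s = 0 := by rw [hχ]; simp [max_eq_left hs]
    rw [hws, this]; simp
  set t : ℕ → ℝ := fun n => 1 / ((n : ℝ) + 1) with ht
  have htpos : ∀ n, 0 < t n := fun n => by positivity
  have htlim : Tendsto t atTop (𝓝 0) := tendsto_one_div_add_atTop_nhds_zero_nat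
  -- Moving the path by `t w` changes it by at most `t` in the uniform distance, so almost
  -- minimality allows its maximum to drop by at most `ε t`.
  have hstep : ∀ n, ∃ s, M ≤ I (γ.1 s + t n • w s) + ε * t n := by
    intro n
    set γ' : P := ⟨γ.1 + t n • w, by
      constructor
      · rw [ContinuousMap.add_apply, ContinuousMap.smul_apply, hend 0 (by rw [γ.2.1]; exact h0),
          γ.2.1]; simp
      · rw [ContinuousMap.add_apply, ContinuousMap.smul_apply, hend 1 (by rw [γ.2.2]; exact hIe),
          γ.2.2]; simp⟩ with hγ'
    obtain ⟨s, hs⟩ := hmax γ'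
    refine ⟨s, ?_⟩
    have hdd : dist γ γ' ≤ t n := by
      rw [Subtype.dist_eq, ContinuousMap.dist_le (htpos n).le]
      intro s
      rw [hγ', dist_eq_norm]
      simp only [ContinuousMap.add_apply, ContinuousMap.smul_apply, sub_add_cancel_left, norm_neg,
        norm_smul]
      rw [Real.norm_eq_abs, abs_of_pos (htpos n)]
      nlinarith [hw1 s, htpos n]
    have h1 := hγ2 γ'
    rw [← hs] at h1
    have h2 : I (γ'.1 s) = I (γ.1 s + t n • w s) := rfl
    rw [h2] at h1
    nlinarith
  choose s hs using hstep
  -- The points of maximum of the deformed paths accumulate at a point of maximum of the original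
  -- path, and that point is the almost critical one.
  obtain ⟨a, -, φ, hφ, hlim⟩ := isCompact_univ.tendsto_subseq (fun n => mem_univ (s n))
  have htφ : Tendsto (fun n => t (φ n)) atTop (𝓝 0) := htlim.comp hφ.tendsto_atTop
  have hγlim : Tendsto (fun n => γ.1 (s (φ n))) atTop (𝓝 (γ.1 a)) :=
    (γ.1.continuous.tendsto a).comp hlim
  have hwlim : Tendsto (fun n => w (s (φ n))) atTop (𝓝 (w a)) := (w.continuous.tendsto a).comp hlim
  have hMa : I (γ.1 a) = M := by
    refine le_antisymm (hle γ a) ?_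
    have h1 : Tendsto (fun n => I (γ.1 (s (φ n)) + t (φ n) • w (s (φ n))) + ε * t (φ n)) atTop
        (𝓝 (I (γ.1 a + (0 : ℝ) • w a) + ε * 0)) :=
      ((hIc.tendsto _).comp (hγlim.add (htφ.smul hwlim))).add (htφ.const_mul ε)
    simp only [zero_smul, add_zero, mul_zero] at h1
    exact ge_of_tendsto' h1 fun n => hs (φ n)
  have hmv : ∀ n, ∃ θ ∈ Ioo (0 : ℝ) 1, -ε ≤ I' (γ.1 (s n) + (θ * t n) • w (s n)) (w (s n)) := by
    intro n
    obtain ⟨θ, hθ, h⟩ := exists_mean_value hd (γ.1 (s n)) (t n • w (s n))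
    refine ⟨θ, hθ, ?_⟩
    rw [smul_smul, map_smul, smul_eq_mul] at h
    have h1 := hs n
    have h2 := hle γ (s n)
    have h3 := htpos n
    have h4 : t n * (-ε) ≤ t n * I' (γ.1 (s n) + (θ * t n) • w (s n)) (w (s n)) := by
      rw [← h]; linarith
    exact le_of_mul_le_mul_left h4 h3
  choose θ hθ hθ2 using hmv
  have hθt : Tendsto (fun n => θ (φ n) * t (φ n)) atTop (𝓝 0) := by
    refine squeeze_zero (fun n => (mul_pos (hθ _).1 (htpos _)).le) (fun n => ?_) htφ
    nlinarith [(hθ (φ n)).2, htpos (φ n)]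
  have hfin : -ε ≤ I' (γ.1 a) (w a) := by
    have h1 : Tendsto (fun n => I' (γ.1 (s (φ n)) + (θ (φ n) * t (φ n)) • w (s (φ n)))
        (w (s (φ n)))) atTop (𝓝 (I' (γ.1 a + (0 : ℝ) • w a) (w a))) :=
      (isBoundedBilinearMap_apply.continuous.tendsto (_, _)).comp
        (((hc.tendsto _).comp (hγlim.add (hθt.smul hwlim))).prodMk_nhds hwlim)
    rw [zero_smul, add_zero] at h1
    exact ge_of_tendsto' h1 fun n => hθ2 (φ n)
  refine ⟨γ.1 a, by rw [hMa]; exact hlow γ, by rw [hMa]; exact hγ1, ?_⟩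
  have hχa : χ a = 1 := by
    rw [hχ]; simp only [hMa]; rw [max_eq_right hMpos.le, div_self hMpos.ne']
  -- The slope along `w` at the maximum is `-‖I'‖² / max ‖I'‖ ε`; were the norm larger than `ε`,
  -- this would be `-‖I'‖ < -ε`.
  rw [hGi, hws, hχa, inner_smul_right, real_inner_self_eq_norm_sq, hGn] at hfin
  have hm : 0 < max ‖I' (γ.1 a)‖ ε := lt_max_of_lt_right hε
  by_contra hcon
  push Not at hcon
  rw [max_eq_left hcon.le, neg_mul, neg_le_neg_iff, sq, one_div,
    inv_mul_cancel_left₀ (hε.trans hcon).ne'] at hfin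
  linarith

end MountainPass

/-! ## The change of variable and the transformed nonlinearities -/

theorem invChange_zero : invChange 0 = 0 := by simp [invChange]

theorem dualChange_zero : dualChange 0 = 0 := dualChange_spec.1

theorem hasDerivAt_dualChange (t : ℝ) : HasDerivAt dualChange (1 / √(1 + 2 * dualChange t ^ 2)) t :=
  dualChange_spec.2 t

theorem continuous_dualChange : Continuous dualChange :=
  continuous_iff_continuousAt.2 fun t => (hasDerivAt_dualChange t).continuousAt

theorem strictMono_dualChange : StrictMono dualChange :=
  OrderIso.strictMono _

theorem hasDerivAt_sqrt_one_add (w : ℝ) :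
    HasDerivAt (fun w : ℝ => √(1 + 2 * w ^ 2)) (2 * w / √(1 + 2 * w ^ 2)) w := by
  have h : HasDerivAt (fun w : ℝ => 1 + 2 * w ^ 2) (2 * (2 * w)) w := by
    simpa using ((hasDerivAt_pow 2 w).const_mul 2).const_add 1
  convert h.sqrt (by positivity) using 1
  have := (sqrt_one_add_pos w).ne'
  field_simp

/-- Each difference vanishes at `0` and has a nonnegative derivative. All the inequalities on `f`
come from these three, read at `w = f(t)`: `|f(t)| ≤ |t|` and, for `t ≥ 0`, `f'(t) t ≤ f(t) ≤ 2
f'(t) t`. -/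
theorem invChange_bounds {w : ℝ} (hw : 0 ≤ w) :
    w ≤ invChange w ∧ invChange w ≤ w * √(1 + 2 * w ^ 2) ∧ w * √(1 + 2 * w ^ 2) ≤ 2 * invChange w := by
  have hs : ∀ w : ℝ, √(1 + 2 * w ^ 2) * √(1 + 2 * w ^ 2) = 1 + 2 * w ^ 2 := fun w =>
    Real.mul_self_sqrt (by positivity)
  have hd : ∀ w : ℝ, HasDerivAt (fun w : ℝ => w * √(1 + 2 * w ^ 2))
      (1 * √(1 + 2 * w ^ 2) + w * (2 * w / √(1 + 2 * w ^ 2))) w := fun w =>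
    (hasDerivAt_id w).mul (hasDerivAt_sqrt_one_add w)
  refine ⟨?_, ?_, ?_⟩
  · have := monotone_invChange_sub hw
    simp only [invChange_zero] at this; linarith
  · have hm : Monotone fun w => w * √(1 + 2 * w ^ 2) - invChange w := by
      refine monotone_of_hasDerivAt_nonneg (fun w => (hd w).sub (hasDerivAt_invChange w)) fun w => ?_
      have := sqrt_one_add_pos w
      have h2 : 0 ≤ w * (2 * w / √(1 + 2 * w ^ 2)) := by
        rw [← mul_div_assoc]; apply div_nonneg _ this.le; nlinarith [sq_nonneg w]
      show (0 : ℝ) ≤ _; linarith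
    have := hm hw
    simp only [invChange_zero] at this; linarith
  · have hm : Monotone fun w => 2 * invChange w - w * √(1 + 2 * w ^ 2) := by
      refine monotone_of_hasDerivAt_nonneg
        (fun w => ((hasDerivAt_invChange w).const_mul 2).sub (hd w)) fun w => ?_
      have h1 := sqrt_one_add_pos w
      have h2 : w * (2 * w / √(1 + 2 * w ^ 2)) ≤ √(1 + 2 * w ^ 2) := by
        rw [← mul_div_assoc, div_le_iff₀ h1, hs]; nlinarith [sq_nonneg w]
      show (0 : ℝ) ≤ _; linarith
    have := hm hw
    simp only [invChange_zero] at this; linarith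

/-- The reflected function solves the same Cauchy problem. -/
theorem dualChange_neg (t : ℝ) : dualChange (-t) = -dualChange t := by
  have h : (fun t => -dualChange (-t)) = dualChange := by
    refine dualChange_unique (by simp [dualChange_zero]) fun t => ?_
    have h1 := ((hasDerivAt_dualChange (-t)).comp t (hasDerivAt_neg t)).neg
    exact h1.congr_deriv (by simp)
  have := congrFun h t
  linarith

theorem dualChange_nonneg {t : ℝ} (ht : 0 ≤ t) : 0 ≤ dualChange t := by
  rw [← dualChange_zero]; exact strictMono_dualChange.monotone ht

theorem abs_dualChange (t : ℝ) : |dualChange t| = dualChange |t| := by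
  rcases le_total 0 t with h | h
  · rw [abs_of_nonneg h, abs_of_nonneg (dualChange_nonneg h)]
  · have := dualChange_nonneg (neg_nonneg.2 h)
    rw [abs_of_nonpos h, dualChange_neg]
    rw [dualChange_neg] at this
    rw [abs_of_nonpos (by linarith)]

/-- The derivative of the change of variable. -/
def dualSlope (t : ℝ) : ℝ := 1 / √(1 + 2 * dualChange t ^ 2)

theorem dualSlope_pos (t : ℝ) : 0 < dualSlope t := one_div_pos.2 (sqrt_one_add_pos _)

theorem dualSlope_sq (t : ℝ) : dualSlope t ^ 2 * (1 + 2 * dualChange t ^ 2) = 1 := by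
  rw [dualSlope, div_pow, Real.sq_sqrt (by positivity), one_pow, one_div, inv_mul_cancel₀ (by positivity)]

theorem dualSlope_le_one (t : ℝ) : dualSlope t ≤ 1 := by
  have h := dualSlope_sq t
  have h1 := dualSlope_pos t
  by_contra hc
  push Not at hc
  nlinarith [sq_nonneg (dualSlope t * dualChange t)]

theorem abs_dualChange_mul_dualSlope_le (t : ℝ) : |dualChange t| * dualSlope t ≤ 1 := by
  have h := dualSlope_sq t
  have h1 := dualSlope_pos t
  refine abs_le_of_sq_le_sq' (a := |dualChange t| * dualSlope t) (b := 1) ?_ one_pos.le |>.2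
  rw [mul_pow, sq_abs]
  nlinarith [sq_nonneg (dualSlope t * dualChange t), sq_nonneg (dualSlope t)]

theorem continuous_dualSlope : Continuous dualSlope := by
  unfold dualSlope
  exact continuous_const.div (by have := continuous_dualChange; fun_prop)
    fun t => (sqrt_one_add_pos _).ne'

theorem hasDerivAt_dualSlope (t : ℝ) : HasDerivAt dualSlope (-2 * dualChange t * dualSlope t ^ 4) t := by
  have h1 := (hasDerivAt_sqrt_one_add (dualChange t)).comp t (hasDerivAt_dualChange t)
  have h2 := h1.inv (sqrt_one_add_pos (dualChange t)).ne'
  have e : dualSlope = (fun t => (√(1 + 2 * dualChange t ^ 2))⁻¹) := by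
    funext t; rw [dualSlope, one_div]
  rw [e]
  refine h2.congr_deriv ?_
  have := (sqrt_one_add_pos (dualChange t)).ne'
  simp only [Function.comp]
  field_simp

theorem abs_dualChange_le (t : ℝ) : |dualChange t| ≤ |t| := by
  have h := (invChange_bounds (dualChange_nonneg (abs_nonneg t))).1
  rw [invChange_dualChange] at h
  rwa [abs_dualChange]

/-- On bounded sets of `t` this makes `t²` and `f(t)²` comparable, which is why the Orlicz condition
on `V` reduces to a quadratic one away from the origin. -/
theorem sq_le_dualChange (t : ℝ) : t ^ 2 ≤ dualChange t ^ 2 * (1 + 2 * dualChange t ^ 2) := by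
  have h := (invChange_bounds (dualChange_nonneg (abs_nonneg t))).2.1
  rw [invChange_dualChange, ← abs_dualChange, sq_abs] at h
  have h2 := pow_le_pow_left₀ (abs_nonneg t) h 2
  rwa [mul_pow, sq_abs, sq_abs, Real.sq_sqrt (by positivity)] at h2

theorem dualChange_sq_le (t : ℝ) : dualChange t ^ 2 ≤ 2 * |t| := by
  have h := (invChange_bounds (dualChange_nonneg (abs_nonneg t))).2.2
  rw [invChange_dualChange, ← abs_dualChange, sq_abs] at h
  refine le_trans ?_ h
  have h1 : |dualChange t| ≤ √(1 + 2 * dualChange t ^ 2) := by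
    refine Real.le_sqrt_of_sq_le ?_
    rw [sq_abs]; nlinarith [sq_nonneg (dualChange t)]
  calc dualChange t ^ 2 = |dualChange t| * |dualChange t| := by rw [← sq, sq_abs]
    _ ≤ _ := by gcongr

theorem dualChange_sq_le_sq (t : ℝ) : dualChange t ^ 2 ≤ t ^ 2 :=
  sq_le_sq.2 (abs_dualChange_le t)

theorem dualChange_mul_self_nonneg (t : ℝ) : 0 ≤ dualChange t * t := by
  rcases le_total 0 t with h | h
  · exact mul_nonneg (dualChange_nonneg h) h
  · have := dualChange_nonneg (neg_nonneg.2 h)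
    rw [dualChange_neg] at this
    exact mul_nonneg_of_nonpos_of_nonpos (by linarith) h

theorem dualChange_mul_self_eq (t : ℝ) : dualChange t * t = |dualChange t| * |t| := by
  rw [← abs_mul, abs_of_nonneg (dualChange_mul_self_nonneg t)]

/-- `f² ≤ 2 f f' t`. -/
theorem dualChange_sq_le_two_mul (t : ℝ) : dualChange t ^ 2 ≤ 2 * (dualChange t * dualSlope t * t) := by
  have h := (invChange_bounds (dualChange_nonneg (abs_nonneg t))).2.2
  rw [invChange_dualChange, ← abs_dualChange, sq_abs] at h
  have hs := dualSlope_pos t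
  have e : √(1 + 2 * dualChange t ^ 2) * dualSlope t = 1 := mul_one_div_cancel (sqrt_one_add_pos _).ne'
  have h2 : |dualChange t| ≤ 2 * |t| * dualSlope t := by
    calc |dualChange t| = |dualChange t| * √(1 + 2 * dualChange t ^ 2) * dualSlope t := by
          rw [mul_assoc, e, mul_one]
      _ ≤ _ := by gcongr
  have h3 := mul_le_mul_of_nonneg_left h2 (abs_nonneg (dualChange t))
  have h4 := dualChange_mul_self_eq t
  rw [← sq, sq_abs] at h3
  calc _ ≤ _ := h3
    _ = _ := by linear_combination -2 * dualSlope t * h4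

/-- `f f' t ≤ f²`. -/
theorem dualChange_mul_dualSlope_mul_le (t : ℝ) : dualChange t * dualSlope t * t ≤ dualChange t ^ 2 := by
  have h := (invChange_bounds (dualChange_nonneg (abs_nonneg t))).2.1
  rw [invChange_dualChange, ← abs_dualChange, sq_abs] at h
  have hs := dualSlope_pos t
  have e : √(1 + 2 * dualChange t ^ 2) * dualSlope t = 1 := mul_one_div_cancel (sqrt_one_add_pos _).ne'
  have h2 : |t| * dualSlope t ≤ |dualChange t| := by
    calc |t| * dualSlope t ≤ |dualChange t| * √(1 + 2 * dualChange t ^ 2) * dualSlope t := by gcongr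
      _ = _ := by rw [mul_assoc, e, mul_one]
  have h3 := mul_le_mul_of_nonneg_left h2 (abs_nonneg (dualChange t))
  have h4 := dualChange_mul_self_eq t
  rw [← sq, sq_abs] at h3
  calc _ = |dualChange t| * (|t| * dualSlope t) := by linear_combination dualSlope t * h4
    _ ≤ _ := h3

theorem half_le_dualChange_sq {t : ℝ} (ht : 1 ≤ t) : t / 2 ≤ dualChange t ^ 2 := by
  have h := sq_le_dualChange t
  by_contra hc
  push Not at hc
  nlinarith [sq_nonneg (dualChange t)]

/-- The derivative `f f'` of `f² / 2`. -/
def aFun (t : ℝ) : ℝ := dualChange t * dualSlope t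

theorem continuous_aFun : Continuous aFun := continuous_dualChange.mul continuous_dualSlope

theorem hasDerivAt_dualChange_sq (t : ℝ) :
    HasDerivAt (fun t => 1 / 2 * dualChange t ^ 2) (aFun t) t := by
  refine (((hasDerivAt_dualChange t).pow 2).const_mul (1 / 2 : ℝ)).congr_deriv ?_
  simp only [aFun, dualSlope, Nat.cast_ofNat, Nat.add_one_sub_one, pow_one]; ring

/-- The identity `f'² (1 + 2 f²) = 1` collapses `f'² + f f''` to `f'⁴`, which lies in `(0, 1]`.
Hence `f f'` is `1`-Lipschitz and `f²` is convex; both facts are used. -/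
theorem hasDerivAt_aFun (t : ℝ) : HasDerivAt aFun (dualSlope t ^ 4) t := by
  refine ((hasDerivAt_dualChange t).mul (hasDerivAt_dualSlope t)).congr_deriv ?_
  have h := dualSlope_sq t
  rw [show 1 / √(1 + 2 * dualChange t ^ 2) = dualSlope t from rfl]
  linear_combination -(dualSlope t ^ 2) * h

theorem abs_aFun_sub_le (s t : ℝ) : |aFun s - aFun t| ≤ |s - t| := by
  have := Convex.norm_image_sub_le_of_norm_hasDerivWithin_le (f := aFun)
    (f' := fun t => dualSlope t ^ 4) (C := 1) (s := univ) (x := t) (y := s)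
    (fun x _ => (hasDerivAt_aFun x).hasDerivWithinAt) (fun x _ => by
      rw [Real.norm_eq_abs, abs_of_nonneg (by have := dualSlope_pos x; positivity)]
      exact pow_le_one₀ (dualSlope_pos x).le (dualSlope_le_one x)) convex_univ trivial trivial
  simpa using this

theorem aFun_zero : aFun 0 = 0 := by rw [aFun, dualChange_zero, zero_mul]

/-- The transformed nonlinearity `g(f) f'`. -/
def bFun (g : ℝ → ℝ) (t : ℝ) : ℝ := g (dualChange t) * dualSlope t

/-! ### Growth and superlinearity of the transformed nonlinearity. -/

section Nonlinearity

variable {g : ℝ → ℝ} {q₁ q₂ : ℝ}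

theorem HypG.continuous_bFun (hg : HypG g q₁ q₂) : Continuous (bFun g) :=
  (hg.cont.comp continuous_dualChange).mul continuous_dualSlope

theorem HypG.hasDerivAt_primG (hg : HypG g q₁ q₂) (t : ℝ) : HasDerivAt (primG g) (g t) t :=
  intervalIntegral.integral_hasDerivAt_right (hg.cont.intervalIntegrable _ _)
    hg.cont.aestronglyMeasurable.stronglyMeasurableAtFilter hg.cont.continuousAt

theorem HypG.hasDerivAt_primG_comp (hg : HypG g q₁ q₂) (t : ℝ) :
    HasDerivAt (fun t => primG g (dualChange t)) (bFun g t) t :=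
  (hg.hasDerivAt_primG _).comp t (hasDerivAt_dualChange t)

theorem HypG.continuous_primG_comp (hg : HypG g q₁ q₂) :
    Continuous fun t => primG g (dualChange t) :=
  continuous_iff_continuousAt.2 fun t => (hg.hasDerivAt_primG_comp t).continuousAt

theorem primG_zero (g : ℝ → ℝ) : primG g 0 = 0 := by simp [primG]

/-- The Ambrosetti–Rabinowitz condition survives the change of variable with half the exponent: `f²
≤ 2 f f' t` gives `g(f) f ≤ 2 g(f) f' t`. This is why the hypothesis carries the factor `2 θ`. -/
theorem HypG.primG_le (hg : HypG g q₁ q₂) : ∃ θ : ℝ, 2 < θ ∧ ∀ t,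
    0 ≤ primG g (dualChange t) ∧ θ * primG g (dualChange t) ≤ bFun g t * t := by
  obtain ⟨θ, hθ, h⟩ := hg.superlinear
  refine ⟨θ, hθ, fun t => ?_⟩
  obtain ⟨h1, h2⟩ := h (dualChange t)
  have hG : 0 ≤ primG g (dualChange t) := by
    by_contra hc; push Not at hc; nlinarith
  refine ⟨hG, ?_⟩
  rcases eq_or_ne (dualChange t) 0 with h0 | h0
  · have ht : t = 0 := strictMono_dualChange.injective (by rw [h0, dualChange_zero])
    subst ht
    simp [dualChange_zero, primG_zero]
  · have h3 := dualChange_sq_le_two_mul t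
    have h4 : 0 < dualChange t ^ 2 := by positivity
    have h5 : g (dualChange t) * dualChange t ≤ 2 * (bFun g t * t) := by
      refine le_of_mul_le_mul_right ?_ h4
      have := mul_le_mul_of_nonneg_left h3 (h1.trans h2)
      calc _ ≤ _ := this
        _ = _ := by rw [bFun]; ring
    linarith

/-- For the first bound, `|f| f' ≤ 1` absorbs one power of `f` and `f² ≤ 2 |t|` halves the rest,
giving the exponent `q₁ / 2 - 1`. For the second, only `|f(t)| ≤ |t|` and `f' ≤ 1` are used. -/
theorem HypG.bFun_growth (hg : HypG g q₁ q₂) (h1 : 4 < q₁) (h2 : 4 < q₂) : ∃ C > 0, ∀ t,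
    |bFun g t| ≤ C * |t| ^ (q₁ / 2 - 1) ∧ |bFun g t| ≤ C * |t| ^ (q₂ - 1) := by
  obtain ⟨C, hC, h⟩ := hg.growth
  have hp : (1 : ℝ) ≤ 2 ^ (q₁ / 2 - 1) := Real.one_le_rpow (by norm_num) (by linarith)
  refine ⟨C * 2 ^ (q₁ / 2 - 1), by positivity, fun t => ?_⟩
  have hs := dualSlope_pos t
  have hb : |bFun g t| = |g (dualChange t)| * dualSlope t := by
    rw [bFun, abs_mul, abs_of_pos hs]
  rw [hb]
  constructor
  · have e1 : |dualChange t| ^ (q₁ - 1) * dualSlope t ≤ |dualChange t| ^ (q₁ - 2) := by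
      have : |dualChange t| ^ (q₁ - 1) = |dualChange t| ^ (q₁ - 2) * |dualChange t| := by
        rw [← Real.rpow_add_one' (abs_nonneg _) (by linarith)]; congr 1; ring
      rw [this, mul_assoc]
      exact mul_le_of_le_one_right (by positivity) (abs_dualChange_mul_dualSlope_le t)
    have e2 : |dualChange t| ^ (q₁ - 2) ≤ 2 ^ (q₁ / 2 - 1) * |t| ^ (q₁ / 2 - 1) := by
      rw [← Real.mul_rpow (by norm_num) (abs_nonneg t)]
      have : |dualChange t| ^ (q₁ - 2) = (dualChange t ^ 2) ^ (q₁ / 2 - 1) := by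
        rw [← sq_abs, ← Real.rpow_natCast, ← Real.rpow_mul (abs_nonneg _)]; congr 1; push_cast; ring
      rw [this]
      exact Real.rpow_le_rpow (sq_nonneg _) (dualChange_sq_le t) (by linarith)
    calc |g (dualChange t)| * dualSlope t ≤ C * |dualChange t| ^ (q₁ - 1) * dualSlope t := by
          gcongr
          exact (h _).trans (mul_le_mul_of_nonneg_left (min_le_left _ _) hC.le)
      _ = C * (|dualChange t| ^ (q₁ - 1) * dualSlope t) := by ring
      _ ≤ C * (2 ^ (q₁ / 2 - 1) * |t| ^ (q₁ / 2 - 1)) := mul_le_mul_of_nonneg_left (e1.trans e2) hC.le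
      _ = _ := by ring
  · calc |g (dualChange t)| * dualSlope t ≤ C * |dualChange t| ^ (q₂ - 1) * 1 := by
          gcongr
          · exact (h _).trans (mul_le_mul_of_nonneg_left (min_le_right _ _) hC.le)
          · exact dualSlope_le_one t
      _ ≤ C * |t| ^ (q₂ - 1) := by
          rw [mul_one]
          exact mul_le_mul_of_nonneg_left
            (Real.rpow_le_rpow (abs_nonneg _) (abs_dualChange_le t) (by linarith)) hC.le
      _ ≤ _ := by
          gcongr
          exact le_mul_of_one_le_right hC.le hp

/-- The primitive grows at least like `s^{2θ}`, and `f(t)² ≥ t / 2` for `t ≥ 1` leaves growth `t^θ`,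
still faster than quadratic. -/
theorem HypG.primG_lower (hg : HypG g q₁ q₂) : ∃ θ : ℝ, 2 < θ ∧ ∃ c > 0, ∃ T, ∀ t, T ≤ t →
    c * t ^ θ ≤ primG g (dualChange t) := by
  obtain ⟨θ, hθ, h⟩ := hg.superlinear
  obtain ⟨t₀, ht₀, hpos⟩ := hg.pos
  -- Integrated form of `2 θ G(s) ≤ g(s) s`.
  have hmono : MonotoneOn (fun s => primG g s * s ^ (-(2 * θ))) (Ici t₀) := by
    have hd : ∀ s, 0 < s → HasDerivAt (fun s => primG g s * s ^ (-(2 * θ)))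
        (g s * s ^ (-(2 * θ)) + primG g s * (-(2 * θ) * s ^ (-(2 * θ) - 1))) s := fun s hs =>
      (hg.hasDerivAt_primG s).mul (Real.hasDerivAt_rpow_const (Or.inl hs.ne'))
    refine monotoneOn_of_deriv_nonneg (convex_Ici t₀)
      (fun s hs => (hd s (ht₀.trans_le hs)).continuousAt.continuousWithinAt)
      (fun s hs => ?_) (fun s hs => ?_)
    · rw [interior_Ici] at hs
      exact (hd s (ht₀.trans hs)).differentiableAt.differentiableWithinAt
    · rw [interior_Ici] at hs
      have hs0 : 0 < s := ht₀.trans hs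
      rw [(hd s hs0).deriv, Real.rpow_sub_one hs0.ne']
      have h2 := (h s).2
      have h3 : 0 < s ^ (-(2 * θ)) := Real.rpow_pos_of_pos hs0 _
      have : g s * s ^ (-(2 * θ)) + primG g s * (-(2 * θ) * (s ^ (-(2 * θ)) / s))
          = s ^ (-(2 * θ)) / s * (g s * s - 2 * θ * primG g s) := by
        field_simp
        ring
      rw [this]
      exact mul_nonneg (by positivity) (by linarith)
  set c₀ := primG g t₀ * t₀ ^ (-(2 * θ)) with hc₀
  have hc₀pos : 0 < c₀ := mul_pos hpos (Real.rpow_pos_of_pos ht₀ _)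
  refine ⟨θ, hθ, c₀ * (1 / 2) ^ θ, by positivity, max 1 (invChange t₀), fun t ht => ?_⟩
  have ht1 : 1 ≤ t := (le_max_left _ _).trans ht
  have ht2 : t₀ ≤ dualChange t := by
    have := strictMono_dualChange.monotone ((le_max_right _ _).trans ht)
    have e : dualChange (invChange t₀) = t₀ :=
      strictMono_invChange.injective (invChange_dualChange _)
    rwa [e] at this
  set w := dualChange t with hw
  have hw0 : 0 < w := ht₀.trans_le ht2
  have h1 : c₀ ≤ primG g w * w ^ (-(2 * θ)) := hmono (mem_Ici.2 le_rfl) (mem_Ici.2 ht2) ht2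
  have h2 : c₀ * w ^ (2 * θ) ≤ primG g w := by
    rw [Real.rpow_neg hw0.le] at h1
    rwa [← le_div_iff₀ (by positivity), div_eq_mul_inv]
  have h3 : (1 / 2) ^ θ * t ^ θ ≤ w ^ (2 * θ) := by
    rw [← Real.mul_rpow (by norm_num) (by linarith), Real.rpow_mul hw0.le, Real.rpow_two]
    refine Real.rpow_le_rpow (by positivity) ?_ (by linarith)
    have := half_le_dualChange_sq ht1
    linarith
  calc _ = c₀ * ((1 / 2) ^ θ * t ^ θ) := by ring
    _ ≤ c₀ * w ^ (2 * θ) := by gcongr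
    _ ≤ _ := h2

/-- Truncation of the nonlinearity to nonnegative arguments. -/
theorem HypG.truncate (hg : HypG g q₁ q₂) (h1 : 4 < q₁) (h2 : 4 < q₂) :
    HypG (fun t => g (max t 0)) q₁ q₂ := by
  obtain ⟨C, hC, h⟩ := hg.growth
  have hg0 : g 0 = 0 := by
    have := h 0
    rw [abs_zero, Real.zero_rpow (by linarith), Real.zero_rpow (by linarith)] at this
    simpa using this
  have hprim : ∀ t, primG (fun t => g (max t 0)) t = primG g (max t 0) := by
    intro t
    rcases le_total 0 t with ht | ht
    · rw [max_eq_left ht]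
      refine intervalIntegral.integral_congr fun s hs => ?_
      rw [uIcc_of_le ht] at hs
      simp [max_eq_left hs.1]
    · rw [max_eq_right ht, primG_zero, primG, intervalIntegral.integral_symm]
      rw [intervalIntegral.integral_congr (g := fun _ => (0 : ℝ))]
      · simp
      · intro s hs
        rw [uIcc_of_le ht] at hs
        simp [max_eq_right hs.2, hg0]
  refine ⟨hg.cont.comp (by fun_prop), ?_, ?_, C, hC, fun t => ?_⟩
  · obtain ⟨θ, hθ, hs⟩ := hg.superlinear
    refine ⟨θ, hθ, fun t => ?_⟩
    rw [hprim]
    have := hs (max t 0)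
    refine ⟨this.1, this.2.trans ?_⟩
    rcases le_total 0 t with ht | ht
    · rw [max_eq_left ht]
    · rw [max_eq_right ht, hg0]; simp
  · obtain ⟨t₀, ht₀, hp⟩ := hg.pos
    exact ⟨t₀, ht₀, by rw [hprim, max_eq_left ht₀.le]; exact hp⟩
  · rcases le_total 0 t with ht | ht
    · simpa only [max_eq_left ht] using h t
    · simp only [max_eq_right ht, hg0, abs_zero]
      positivity

end Nonlinearity

/-! ## Pointwise estimates for the nonlinear term -/

theorem rMeas_integrableOn_iff {N : ℕ} (hN : 1 ≤ N) {F : ℝ → ℝ} {s : Set ℝ}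
    (hs : MeasurableSet s) :
    IntegrableOn F s (rMeas N) ↔ IntegrableOn (fun r => r ^ (N - 1) * F r) (s ∩ Ioi 0) := by
  have : (fun r => r ^ (N - 1) * s.indicator F r) = s.indicator (fun r => r ^ (N - 1) * F r) := by
    funext r; by_cases h : r ∈ s <;> simp [h]
  rw [← integrable_indicator_iff hs, rMeas_integrable_iff hN, this, IntegrableOn,
    integrable_indicator_iff hs, IntegrableOn, Measure.restrict_restrict hs, IntegrableOn]

theorem rMeas_integrableOn_Iic_rpow {N : ℕ} (hN : 1 ≤ N) {κ δ : ℝ} (hδ : 0 < δ)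
    (hκ : -(N : ℝ) < κ) : IntegrableOn (fun r => r ^ κ) (Iic δ) (rMeas N) := by
  rw [rMeas_integrableOn_iff hN measurableSet_Iic, inter_comm, Ioi_inter_Iic]
  have h1 : IntegrableOn (fun r : ℝ => r ^ (κ + N - 1)) (Ioc 0 δ) :=
    (intervalIntegrable_iff_integrableOn_Ioc_of_le hδ.le).1
      (intervalIntegral.intervalIntegrable_rpow' (by linarith))
  refine h1.congr_fun (fun r hr => ?_) measurableSet_Ioc
  have hr0 : 0 < r := hr.1
  simp only
  rw [← Real.rpow_natCast, ← Real.rpow_add hr0]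
  congr 1; push_cast [Nat.cast_sub hN]; ring

theorem rMeas_integrableOn_Ioi_rpow {N : ℕ} (hN : 1 ≤ N) {κ R : ℝ} (hR : 0 < R)
    (hκ : κ < -(N : ℝ)) : IntegrableOn (fun r => r ^ κ) (Ioi R) (rMeas N) := by
  rw [rMeas_integrableOn_iff hN measurableSet_Ioi, inter_eq_left.2 (Ioi_subset_Ioi hR.le)]
  have h1 : IntegrableOn (fun r : ℝ => r ^ (κ + N - 1)) (Ioi R) :=
    integrableOn_Ioi_rpow_of_lt (by linarith) hR
  refine h1.congr_fun (fun r hr => ?_) measurableSet_Ioi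
  have hr0 : 0 < r := hR.trans hr
  simp only
  rw [← Real.rpow_natCast, ← Real.rpow_add hr0]
  congr 1; push_cast [Nat.cast_sub hN]; ring

theorem rMeas_integrableOn_Icc {N : ℕ} (hN : 1 ≤ N) {F : ℝ → ℝ} {a b : ℝ} (ha : 0 < a)
    (hF : ContinuousOn F (Ioi 0)) : IntegrableOn F (Icc a b) (rMeas N) := by
  rw [rMeas_integrableOn_iff hN measurableSet_Icc]
  have hsub : Icc a b ⊆ Ioi 0 := fun x hx => ha.trans_le hx.1
  rw [inter_eq_left.2 hsub]
  exact (((continuous_pow _).continuousOn.mul hF).mono hsub).integrableOn_Icc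

theorem continuousOn_decay (N : ℕ) : ContinuousOn (decay N) (Ioi 0) := by
  intro r hr
  have hr' : (0 : ℝ) < r := hr
  exact (Real.continuousAt_rpow_const r _ (Or.inl hr'.ne')).continuousWithinAt

/-- Bounds for the nonlinear term `K g(f(y)) f'(y) w` in terms of the decay of `y` and `w`. -/
structure GrowthBound (N : ℕ) (V K g : ℝ → ℝ) (a b σ C R : ℝ) (m : ℝ → ℝ) : Prop where
  one_lt_a : 1 < a
  two_lt_b : 2 < b
  σ_pos : 0 < σ
  C_nonneg : 0 ≤ C
  one_le_R : 1 ≤ R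
  m_int : ∀ R', IntegrableOn m (Iic R') (rMeas N)
  near : ∀ r, 0 < r → ∀ s τ y w : ℝ, 0 ≤ s → 0 ≤ τ → |y| ≤ s * decay N r → |w| ≤ τ * decay N r →
    K r * (|bFun g y| * |w|) ≤ s ^ a * τ * m r
  far : ∀ r, R < r → ∀ s τ y w : ℝ, 0 ≤ s → 0 ≤ τ → |y| ≤ s * decay N r → |w| ≤ τ * decay N r →
    K r * (|bFun g y| * |w|)
      ≤ C * r ^ (-σ) * s ^ b * (V r * (|y| * |w|) + s * τ * r ^ (-(N : ℝ) - σ))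
  tail_int : IntegrableOn (fun r => r ^ (-(N : ℝ) - σ)) (Ioi R) (rMeas N)

/-- Interpolation at infinity. The factor `(P W)^β` is kept for `v^β`, everything else is estimated
by the decay, and weighted Young separates `v P W` from a pure power. The surplus `2 σ` in the
exponent is shared: one `σ` remains as a small factor in front, the other makes `r^{-N-σ}`
integrable at infinity. -/
theorem far_estimate {N : ℕ} {αi β q σ r s τ P W v : ℝ} (hβ : β ∈ Icc (0 : ℝ) 1) (hq : 4 < q)
    (hσ0 : 0 < σ)
    (hσ : 2 * σ = ((N : ℝ) - 2) / 2 * (q - 2 * β) - αi - N * (1 - β)) (hr : 1 ≤ r) (hs : 0 ≤ s)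
    (hτ : 0 ≤ τ) (hP0 : 0 ≤ P) (hW0 : 0 ≤ W) (hv : 0 ≤ v) (hP : P ≤ s * decay N r)
    (hW : W ≤ τ * decay N r) :
    r ^ αi * v ^ β * (P ^ (q - 1) * W)
      ≤ r ^ (-σ) * s ^ (q - 2) * (v * (P * W) + s * τ * r ^ (-(N : ℝ) - σ)) := by
  have hr0 : 0 < r := by linarith
  have hD := decay_pos N hr0
  set D := decay N r with hDdef
  set k := r ^ (-(N : ℝ) - σ) with hk
  have hk0 : 0 < k := Real.rpow_pos_of_pos hr0 _
  have e1 : P ^ (q - 1) * W = P ^ (q - 2) * (P * W) := by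
    have : P ^ (q - 1) = P ^ (q - 2) * P := by
      rw [← Real.rpow_add_one' hP0 (by linarith)]; congr 1; ring
    rw [this]; ring
  have e2 : P * W = (P * W) ^ β * (P * W) ^ (1 - β) := by
    rw [← Real.rpow_add' (by positivity) (by norm_num)]; simp
  have h1 : P ^ (q - 2) ≤ s ^ (q - 2) * D ^ (q - 2) := by
    rw [← Real.mul_rpow hs hD.le]; exact Real.rpow_le_rpow hP0 hP (by linarith)
  have h2 : (P * W) ^ (1 - β) ≤ (s * τ) ^ (1 - β) * (D * D) ^ (1 - β) := by
    rw [← Real.mul_rpow (by positivity) (by positivity)]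
    refine Real.rpow_le_rpow (by positivity) ?_ (by linarith [hβ.2])
    calc P * W ≤ (s * D) * (τ * D) := by gcongr
      _ = _ := by ring
  -- The exponents of the two sides differ by exactly `σ β ≥ 0`, and `r ≥ 1`.
  have h3 : r ^ αi * D ^ (q - 2) * (D * D) ^ (1 - β) ≤ r ^ (-σ) * k ^ (1 - β) := by
    have : r ^ αi * D ^ (q - 2) * (D * D) ^ (1 - β)
        = r ^ (αi + (-((N : ℝ) - 2) / 2) * (q - 2)
          + ((-((N : ℝ) - 2) / 2) + (-((N : ℝ) - 2) / 2)) * (1 - β)) := by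
      rw [hDdef, decay, ← Real.rpow_add hr0, ← Real.rpow_mul hr0.le, ← Real.rpow_mul hr0.le,
        ← Real.rpow_add hr0, ← Real.rpow_add hr0]
    rw [this, hk, ← Real.rpow_mul hr0.le, ← Real.rpow_add hr0]
    refine Real.rpow_le_rpow_of_exponent_le hr ?_
    nlinarith [mul_nonneg hσ0.le hβ.1]
  have h4 : (v * (P * W)) ^ β * (s * τ * k) ^ (1 - β) ≤ v * (P * W) + s * τ * k := by
    refine (Real.geom_mean_le_arith_mean2_weighted hβ.1 (by linarith [hβ.2]) (by positivity)
      (by positivity) (by ring)).trans ?_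
    have i1 : β * (v * (P * W)) ≤ v * (P * W) :=
      mul_le_of_le_one_left (by positivity) hβ.2
    have i2 : (1 - β) * (s * τ * k) ≤ s * τ * k :=
      mul_le_of_le_one_left (by positivity) (by linarith [hβ.1])
    linarith
  calc r ^ αi * v ^ β * (P ^ (q - 1) * W)
      = r ^ αi * v ^ β * (P ^ (q - 2) * ((P * W) ^ β * (P * W) ^ (1 - β))) := by rw [e1, ← e2]
    _ ≤ r ^ αi * v ^ β * ((s ^ (q - 2) * D ^ (q - 2)) *
        ((P * W) ^ β * ((s * τ) ^ (1 - β) * (D * D) ^ (1 - β)))) := by gcongr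
    _ = s ^ (q - 2) * (v ^ β * (P * W) ^ β) * (s * τ) ^ (1 - β) *
        (r ^ αi * D ^ (q - 2) * (D * D) ^ (1 - β)) := by ring
    _ ≤ s ^ (q - 2) * (v ^ β * (P * W) ^ β) * (s * τ) ^ (1 - β) * (r ^ (-σ) * k ^ (1 - β)) := by
        gcongr
    _ = r ^ (-σ) * s ^ (q - 2) * ((v * (P * W)) ^ β * (s * τ * k) ^ (1 - β)) := by
        rw [Real.mul_rpow hv (by positivity), Real.mul_rpow (by positivity : (0 : ℝ) ≤ s * τ) hk0.le]
        ring
    _ ≤ _ := by gcongr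

/-- Here the conditions on `q₁` and `q₂` enter. Near the origin `V^{β₀}` is bounded by `r^{-2β₀}` up
to a constant and the decay turns the nonlinear term into an integrable power; at infinity the
interpolation estimate applies with `q = q₂`. -/
theorem exists_growthBound {N : ℕ} (hN : 3 ≤ N) {V K g : ℝ → ℝ} {α₀ β₀ αi βi q₁ q₂ : ℝ}
    (hH : HypH V K) (h₁ : HypOne V K α₀ β₀ αi βi) (h₂ : HypTwo N α₀ β₀ αi βi q₁ q₂)
    (hg : HypG g q₁ q₂) : ∃ a b σ C R m, GrowthBound N V K g a b σ C R m := by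
  have hN' : (3 : ℝ) ≤ N := by exact_mod_cast hN
  have hN1 : 1 ≤ N := by omega
  have hq2 : 4 < q₂ := (le_max_left _ _).trans_lt h₂.gt_infty
  obtain ⟨Cb, hCb, hb⟩ := hg.bFun_growth h₂.four_lt hq2
  obtain ⟨R₂, hR₂, C₂, hfar⟩ := h₁.near_infty
  obtain ⟨R₁, hR₁, C₁, hnear⟩ := h₁.near_zero
  obtain ⟨Cv, hCv, hVb⟩ := hH.V_bound
  -- Half of the surplus in the exponent at infinity; it is positive exactly when `q₂` exceeds
  -- `qInfty N αi βi`.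
  set σ : ℝ := (((N : ℝ) - 2) / 2 * (q₂ - 2 * βi) - αi - N * (1 - βi)) / 2 with hσ
  have hσpos : 0 < σ := by
    have hq := h₂.gt_infty
    have hn2 : (0 : ℝ) < N - 2 := by linarith
    -- The hypothesis bounds `q₂` below by twice this number, which may be negative; in that case `4
    -- < q₂` suffices.
    have hQ : qInfty N αi βi < q₂ := by
      rcases le_total 0 (qInfty N αi βi) with h | h
      · have := (le_max_right 4 (2 * qInfty N αi βi)).trans_lt hq
        linarith
      · linarith
    rw [qInfty, ← mul_div_assoc, div_lt_iff₀ hn2] at hQ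
    rw [hσ]; nlinarith
  set m : ℝ → ℝ := fun r => Cb * K r * (decay N r ^ (q₁ / 2 - 1) * decay N r) with hm
  have hmc : ContinuousOn m (Ioi 0) := by
    refine (continuousOn_const.mul hH.K_cont).mul (ContinuousOn.mul ?_ (continuousOn_decay N))
    exact (continuousOn_decay N).rpow_const fun r hr => Or.inl (decay_pos N hr).ne'
  have hm0 : ∀ r, 0 < r → 0 ≤ m r := fun r hr => by
    have := hH.K_pos r hr
    have := decay_pos N hr
    positivity
  refine ⟨q₁ / 2 - 1, q₂ - 2, σ, |C₂| * Cb, max 1 R₂, m, ?_, ?_, hσpos, by positivity,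
    le_max_left _ _, fun R' => ?_, ?_, ?_, ?_⟩
  · linarith [h₂.four_lt]
  · linarith
  · set δ : ℝ := min R₁ 1 / 2 with hδ
    have hδ0 : 0 < δ := by positivity
    have hδ1 : δ < R₁ := by
      have := min_le_left R₁ 1
      rw [hδ]; linarith
    have hδ2 : δ < 1 := by
      have := min_le_right R₁ 1
      rw [hδ]; linarith
    -- The power of `r` that dominates the weight near `0`. Integrability needs `κ > -N`, which
    -- follows from the bound on `q₁` because `β₀ (N + 2) / 2 ≥ 2 β₀`.
    set κ : ℝ := α₀ - 2 * β₀ - ((N : ℝ) - 2) / 2 * (q₁ / 2) with hκ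
    have hκ1 : -(N : ℝ) < κ := by
      have hq := h₂.lt_zero
      have hn2 : (0 : ℝ) < N - 2 := by linarith
      rw [qZero, ← mul_div_assoc, lt_div_iff₀ hn2] at hq
      have := h₁.β₀_mem.1
      rw [hκ]; nlinarith
    have i1 : IntegrableOn m (Iic δ) (rMeas N) := by
      refine Integrable.mono' ((rMeas_integrableOn_Iic_rpow hN1 hδ0 hκ1).const_mul
        (Cb * |C₁| * Cv ^ β₀)) (rMeas_aestronglyMeasurable hN1 hmc).restrict ?_
      filter_upwards [ae_restrict_mem measurableSet_Iic, ae_restrict_of_ae (rMeas_ae_pos hN1)]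
        with r hr hr0
      have hr1 : r ≤ δ := hr
      have hK := hnear r ⟨hr0, hr1.trans_lt hδ1⟩
      have hV0 := hH.V_nonneg r hr0
      have hV := hVb r ⟨hr0, hr1.trans_lt hδ2⟩
      have hD := decay_pos N hr0
      rw [Real.norm_eq_abs, abs_of_nonneg (hm0 r hr0)]
      have hV2 : V r ^ β₀ ≤ Cv ^ β₀ * r ^ (-2 * β₀) := by
        refine (Real.rpow_le_rpow hV0 hV h₁.β₀_mem.1).trans (le_of_eq ?_)
        rw [Real.div_rpow hCv.le (by positivity), Real.rpow_mul hr0.le,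
          show r ^ (-2 : ℝ) = (r ^ 2)⁻¹ by
            rw [Real.rpow_neg hr0.le]; norm_num, Real.inv_rpow (by positivity), div_eq_mul_inv]
      have hK2 : K r ≤ |C₁| * (r ^ α₀ * (Cv ^ β₀ * r ^ (-2 * β₀))) := by
        calc K r ≤ |C₁| * (r ^ α₀ * V r ^ β₀) :=
              hK.trans (mul_le_mul_of_nonneg_right (le_abs_self _) (by positivity))
          _ ≤ _ := by gcongr
      calc m r ≤ Cb * (|C₁| * (r ^ α₀ * (Cv ^ β₀ * r ^ (-2 * β₀)))) *
            (decay N r ^ (q₁ / 2 - 1) * decay N r) := by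
            simp only [hm]; gcongr
        _ = Cb * |C₁| * Cv ^ β₀ * (r ^ α₀ * r ^ (-2 * β₀) *
            (decay N r ^ (q₁ / 2 - 1) * decay N r)) := by ring
        _ = _ := by
            congr 1
            have : decay N r ^ (q₁ / 2 - 1) * decay N r = decay N r ^ (q₁ / 2) := by
              rw [← Real.rpow_add_one hD.ne']; congr 1; ring
            rw [this, decay, ← Real.rpow_mul hr0.le, ← Real.rpow_add hr0, ← Real.rpow_add hr0]
            congr 1; rw [hκ]; ring
    refine (i1.union (rMeas_integrableOn_Icc hN1 (b := R') hδ0 hmc)).mono_set fun r hr => ?_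
    rcases le_total r δ with h | h
    · exact Or.inl h
    · exact Or.inr ⟨h, hr⟩
  · intro r hr s τ y w hs hτ hy hw
    have hK := hH.K_pos r hr
    have hD := decay_pos N hr
    have e : (0 : ℝ) ≤ q₁ / 2 - 1 := by linarith [h₂.four_lt]
    calc K r * (|bFun g y| * |w|)
        ≤ K r * ((Cb * (s * decay N r) ^ (q₁ / 2 - 1)) * (τ * decay N r)) := by
          gcongr
          exact (hb y).1.trans (by gcongr)
      _ = _ := by
          rw [Real.mul_rpow hs hD.le]; simp only [hm]; ring
  · intro r hr s τ y w hs hτ hy hw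
    have hr1 : 1 ≤ r := (le_max_left _ _).trans hr.le
    have hr0 : 0 < r := by linarith
    have hK := hH.K_pos r hr0
    have hV0 := hH.V_nonneg r hr0
    have hK2 : K r ≤ |C₂| * (r ^ αi * V r ^ βi) :=
      (hfar r ((le_max_right _ _).trans_lt hr)).trans
        (mul_le_mul_of_nonneg_right (le_abs_self _) (by positivity))
    calc K r * (|bFun g y| * |w|)
        ≤ (|C₂| * (r ^ αi * V r ^ βi)) * ((Cb * |y| ^ (q₂ - 1)) * |w|) := by
          gcongr
          exact (hb y).2
      _ = |C₂| * Cb * (r ^ αi * V r ^ βi * (|y| ^ (q₂ - 1) * |w|)) := by ring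
      _ ≤ |C₂| * Cb * (r ^ (-σ) * s ^ (q₂ - 2) *
          (V r * (|y| * |w|) + s * τ * r ^ (-(N : ℝ) - σ))) := by
          refine mul_le_mul_of_nonneg_left ?_ (by positivity)
          exact far_estimate h₁.βi_mem hq2 hσpos (by rw [hσ]; ring) hr1 hs hτ (abs_nonneg _)
            (abs_nonneg _) hV0 hy hw
      _ = _ := by ring
  · exact rMeas_integrableOn_Ioi_rpow hN1 (lt_of_lt_of_le one_pos (le_max_left _ _))
      (by linarith)

/-! ## The functional on the radial space -/

section Functional

variable {N : ℕ} [hN : Fact (3 ≤ N)] {V K g : ℝ → ℝ} {a b σ C R : ℝ} {m : ℝ → ℝ}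

/-- The functional `q ↦ ∫ k q`, when it is well defined and bounded. -/
def pairFun (N : ℕ) [Fact (3 ≤ N)] (V k : ℝ → ℝ) : StrongDual ℝ (RadSpace N V) :=
  open Classical in
  if h : (∀ q : RadSpace N V, Integrable (fun r => k r * val q r) (rMeas N)) ∧
      ∃ C : ℝ, ∀ q : RadSpace N V, |∫ r, k r * val q r ∂(rMeas N)| ≤ C * ‖q‖ then
    LinearMap.mkContinuousOfExistsBound
      { toFun := fun q => ∫ r, k r * val q r ∂(rMeas N)
        map_add' := fun p q => by
          rw [← integral_add (h.1 p) (h.1 q)]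
          refine integral_congr_ae ?_
          filter_upwards [rMeas_ae_pos (one_le_dim N)] with r hr
          rw [val_add _ _ hr, mul_add]
        map_smul' := fun c q => by
          rw [RingHom.id_apply, smul_eq_mul, ← integral_const_mul]
          refine integral_congr_ae ?_
          filter_upwards [rMeas_ae_pos (one_le_dim N)] with r hr
          rw [val_smul _ _ hr]; ring } h.2
  else 0

theorem pairFun_apply {k : ℝ → ℝ}
    (h1 : ∀ q : RadSpace N V, Integrable (fun r => k r * val q r) (rMeas N)) {M : ℝ}
    (h2 : ∀ q : RadSpace N V, |∫ r, k r * val q r ∂(rMeas N)| ≤ M * ‖q‖) (q : RadSpace N V) :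
    pairFun N V k q = ∫ r, k r * val q r ∂(rMeas N) := by
  rw [pairFun, dif_pos ⟨h1, M, h2⟩]; rfl

theorem continuousOn_comp_val {φ : ℝ → ℝ} (hφ : Continuous φ) (p : RadSpace N V) :
    ContinuousOn (fun r => φ (val p r)) (Ioi 0) :=
  hφ.comp_continuousOn (continuousOn_val p)

/-! ### The part with the potential `V` -/

/-- `½ f(t)² - ½ t²`. -/
def vPrim (t : ℝ) : ℝ := 1 / 2 * dualChange t ^ 2 - 1 / 2 * t ^ 2

/-- The derivative of `vPrim`. -/
def vDer (t : ℝ) : ℝ := aFun t - t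

theorem hasDerivAt_vPrim (t : ℝ) : HasDerivAt vPrim (vDer t) t :=
  ((hasDerivAt_dualChange_sq t).sub ((hasDerivAt_pow 2 t).const_mul (1 / 2))).congr_deriv
    (by simp [vDer])

theorem continuous_vDer : Continuous vDer := continuous_aFun.sub continuous_id

theorem continuous_vPrim : Continuous vPrim :=
  continuous_iff_continuousAt.2 fun t => (hasDerivAt_vPrim t).continuousAt

theorem abs_vDer_sub_le (s t : ℝ) : |vDer s - vDer t| ≤ 2 * |s - t| := by
  have h1 := abs_aFun_sub_le s t
  calc |vDer s - vDer t| = |(aFun s - aFun t) - (s - t)| := by rw [vDer, vDer]; ring_nf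
    _ ≤ |aFun s - aFun t| + |s - t| := abs_sub _ _
    _ ≤ _ := by linarith

theorem abs_vDer_le (t : ℝ) : |vDer t| ≤ 2 * |t| := by
  have := abs_vDer_sub_le t 0
  simpa [vDer, aFun_zero] using this

theorem abs_vPrim_le (t : ℝ) : |vPrim t| ≤ t ^ 2 := by
  have := dualChange_sq_le_sq t
  rw [vPrim, abs_le]
  constructor <;> nlinarith [sq_nonneg (dualChange t)]

theorem integrable_V_sq (hH : HypH V K) (p : RadSpace N V) :
    Integrable (fun r => V r * val p r ^ 2) (rMeas N) := by
  simpa only [sq] using integrable_V_mul hH.V_nonneg p p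

theorem integrable_of_abs_le {F G : ℝ → ℝ} (hF : ContinuousOn F (Ioi 0))
    (hG : Integrable G (rMeas N)) (h : ∀ r, 0 < r → |F r| ≤ G r) : Integrable F (rMeas N) := by
  refine hG.mono' (rMeas_aestronglyMeasurable (one_le_dim N) hF) ?_
  filter_upwards [rMeas_ae_pos (one_le_dim N)] with r hr using h r hr

theorem abs_integral_le_of_abs_le {F G : ℝ → ℝ}
    (hG : Integrable G (rMeas N)) (h : ∀ r, 0 < r → |F r| ≤ G r) :
    |∫ r, F r ∂(rMeas N)| ≤ ∫ r, G r ∂(rMeas N) := by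
  rw [← Real.norm_eq_abs]
  refine norm_integral_le_of_norm_le hG ?_
  filter_upwards [rMeas_ae_pos (one_le_dim N)] with r hr using h r hr

theorem abs_V_vDer_sub_le (hH : HypH V K) (p p' q : RadSpace N V) {r : ℝ} (hr : 0 < r) :
    |V r * (vDer (val p r) - vDer (val p' r)) * val q r|
      ≤ 2 * (V r * (|val (p - p') r| * |val q r|)) := by
  have h := abs_vDer_sub_le (val p r) (val p' r)
  have hv := hH.V_nonneg r hr
  rw [val_sub _ _ hr, abs_mul, abs_mul, abs_of_nonneg hv]
  calc _ ≤ V r * (2 * |val p r - val p' r|) * |val q r| := by gcongr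
    _ = _ := by ring

theorem abs_V_vDer_le (hH : HypH V K) (p q : RadSpace N V) {r : ℝ} (hr : 0 < r) :
    |V r * vDer (val p r) * val q r| ≤ 2 * (V r * (|val p r| * |val q r|)) := by
  have h := abs_vDer_le (val p r)
  have hv := hH.V_nonneg r hr
  rw [abs_mul, abs_mul, abs_of_nonneg hv]
  calc _ ≤ V r * (2 * |val p r|) * |val q r| := by gcongr
    _ = _ := by ring

theorem continuousOn_V_vDer (hH : HypH V K) (p q : RadSpace N V) :
    ContinuousOn (fun r => V r * vDer (val p r) * val q r) (Ioi 0) :=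
  (hH.V_cont.mul (continuousOn_comp_val continuous_vDer p)).mul (continuousOn_val q)

theorem integrable_V_vDer (hH : HypH V K) (p q : RadSpace N V) :
    Integrable (fun r => V r * vDer (val p r) * val q r) (rMeas N) :=
  integrable_of_abs_le (continuousOn_V_vDer hH p q)
    ((integrable_V_abs hH.V_nonneg p q).const_mul 2) fun _ hr => abs_V_vDer_le hH p q hr

/-- The derivative of `∫ V (½ f(u)² - ½ u²)`. -/
def vGrad (p : RadSpace N V) : StrongDual ℝ (RadSpace N V) :=
  pairFun N V fun r => V r * vDer (val p r)

theorem vGrad_apply (hH : HypH V K) (p q : RadSpace N V) :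
    vGrad p q = ∫ r, V r * vDer (val p r) * val q r ∂(rMeas N) := by
  refine pairFun_apply (integrable_V_vDer hH p) (M := 2 * ‖p‖) (fun q => ?_) q
  refine (abs_integral_le_of_abs_le ((integrable_V_abs hH.V_nonneg p q).const_mul 2)
    fun _ hr => abs_V_vDer_le hH p q hr).trans ?_
  rw [integral_const_mul, mul_assoc]
  exact mul_le_mul_of_nonneg_left (integral_V_abs_le hH.V_nonneg p q) two_pos.le

/-- The scalar function `f f' - id` is `2`-Lipschitz, and Cauchy–Schwarz for the weight `V`
transfers this to the gradient. -/
theorem norm_vGrad_sub_le (hH : HypH V K) (p p' : RadSpace N V) :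
    ‖vGrad p - vGrad p'‖ ≤ 2 * ‖p - p'‖ := by
  refine ContinuousLinearMap.opNorm_le_bound _ (by positivity) fun q => ?_
  rw [_root_.sub_apply, vGrad_apply hH, vGrad_apply hH,
    ← integral_sub (integrable_V_vDer hH p q) (integrable_V_vDer hH p' q)]
  refine (abs_integral_le_of_abs_le ((integrable_V_abs hH.V_nonneg (p - p') q).const_mul 2)
    fun r hr => ?_).trans ?_
  · have := abs_V_vDer_sub_le hH p p' q hr
    rwa [mul_sub, sub_mul] at this
  · rw [integral_const_mul, mul_assoc]
    exact mul_le_mul_of_nonneg_left (integral_V_abs_le hH.V_nonneg _ q) two_pos.le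

theorem continuous_vGrad (hH : HypH V K) : Continuous (vGrad : RadSpace N V → _) :=
  (LipschitzWith.of_dist_le_mul (K := 2)
    (f := (vGrad : RadSpace N V → StrongDual ℝ (RadSpace N V))) fun p p' => by
    rw [dist_eq_norm p p']
    exact (dist_eq_norm (vGrad p) (vGrad p')).trans_le (norm_vGrad_sub_le hH p p')).continuous

/-! ### Differentiation along lines -/

/-- Differentiation under the integral sign along a line, common to the `V` part and the `K` part;
only a dominating function for parameters at distance less than `1` is asked for. -/
theorem hasDerivAt_integral_line {Φ φ k bound : ℝ → ℝ} (hΦ : ∀ t, HasDerivAt Φ (φ t) t)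
    (hφ : Continuous φ) (hk : ContinuousOn k (Ioi 0)) (p q : RadSpace N V) (t₀ : ℝ)
    (hb : Integrable bound (rMeas N))
    (hle : ∀ t ∈ Metric.ball t₀ 1, ∀ r, 0 < r →
      |k r * φ (val (p + t • q) r) * val q r| ≤ bound r)
    (hint : Integrable (fun r => k r * Φ (val (p + t₀ • q) r)) (rMeas N)) :
    HasDerivAt (fun t => ∫ r, k r * Φ (val (p + t • q) r) ∂(rMeas N))
      (∫ r, k r * φ (val (p + t₀ • q) r) * val q r ∂(rMeas N)) t₀ := by
  have hΦc : Continuous Φ := continuous_iff_continuousAt.2 fun t => (hΦ t).continuousAt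
  refine (hasDerivAt_integral_of_dominated_loc_of_deriv_le (bound := bound)
    (F' := fun t r => k r * φ (val (p + t • q) r) * val q r)
    (Metric.ball_mem_nhds t₀ one_pos) ?_ hint ?_ ?_ hb ?_).2
  · exact Eventually.of_forall fun t => rMeas_aestronglyMeasurable (one_le_dim N)
      (hk.mul (continuousOn_comp_val hΦc _))
  · exact rMeas_aestronglyMeasurable (one_le_dim N)
      ((hk.mul (continuousOn_comp_val hφ _)).mul (continuousOn_val q))
  · filter_upwards [rMeas_ae_pos (one_le_dim N)] with r hr t ht using hle t ht r hr
  · filter_upwards [rMeas_ae_pos (one_le_dim N)] with r hr t ht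
    have e : ∀ t : ℝ, val (p + t • q) r = val p r + t * val q r := fun t => by
      rw [val_add _ _ hr, val_smul _ _ hr]
    simp only [e]
    have h1 : HasDerivAt (fun t : ℝ => val p r + t * val q r) (val q r) t := by
      simpa using ((hasDerivAt_id t).mul_const (val q r)).const_add (val p r)
    have h2 := ((hΦ _).comp t h1).const_mul (k r)
    rw [← mul_assoc] at h2
    exact h2

theorem abs_val_line_le (p q : RadSpace N V) {t₀ t : ℝ} (ht : t ∈ Metric.ball t₀ 1) {r : ℝ}
    (hr : 0 < r) : |val (p + t • q) r| ≤ |val p r| + (|t₀| + 1) * |val q r| := by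
  rw [val_add _ _ hr, val_smul _ _ hr]
  have h1 : |t| ≤ |t₀| + 1 := by
    rw [Metric.mem_ball, Real.dist_eq] at ht
    have := abs_sub_abs_le_abs_sub t t₀
    linarith
  calc _ ≤ |val p r| + |t| * |val q r| := by rw [← abs_mul]; exact abs_add_le _ _
    _ ≤ _ := by gcongr

theorem integrable_V_vPrim (hH : HypH V K) (p : RadSpace N V) :
    Integrable (fun r => V r * vPrim (val p r)) (rMeas N) := by
  refine integrable_of_abs_le (hH.V_cont.mul (continuousOn_comp_val continuous_vPrim p))
    (integrable_V_sq hH p) fun r hr => ?_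
  rw [abs_mul, abs_of_nonneg (hH.V_nonneg r hr)]
  exact mul_le_mul_of_nonneg_left (abs_vPrim_le _) (hH.V_nonneg r hr)

theorem hasDerivAt_vPart (hH : HypH V K) (p q : RadSpace N V) (t₀ : ℝ) :
    HasDerivAt (fun t : ℝ => ∫ r, V r * vPrim (val (p + t • q) r) ∂(rMeas N))
      (vGrad (p + t₀ • q) q) t₀ := by
  rw [vGrad_apply hH]
  refine hasDerivAt_integral_line hasDerivAt_vPrim continuous_vDer hH.V_cont p q t₀
    (((integrable_V_abs hH.V_nonneg p q).const_mul 2).add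
      ((integrable_V_abs hH.V_nonneg q q).const_mul (2 * (|t₀| + 1)))) (fun t ht r hr => ?_)
    (integrable_V_vPrim hH _)
  refine (abs_V_vDer_le hH _ q hr).trans ?_
  have hv := hH.V_nonneg r hr
  calc _ ≤ 2 * (V r * ((|val p r| + (|t₀| + 1) * |val q r|) * |val q r|)) := by
        gcongr; exact abs_val_line_le p q ht hr
    _ = _ := by simp only [Pi.add_apply]; ring

/-! ### The nonlinear part -/

/-- A dominating function for the nonlinear term. -/
def domBound (N : ℕ) (V : ℝ → ℝ) (a b σ C R : ℝ) (m : ℝ → ℝ) (s τ : ℝ) (P : ℝ → ℝ) (r : ℝ) : ℝ :=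
  if r ≤ R then s ^ a * τ * m r else C * r ^ (-σ) * s ^ b * (V r * P r + s * τ * r ^ (-(N : ℝ) - σ))

theorem le_domBound (hH : HypH V K) (gb : GrowthBound N V K g a b σ C R m) {s τ y w r : ℝ}
    {P : ℝ → ℝ} (hr : 0 < r) (hs : 0 ≤ s) (hτ : 0 ≤ τ) (hy : |y| ≤ s * decay N r)
    (hw : |w| ≤ τ * decay N r) (hP : |y| * |w| ≤ P r) :
    K r * (|bFun g y| * |w|) ≤ domBound N V a b σ C R m s τ P r := by
  rw [domBound]
  split_ifs with h
  · exact gb.near r hr s τ y w hs hτ hy hw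
  · have := hH.V_nonneg r hr
    have := gb.C_nonneg
    refine (gb.far r (not_le.1 h) s τ y w hs hτ hy hw).trans ?_
    gcongr

theorem GrowthBound.rpow_le_one (gb : GrowthBound N V K g a b σ C R m) {R' r : ℝ} (hR : R ≤ R')
    (hr : R' < r) : r ^ (-σ) ≤ R' ^ (-σ) ∧ R' ^ (-σ) ≤ 1 := by
  have h1 := gb.one_le_R
  have h2 := gb.σ_pos
  exact ⟨Real.rpow_le_rpow_of_nonpos (by linarith) hr.le (by linarith),
    Real.rpow_le_one_of_one_le_of_nonpos (by linarith) (by linarith)⟩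

theorem integrable_domBound (gb : GrowthBound N V K g a b σ C R m) {s τ : ℝ}
    {P : ℝ → ℝ} (hP : Integrable (fun r => V r * P r) (rMeas N)) :
    Integrable (domBound N V a b σ C R m s τ P) (rMeas N) := by
  have e : domBound N V a b σ C R m s τ P = (Iic R).piecewise (fun r => s ^ a * τ * m r)
      (fun r => r ^ (-σ) * (C * s ^ b * (V r * P r + s * τ * r ^ (-(N : ℝ) - σ)))) := by
    funext r
    rw [domBound, piecewise]
    simp only [mem_Iic]
    split_ifs <;> ring
  rw [e]
  refine Integrable.piecewise measurableSet_Iic ((gb.m_int R).const_mul _) ?_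
  rw [compl_Iic]
  have h1 : IntegrableOn (fun r => C * s ^ b * (V r * P r + s * τ * r ^ (-(N : ℝ) - σ))) (Ioi R)
      (rMeas N) := (hP.integrableOn.add (gb.tail_int.const_mul _)).const_mul _
  refine h1.bdd_mul (c := 1) (by fun_prop) ?_
  filter_upwards [ae_restrict_mem measurableSet_Ioi] with r hr
  have hr0 : 0 < r := by have := gb.one_le_R; have : R < r := hr; linarith
  rw [Real.norm_eq_abs, abs_of_pos (Real.rpow_pos_of_pos hr0 _)]
  exact (gb.rpow_le_one le_rfl hr).1.trans (gb.rpow_le_one le_rfl hr).2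

theorem abs_val_le_mul (hH : HypH V K) (p : RadSpace N V) {B : ℝ} (hB : ‖p‖ ≤ B) {r : ℝ}
    (hr : 0 < r) : |val p r| ≤ (decayConst N * B) * decay N r := by
  refine (abs_val_le hH.V_nonneg p hr).trans ?_
  have := decay_pos N hr
  have := decayConst_nonneg N
  gcongr

theorem continuousOn_K_bFun (hH : HypH V K) (hb : Continuous (bFun g)) (p q : RadSpace N V) :
    ContinuousOn (fun r => K r * bFun g (val p r) * val q r) (Ioi 0) :=
  (hH.K_cont.mul (continuousOn_comp_val hb p)).mul (continuousOn_val q)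

theorem abs_K_bFun (hH : HypH V K) (p q : RadSpace N V) {r : ℝ} (hr : 0 < r) :
    |K r * bFun g (val p r) * val q r| = K r * (|bFun g (val p r)| * |val q r|) := by
  rw [abs_mul, abs_mul, abs_of_pos (hH.K_pos r hr), mul_assoc]

theorem integrable_K_bFun (hH : HypH V K) (gb : GrowthBound N V K g a b σ C R m)
    (hb : Continuous (bFun g)) (p q : RadSpace N V) :
    Integrable (fun r => K r * bFun g (val p r) * val q r) (rMeas N) := by
  have h0 := decayConst_nonneg N
  refine integrable_of_abs_le (continuousOn_K_bFun hH hb p q)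
    (integrable_domBound gb (s := decayConst N * ‖p‖) (τ := decayConst N * ‖q‖)
      (integrable_V_abs hH.V_nonneg p q)) fun r hr => ?_
  rw [abs_K_bFun hH p q hr]
  exact le_domBound hH gb hr (by positivity) (by positivity) (abs_val_le hH.V_nonneg p hr)
    (abs_val_le hH.V_nonneg q hr) le_rfl

/-- The mass of the tail weight. -/
def tailMass (N : ℕ) (σ R : ℝ) : ℝ := ∫ r in Ioi R, r ^ (-(N : ℝ) - σ) ∂(rMeas N)

theorem tailMass_nonneg (gb : GrowthBound N V K g a b σ C R m) : 0 ≤ tailMass N σ R := by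
  refine setIntegral_nonneg measurableSet_Ioi fun r hr => ?_
  have hr0 : 0 < r := by have := gb.one_le_R; have : R < r := hr; linarith
  positivity

/-- The constant in the tail estimate. -/
def tailConst (N : ℕ) (b σ C R : ℝ) : ℝ :=
  C * decayConst N ^ b * (1 + decayConst N ^ 2 * tailMass N σ R)

theorem tailConst_nonneg (gb : GrowthBound N V K g a b σ C R m) : 0 ≤ tailConst N b σ C R := by
  have := decayConst_nonneg N
  have := tailMass_nonneg gb
  have := gb.C_nonneg
  rw [tailConst]; positivity

/-- The factor `R'^{-σ}` makes the tails small uniformly on bounded sets; this is the source of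
compactness at infinity. -/
theorem tail_estimate (hH : HypH V K) (gb : GrowthBound N V K g a b σ C R m)
    (hb : Continuous (bFun g)) (p q : RadSpace N V) {R' : ℝ} (hR : R ≤ R') :
    ∫ r in Ioi R', K r * (|bFun g (val p r)| * |val q r|) ∂(rMeas N)
      ≤ tailConst N b σ C R * R' ^ (-σ) * ‖p‖ ^ b * ‖p‖ * ‖q‖ := by
  set c := decayConst N with hc
  have h0 : 0 ≤ c := decayConst_nonneg N
  have hC := gb.C_nonneg
  have hR'0 : 0 < R' := by have := gb.one_le_R; linarith
  have hm := tailMass_nonneg gb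
  have i1 : Integrable (fun r => K r * (|bFun g (val p r)| * |val q r|)) (rMeas N) := by
    refine (integrable_K_bFun hH gb hb p q).norm.congr ?_
    filter_upwards [rMeas_ae_pos (one_le_dim N)] with r hr using abs_K_bFun hH p q hr
  have i2 := integrable_V_abs hH.V_nonneg p q
  have i3 : IntegrableOn (fun r => r ^ (-(N : ℝ) - σ)) (Ioi R') (rMeas N) :=
    gb.tail_int.mono_set (Ioi_subset_Ioi hR)
  have e1 : ∫ r in Ioi R', V r * (|val p r| * |val q r|) ∂(rMeas N) ≤ ‖p‖ * ‖q‖ := by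
    refine (setIntegral_le_integral i2 ?_).trans (integral_V_abs_le hH.V_nonneg p q)
    filter_upwards [rMeas_ae_pos (one_le_dim N)] with r hr
    have := hH.V_nonneg r hr
    simp only [Pi.zero_apply]; positivity
  have e2 : ∫ r in Ioi R', r ^ (-(N : ℝ) - σ) ∂(rMeas N) ≤ tailMass N σ R := by
    refine setIntegral_mono_set gb.tail_int ?_ (Ioi_subset_Ioi hR).eventuallyLE
    filter_upwards [ae_restrict_mem measurableSet_Ioi] with r hr
    have hr0 : 0 < r := by have := gb.one_le_R; have : R < r := hr; linarith
    simp only [Pi.zero_apply]; positivity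
  calc ∫ r in Ioi R', K r * (|bFun g (val p r)| * |val q r|) ∂(rMeas N)
      ≤ ∫ r in Ioi R', C * R' ^ (-σ) * (c * ‖p‖) ^ b * (V r * (|val p r| * |val q r|)
          + (c * ‖p‖) * (c * ‖q‖) * r ^ (-(N : ℝ) - σ)) ∂(rMeas N) := by
        refine setIntegral_mono_on i1.integrableOn
          ((i2.integrableOn.add (i3.const_mul _)).const_mul _) measurableSet_Ioi fun r hr => ?_
        have hr1 : R' < r := hr
        have hr0 : 0 < r := hR'0.trans hr1
        refine (gb.far r (hR.trans_lt hr1) (c * ‖p‖) (c * ‖q‖) _ _ (by positivity) (by positivity)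
          (abs_val_le hH.V_nonneg p hr0) (abs_val_le hH.V_nonneg q hr0)).trans ?_
        have := hH.V_nonneg r hr0
        have := (gb.rpow_le_one hR hr1).1
        gcongr
    _ = C * R' ^ (-σ) * (c * ‖p‖) ^ b * (∫ r in Ioi R', V r * (|val p r| * |val q r|) ∂(rMeas N)
          + (c * ‖p‖) * (c * ‖q‖) * ∫ r in Ioi R', r ^ (-(N : ℝ) - σ) ∂(rMeas N)) := by
        rw [integral_const_mul, integral_add i2.integrableOn (i3.const_mul _), integral_const_mul]
    _ ≤ C * R' ^ (-σ) * (c * ‖p‖) ^ b * (‖p‖ * ‖q‖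
          + (c * ‖p‖) * (c * ‖q‖) * tailMass N σ R) := by gcongr
    _ = _ := by
        rw [Real.mul_rpow h0 (norm_nonneg _), tailConst]; ring

theorem near_estimate (hH : HypH V K) (gb : GrowthBound N V K g a b σ C R m)
    (hb : Continuous (bFun g)) (p q : RadSpace N V) (R' : ℝ) :
    ∫ r in Iic R', K r * (|bFun g (val p r)| * |val q r|) ∂(rMeas N)
      ≤ (decayConst N ^ a * decayConst N * ∫ r in Iic R', m r ∂(rMeas N)) * ‖p‖ ^ a * ‖q‖ := by
  set c := decayConst N with hc
  have h0 : 0 ≤ c := decayConst_nonneg N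
  have i1 : Integrable (fun r => K r * (|bFun g (val p r)| * |val q r|)) (rMeas N) := by
    refine (integrable_K_bFun hH gb hb p q).norm.congr ?_
    filter_upwards [rMeas_ae_pos (one_le_dim N)] with r hr using abs_K_bFun hH p q hr
  calc _ ≤ ∫ r in Iic R', (c * ‖p‖) ^ a * (c * ‖q‖) * m r ∂(rMeas N) := by
        refine setIntegral_mono_ae i1.integrableOn ((gb.m_int R').const_mul _) ?_
        filter_upwards [rMeas_ae_pos (one_le_dim N)] with r hr
        exact gb.near r hr _ _ _ _ (by positivity) (by positivity)
          (abs_val_le hH.V_nonneg p hr) (abs_val_le hH.V_nonneg q hr)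
    _ = _ := by
        rw [integral_const_mul, Real.mul_rpow h0 (norm_nonneg _)]; ring

/-- The constants in the estimate of the nonlinear term. -/
def nearConst (N : ℕ) (a R : ℝ) (m : ℝ → ℝ) : ℝ :=
  decayConst N ^ a * decayConst N * ∫ r in Iic R, m r ∂(rMeas N)

theorem integral_K_abs_le (hH : HypH V K) (gb : GrowthBound N V K g a b σ C R m)
    (hb : Continuous (bFun g)) (p q : RadSpace N V) :
    ∫ r, K r * (|bFun g (val p r)| * |val q r|) ∂(rMeas N)
      ≤ (nearConst N a R m * ‖p‖ ^ a + tailConst N b σ C R * ‖p‖ ^ b * ‖p‖) * ‖q‖ := by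
  have i1 : Integrable (fun r => K r * (|bFun g (val p r)| * |val q r|)) (rMeas N) := by
    refine (integrable_K_bFun hH gb hb p q).norm.congr ?_
    filter_upwards [rMeas_ae_pos (one_le_dim N)] with r hr using abs_K_bFun hH p q hr
  rw [← integral_add_compl measurableSet_Iic i1 (s := Iic R), compl_Iic]
  have h1 := near_estimate hH gb hb p q R
  have h2 := tail_estimate hH gb hb p q (le_refl R)
  have h3 : R ^ (-σ) ≤ 1 := Real.rpow_le_one_of_one_le_of_nonpos gb.one_le_R (by
    linarith [gb.σ_pos])
  have h4 := tailConst_nonneg gb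
  have h5 : tailConst N b σ C R * R ^ (-σ) * ‖p‖ ^ b * ‖p‖ * ‖q‖
      ≤ tailConst N b σ C R * 1 * ‖p‖ ^ b * ‖p‖ * ‖q‖ := by gcongr
  calc _ ≤ _ := add_le_add h1 (h2.trans h5)
    _ = _ := by rw [nearConst]; ring

/-- The derivative of `∫ K G(f(u))`. -/
def kGrad (K g : ℝ → ℝ) (p : RadSpace N V) : StrongDual ℝ (RadSpace N V) :=
  pairFun N V fun r => K r * bFun g (val p r)

theorem kGrad_apply (hH : HypH V K) (gb : GrowthBound N V K g a b σ C R m)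
    (hb : Continuous (bFun g)) (p q : RadSpace N V) :
    kGrad K g p q = ∫ r, K r * bFun g (val p r) * val q r ∂(rMeas N) := by
  refine pairFun_apply (integrable_K_bFun hH gb hb p)
    (M := nearConst N a R m * ‖p‖ ^ a + tailConst N b σ C R * ‖p‖ ^ b * ‖p‖) (fun q => ?_) q
  refine (abs_integral_le_of_abs_le ?_ fun r hr => (abs_K_bFun hH p q hr).le).trans
    (integral_K_abs_le hH gb hb p q)
  refine (integrable_K_bFun hH gb hb p q).norm.congr ?_
  filter_upwards [rMeas_ae_pos (one_le_dim N)] with r hr using abs_K_bFun hH p q hr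

theorem integrable_K_abs (hH : HypH V K) (gb : GrowthBound N V K g a b σ C R m)
    (hb : Continuous (bFun g)) (p q : RadSpace N V) :
    Integrable (fun r => K r * (|bFun g (val p r)| * |val q r|)) (rMeas N) := by
  refine (integrable_K_bFun hH gb hb p q).norm.congr ?_
  filter_upwards [rMeas_ae_pos (one_le_dim N)] with r hr using abs_K_bFun hH p q hr

/-- The nonlinear part of the gradient is completely continuous. -/
theorem tendsto_kGrad (hH : HypH V K) (gb : GrowthBound N V K g a b σ C R m)
    (hb : Continuous (bFun g)) {x : ℕ → RadSpace N V} {p : RadSpace N V} {B : ℝ}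
    (hx : ∀ n, ‖x n‖ ≤ B) (hp : ‖p‖ ≤ B)
    (hlim : ∀ r, 0 < r → Tendsto (fun n => val (x n) r) atTop (𝓝 (val p r))) :
    Tendsto (fun n => kGrad K g (x n)) atTop (𝓝 (kGrad K g p)) := by
  have hB : 0 ≤ B := (norm_nonneg _).trans hp
  have hc := decayConst_nonneg N
  have hT := tailConst_nonneg gb
  set c := decayConst N with hcdef
  have hbpos : 0 < b := by linarith [gb.two_lt_b]
  -- On `(0, R']` the test element is replaced by its pointwise bound `c ‖q‖ r^{-(N-2)/2}`, so the
  -- estimate is uniform in `q` and becomes a bound for the operator norm; beyond `R'` the tail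
  -- estimate is used for both points.
  have key : ∀ R', R ≤ R' → ∀ n, ‖kGrad K g (x n) - kGrad K g p‖
      ≤ ∫ r in Iic R', K r * (|bFun g (val (x n) r) - bFun g (val p r)| * (c * decay N r)) ∂(rMeas N)
        + 2 * (tailConst N b σ C R * R' ^ (-σ) * B ^ b * B) := by
    intro R' hR n
    have hR'0 : 0 < R' := by have := gb.one_le_R; linarith
    have hn0 : 0 ≤ ∫ r in Iic R', K r * (|bFun g (val (x n) r) - bFun g (val p r)|
        * (c * decay N r)) ∂(rMeas N) := by
      refine integral_nonneg_of_ae ?_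
      filter_upwards [ae_restrict_of_ae (rMeas_ae_pos (one_le_dim N))] with r hr
      have := hH.K_pos r hr
      have := decay_pos N hr
      simp only [Pi.zero_apply]; positivity
    refine ContinuousLinearMap.opNorm_le_bound _ (by positivity) fun q => ?_
    rw [_root_.sub_apply, kGrad_apply hH gb hb, kGrad_apply hH gb hb,
      ← integral_sub (integrable_K_bFun hH gb hb _ q) (integrable_K_bFun hH gb hb p q)]
    have i1 := ((integrable_K_bFun hH gb hb (x n) q).sub (integrable_K_bFun hH gb hb p q)).norm
    refine (norm_integral_le_integral_norm _).trans ?_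
    simp only [Pi.sub_apply] at i1
    rw [← integral_add_compl measurableSet_Iic i1 (s := Iic R'), compl_Iic, add_mul]
    refine add_le_add ?_ ?_
    · rw [← integral_mul_const]
      have hdom : IntegrableOn (fun r => K r * (|bFun g (val (x n) r) - bFun g (val p r)|
          * (c * decay N r)) * ‖q‖) (Iic R') (rMeas N) := by
        refine Integrable.mono' (((gb.m_int R').const_mul (2 * (c * B) ^ a * c)).mul_const ‖q‖)
          (rMeas_aestronglyMeasurable (one_le_dim N) ?_).restrict ?_
        · exact (hH.K_cont.mul ((((continuousOn_comp_val hb _).sub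
            (continuousOn_comp_val hb _)).abs).mul
            (continuousOn_const.mul (continuousOn_decay N)))).mul continuousOn_const
        · filter_upwards [ae_restrict_of_ae (rMeas_ae_pos (one_le_dim N))] with r hr
          have hK := hH.K_pos r hr
          have hD := decay_pos N hr
          -- Choosing the decay profile itself as the test value gives domination by a multiple of
          -- the integrable weight `m`.
          have h1 := gb.near r hr (c * B) 1 (val (x n) r) (decay N r) (by positivity) one_pos.le
            (abs_val_le_mul hH _ (hx n) hr) (by rw [abs_of_pos hD, one_mul])
          have h2 := gb.near r hr (c * B) 1 (val p r) (decay N r) (by positivity) one_pos.le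
            (abs_val_le_mul hH _ hp hr) (by rw [abs_of_pos hD, one_mul])
          rw [abs_of_pos hD] at h1 h2
          rw [Real.norm_eq_abs, abs_of_nonneg (by positivity)]
          refine mul_le_mul_of_nonneg_right ?_ (norm_nonneg q)
          calc _ ≤ K r * ((|bFun g (val (x n) r)| + |bFun g (val p r)|) * (c * decay N r)) := by
                gcongr; exact abs_sub _ _
            _ = c * (K r * (|bFun g (val (x n) r)| * decay N r)
                + K r * (|bFun g (val p r)| * decay N r)) := by ring
            _ ≤ c * ((c * B) ^ a * 1 * m r + (c * B) ^ a * 1 * m r) := by gcongr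
            _ = _ := by ring
      refine setIntegral_mono_ae i1.integrableOn hdom ?_
      filter_upwards [rMeas_ae_pos (one_le_dim N)] with r hr
      have hK := hH.K_pos r hr
      have hq := abs_val_le hH.V_nonneg q hr
      rw [Real.norm_eq_abs, ← sub_mul, ← mul_sub, abs_mul, abs_mul, abs_of_pos hK]
      calc _ ≤ K r * |bFun g (val (x n) r) - bFun g (val p r)| * (c * ‖q‖ * decay N r) := by gcongr
        _ = _ := by ring
    · have h1 := tail_estimate hH gb hb (x n) q hR
      have h2 := tail_estimate hH gb hb p q hR
      have h3 : tailConst N b σ C R * R' ^ (-σ) * ‖x n‖ ^ b * ‖x n‖ * ‖q‖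
          ≤ tailConst N b σ C R * R' ^ (-σ) * B ^ b * B * ‖q‖ := by
        have := hx n
        gcongr
      have h4 : tailConst N b σ C R * R' ^ (-σ) * ‖p‖ ^ b * ‖p‖ * ‖q‖
          ≤ tailConst N b σ C R * R' ^ (-σ) * B ^ b * B * ‖q‖ := by gcongr
      have i2 := integrable_K_abs hH gb hb (x n) q
      have i3 := integrable_K_abs hH gb hb p q
      have h5 : ∫ r in Ioi R', ‖K r * bFun g (val (x n) r) * val q r
          - K r * bFun g (val p r) * val q r‖ ∂(rMeas N)
          ≤ ∫ r in Ioi R', (K r * (|bFun g (val (x n) r)| * |val q r|)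
            + K r * (|bFun g (val p r)| * |val q r|)) ∂(rMeas N) := by
        refine setIntegral_mono_ae i1.integrableOn (i2.add i3).integrableOn ?_
        filter_upwards [rMeas_ae_pos (one_le_dim N)] with r hr
        rw [Real.norm_eq_abs, ← abs_K_bFun hH _ q hr, ← abs_K_bFun hH _ q hr]
        exact abs_sub _ _
      rw [integral_add i2.integrableOn i3.integrableOn] at h5
      linarith
  refine (tendsto_iff_norm_sub_tendsto_zero (E := StrongDual ℝ (RadSpace N V))).2 ?_
  refine tendsto_order.2 ⟨fun u hu => Eventually.of_forall fun n => hu.trans_le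
    (norm_nonneg (kGrad K g (x n) - kGrad K g p)), fun ε hε => ?_⟩
  have htail : Tendsto (fun R' : ℝ => 2 * (tailConst N b σ C R * R' ^ (-σ) * B ^ b * B)) atTop
      (𝓝 0) := by
    have := (((tendsto_rpow_neg_atTop gb.σ_pos).const_mul (tailConst N b σ C R)).mul_const
      (B ^ b)).mul_const B |>.const_mul 2
    simpa using this
  obtain ⟨R', hR'1, hR'2⟩ := ((htail.eventually_lt_const (half_pos hε)).and
    (eventually_ge_atTop R)).exists
  have hnear : Tendsto (fun n => ∫ r in Iic R', K r * (|bFun g (val (x n) r) - bFun g (val p r)|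
      * (c * decay N r)) ∂(rMeas N)) atTop (𝓝 (∫ r in Iic R', (0 : ℝ) ∂(rMeas N))) := by
    refine tendsto_integral_of_dominated_convergence (fun r => 2 * (c * B) ^ a * c * m r)
      (fun n => (rMeas_aestronglyMeasurable (one_le_dim N) ?_).restrict)
      ((gb.m_int R').const_mul _) (fun n => ?_) ?_
    · exact hH.K_cont.mul ((((continuousOn_comp_val hb _).sub
            (continuousOn_comp_val hb _)).abs).mul (continuousOn_const.mul (continuousOn_decay N)))
    · filter_upwards [ae_restrict_of_ae (rMeas_ae_pos (one_le_dim N))] with r hr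
      have hK := hH.K_pos r hr
      have hD := decay_pos N hr
      have h1 := gb.near r hr (c * B) 1 (val (x n) r) (decay N r) (by positivity) one_pos.le
        (abs_val_le_mul hH _ (hx n) hr) (by rw [abs_of_pos hD, one_mul])
      have h2 := gb.near r hr (c * B) 1 (val p r) (decay N r) (by positivity) one_pos.le
        (abs_val_le_mul hH _ hp hr) (by rw [abs_of_pos hD, one_mul])
      rw [abs_of_pos hD] at h1 h2
      rw [Real.norm_eq_abs, abs_of_nonneg (by positivity)]
      calc _ ≤ K r * ((|bFun g (val (x n) r)| + |bFun g (val p r)|) * (c * decay N r)) := by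
            gcongr; exact abs_sub _ _
        _ = c * (K r * (|bFun g (val (x n) r)| * decay N r)
            + K r * (|bFun g (val p r)| * decay N r)) := by ring
        _ ≤ c * ((c * B) ^ a * 1 * m r + (c * B) ^ a * 1 * m r) := by gcongr
        _ = _ := by ring
    · filter_upwards [ae_restrict_of_ae (rMeas_ae_pos (one_le_dim N))] with r hr
      have h1 : Tendsto (fun n => |bFun g (val (x n) r) - bFun g (val p r)|) atTop (𝓝 0) := by
        have := (((hb.tendsto _).comp (hlim r hr)).sub_const (bFun g (val p r))).abs
        simpa using this
      have := (h1.mul_const (c * decay N r)).const_mul (K r)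
      simpa using this
  rw [integral_zero] at hnear
  filter_upwards [hnear.eventually_lt_const (half_pos hε)] with n hn
  have := key R' hR'2 n
  linarith

theorem tendsto_val_of_tendsto (hH : HypH V K) {x : ℕ → RadSpace N V} {p : RadSpace N V}
    (hx : Tendsto x atTop (𝓝 p)) {r : ℝ} (hr : 0 < r) :
    Tendsto (fun n => val (x n) r) atTop (𝓝 (val p r)) := by
  rw [tendsto_iff_norm_sub_tendsto_zero]
  have h1 := ((tendsto_iff_norm_sub_tendsto_zero.1 hx).const_mul (decayConst N)).mul_const
    (decay N r)
  simp only [mul_zero, zero_mul] at h1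
  refine squeeze_zero (fun _ => norm_nonneg _) (fun n => ?_) h1
  rw [← val_sub _ _ hr]
  exact abs_val_le hH.V_nonneg _ hr

theorem continuous_kGrad (hH : HypH V K) (gb : GrowthBound N V K g a b σ C R m)
    (hb : Continuous (bFun g)) : Continuous (kGrad K g : RadSpace N V → _) := by
  refine continuous_iff_seqContinuous.2 fun x p hx => ?_
  obtain ⟨B, hB⟩ := (Metric.isBounded_range_of_tendsto x hx).exists_norm_le
  refine tendsto_kGrad hH gb hb (B := max B ‖p‖)
    (fun n => (hB _ (mem_range_self n)).trans (le_max_left _ _)) (le_max_right _ _)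
    fun r hr => tendsto_val_of_tendsto hH hx hr

end Functional

/-! ## Existence of a critical point on the radial space -/

section Energy

variable {N : ℕ} [hN : Fact (3 ≤ N)] {V K g : ℝ → ℝ} {a b σ C R : ℝ} {m : ℝ → ℝ} {q₁ q₂ : ℝ}

theorem HypG.primG_comp_nonneg (hg : HypG g q₁ q₂) (t : ℝ) : 0 ≤ primG g (dualChange t) := by
  obtain ⟨θ, -, h⟩ := hg.primG_le
  exact (h t).1

theorem HypG.primG_comp_le (hg : HypG g q₁ q₂) (t : ℝ) :
    primG g (dualChange t) ≤ |bFun g t| * |t| := by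
  obtain ⟨θ, hθ, h⟩ := hg.primG_le
  rw [← abs_mul]
  refine le_trans ?_ ((h t).2.trans (le_abs_self _))
  nlinarith [(h t).1]

theorem integrable_K_primG (hH : HypH V K) (gb : GrowthBound N V K g a b σ C R m)
    (hg : HypG g q₁ q₂) (p : RadSpace N V) :
    Integrable (fun r => K r * primG g (dualChange (val p r))) (rMeas N) := by
  refine integrable_of_abs_le (hH.K_cont.mul (continuousOn_comp_val hg.continuous_primG_comp p))
    (integrable_K_abs hH gb hg.continuous_bFun p p) fun r hr => ?_
  rw [abs_of_nonneg (mul_nonneg (hH.K_pos r hr).le (hg.primG_comp_nonneg _))]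
  exact mul_le_mul_of_nonneg_left (hg.primG_comp_le _) (hH.K_pos r hr).le

theorem hasDerivAt_kPart (hH : HypH V K) (gb : GrowthBound N V K g a b σ C R m)
    (hg : HypG g q₁ q₂) (p q : RadSpace N V) (t₀ : ℝ) :
    HasDerivAt (fun t : ℝ => ∫ r, K r * primG g (dualChange (val (p + t • q) r)) ∂(rMeas N))
      (kGrad K g (p + t₀ • q) q) t₀ := by
  rw [kGrad_apply hH gb hg.continuous_bFun]
  have hc := decayConst_nonneg N
  refine hasDerivAt_integral_line (bound := domBound N V a b σ C R m
      (decayConst N * (‖p‖ + (|t₀| + 1) * ‖q‖)) (decayConst N * ‖q‖)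
      fun r => (|val p r| + (|t₀| + 1) * |val q r|) * |val q r|)
    hg.hasDerivAt_primG_comp hg.continuous_bFun hH.K_cont p q t₀ ?_ (fun t ht r hr => ?_)
    (integrable_K_primG hH gb hg _)
  · refine integrable_domBound gb ?_
    refine ((integrable_V_abs hH.V_nonneg p q).add
      ((integrable_V_abs hH.V_nonneg q q).const_mul (|t₀| + 1))).congr
        (Eventually.of_forall fun r => ?_)
    simp only [Pi.add_apply]; ring
  · rw [abs_K_bFun hH _ q hr]
    have hline := abs_val_line_le p q ht hr
    have hD := decay_pos N hr
    refine le_domBound hH gb hr (by positivity) (by positivity) (hline.trans ?_)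
      (abs_val_le hH.V_nonneg q hr) (mul_le_mul_of_nonneg_right hline (abs_nonneg _))
    have h1 := abs_val_le hH.V_nonneg p hr
    have h2 := abs_val_le hH.V_nonneg q hr
    calc _ ≤ decayConst N * ‖p‖ * decay N r
          + (|t₀| + 1) * (decayConst N * ‖q‖ * decay N r) := by gcongr
      _ = _ := by ring

/-- The functional on the radial space. -/
def radI (K g : ℝ → ℝ) (p : RadSpace N V) : ℝ :=
  1 / 2 * ‖p‖ ^ 2 + ∫ r, V r * vPrim (val p r) ∂(rMeas N)
    - ∫ r, K r * primG g (dualChange (val p r)) ∂(rMeas N)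

/-- The derivative of `radI`. -/
def radGrad (K g : ℝ → ℝ) (p : RadSpace N V) : StrongDual ℝ (RadSpace N V) :=
  innerSL ℝ p + vGrad p - kGrad K g p

theorem radGrad_apply (p q : RadSpace N V) :
    radGrad K g p q = inner ℝ p q + vGrad p q - kGrad K g p q := rfl

theorem hasDerivAt_radI (hH : HypH V K) (gb : GrowthBound N V K g a b σ C R m)
    (hg : HypG g q₁ q₂) (p q : RadSpace N V) (t : ℝ) :
    HasDerivAt (fun t : ℝ => radI K g (p + t • q)) (radGrad K g (p + t • q) q) t := by
  have h1 : HasDerivAt (fun t : ℝ => p + t • q) q t := by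
    simpa using ((hasDerivAt_id t).smul_const q).const_add p
  have h2 : HasDerivAt (fun t : ℝ => 1 / 2 * ‖p + t • q‖ ^ 2) (inner ℝ (p + t • q) q) t :=
    (h1.norm_sq.const_mul (1 / 2)).congr_deriv (by ring)
  exact (h2.add (hasDerivAt_vPart hH p q t)).sub (hasDerivAt_kPart hH gb hg p q t)

theorem continuous_radGrad (hH : HypH V K) (gb : GrowthBound N V K g a b σ C R m)
    (hg : HypG g q₁ q₂) : Continuous (radGrad K g : RadSpace N V → _) :=
  ((innerSL ℝ).continuous.add (continuous_vGrad hH)).sub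
    (continuous_kGrad hH gb hg.continuous_bFun)

/-! ### Energy bounds -/

theorem integrable_V_dual_sq (hH : HypH V K) (p : RadSpace N V) :
    Integrable (fun r => V r * dualChange (val p r) ^ 2) (rMeas N) := by
  refine integrable_of_abs_le (hH.V_cont.mul (continuousOn_comp_val
    (continuous_dualChange.pow 2) p)) (integrable_V_sq hH p) fun r hr => ?_
  have := hH.V_nonneg r hr
  rw [abs_of_nonneg (by positivity)]
  exact mul_le_mul_of_nonneg_left (dualChange_sq_le_sq _) this

/-- `∫ |∇u|² + ∫ V f(u)²`. -/
def energyA (p : RadSpace N V) : ℝ :=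
  dnorm N (der p) ^ 2 + ∫ r, V r * dualChange (val p r) ^ 2 ∂(rMeas N)

theorem integral_V_dual_sq_nonneg (hH : HypH V K) (p : RadSpace N V) :
    0 ≤ ∫ r, V r * dualChange (val p r) ^ 2 ∂(rMeas N) := by
  refine integral_nonneg_of_ae ?_
  filter_upwards [rMeas_ae_pos (one_le_dim N)] with r hr
  exact mul_nonneg (hH.V_nonneg r hr) (sq_nonneg _)

theorem energyA_nonneg (hH : HypH V K) (p : RadSpace N V) : 0 ≤ energyA p :=
  add_nonneg (sq_nonneg _) (integral_V_dual_sq_nonneg hH p)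

theorem energyA_le (hH : HypH V K) (p : RadSpace N V) : energyA p ≤ ‖p‖ ^ 2 := by
  rw [norm_sq_eq hH.V_nonneg, energyA]
  refine add_le_add le_rfl (integral_mono_ae (integrable_V_dual_sq hH p) (integrable_V_sq hH p) ?_)
  filter_upwards [rMeas_ae_pos (one_le_dim N)] with r hr
  exact mul_le_mul_of_nonneg_left (dualChange_sq_le_sq _) (hH.V_nonneg r hr)

/-- The term `½ ∫ V u²` in the Hilbert norm and the correction in `vPrim` cancel: the functional on
the radial space is the original one. -/
theorem radI_eq (hH : HypH V K) (p : RadSpace N V) :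
    radI K g p = 1 / 2 * energyA p - ∫ r, K r * primG g (dualChange (val p r)) ∂(rMeas N) := by
  have e : ∫ r, V r * vPrim (val p r) ∂(rMeas N)
      = 1 / 2 * (∫ r, V r * dualChange (val p r) ^ 2 ∂(rMeas N))
        - 1 / 2 * ∫ r, V r * val p r ^ 2 ∂(rMeas N) := by
    rw [← integral_const_mul, ← integral_const_mul,
      ← integral_sub ((integrable_V_dual_sq hH p).const_mul _) ((integrable_V_sq hH p).const_mul _)]
    congr 1; funext r; rw [vPrim]; ring
  rw [radI, e, norm_sq_eq hH.V_nonneg, energyA]; ring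

/-- For `r < 1` the bound `V ≤ CV / r²` gives the Hardy term. For `r ≥ 1` the decay bounds `|u / s|`
by `M`, where squares are comparable with `f²`. The scale `s` is `1` for the energy and a number
above the norm of `E` for the norm comparison. -/
theorem exists_V_sq_le (hH : HypH V K) : ∃ CV > 0, ∀ ψ, MemLp ψ 2 (rMeas N) → ∀ s > 0, ∀ M,
    decayConst N * dnorm N ψ ≤ M * s → ∀ r, 0 < r → V r * tailInt ψ r ^ 2
      ≤ CV * (tailInt ψ r ^ 2 / r ^ 2)
        + s ^ 2 * (1 + 2 * M ^ 2) * (V r * dualChange (tailInt ψ r / s) ^ 2) := by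
  obtain ⟨CV, hCV, hV⟩ := hH.V_bound
  have hc := decayConst_nonneg N
  refine ⟨CV, hCV, fun ψ hψ s hs M hM r hr => ?_⟩
  have hd := dnorm_nonneg N ψ
  have hv := hH.V_nonneg r hr
  rcases lt_or_ge r 1 with h1 | h1
  · have := hV r ⟨hr, h1⟩
    have h2 : V r * tailInt ψ r ^ 2 ≤ CV / r ^ 2 * tailInt ψ r ^ 2 := by gcongr
    have h3 : CV / r ^ 2 * tailInt ψ r ^ 2 = CV * (tailInt ψ r ^ 2 / r ^ 2) := by ring
    have : 0 ≤ s ^ 2 * (1 + 2 * M ^ 2) * (V r * dualChange (tailInt ψ r / s) ^ 2) := by positivity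
    linarith
  · have h2 : |tailInt ψ r / s| ≤ M := by
      rw [abs_div, abs_of_pos hs, div_le_iff₀ hs]
      refine (abs_tailInt_le (three_le N) hψ hr).trans (le_trans ?_ hM)
      exact mul_le_of_le_one_right (by positivity) (decay_le_one (three_le N) h1)
    have h3 : dualChange (tailInt ψ r / s) ^ 2 ≤ M ^ 2 :=
      (dualChange_sq_le_sq _).trans (sq_le_sq' (by linarith [neg_abs_le (tailInt ψ r / s)])
        ((le_abs_self _).trans h2))
    have h4 := sq_le_dualChange (tailInt ψ r / s)
    have h5 : (tailInt ψ r / s) ^ 2 ≤ dualChange (tailInt ψ r / s) ^ 2 * (1 + 2 * M ^ 2) :=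
      h4.trans (by gcongr)
    have h6 : V r * (s ^ 2 * (tailInt ψ r / s) ^ 2)
        ≤ V r * (s ^ 2 * (dualChange (tailInt ψ r / s) ^ 2 * (1 + 2 * M ^ 2))) := by
      gcongr
    have h7 : s ^ 2 * (tailInt ψ r / s) ^ 2 = tailInt ψ r ^ 2 := by field_simp
    rw [h7] at h6
    have : 0 ≤ CV * (tailInt ψ r ^ 2 / r ^ 2) := by positivity
    linarith

/-- The pointwise estimate at scale `1`, integrated with Hardy's inequality; the bound `M` is then
proportional to the gradient norm, whence the extra factor `1 + energyA p`. A bound on the energy is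
thus a bound on the Hilbert norm. -/
theorem exists_norm_sq_le_energyA (hH : HypH V K) :
    ∃ C > 0, ∀ p : RadSpace N V, ‖p‖ ^ 2 ≤ C * (1 + energyA p) * energyA p := by
  obtain ⟨CV, hCV, hV⟩ := exists_V_sq_le (N := N) hH
  have hh := hardyConst_nonneg N
  have hc := decayConst_nonneg N
  refine ⟨2 + CV * hardyConst N + 2 * decayConst N ^ 2, by positivity, fun p => ?_⟩
  set c := decayConst N
  set d := dnorm N (der p) with hd
  set W := ∫ r, V r * dualChange (val p r) ^ 2 ∂(rMeas N) with hW
  have hd0 : 0 ≤ d := dnorm_nonneg _ _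
  have hW0 : 0 ≤ W := integral_V_dual_sq_nonneg hH p
  have key : ∫ r, V r * val p r ^ 2 ∂(rMeas N)
      ≤ ∫ r, (CV * (tailInt (der p) r ^ 2 / r ^ 2)
        + (1 + 2 * (c * d) ^ 2) * (V r * dualChange (val p r) ^ 2)) ∂(rMeas N) := by
    refine integral_mono_ae (integrable_V_sq hH p)
      (((integrable_hardy (three_le N) (memLp_der p)).const_mul _).add
        ((integrable_V_dual_sq hH p).const_mul _)) ?_
    filter_upwards [rMeas_ae_pos (one_le_dim N)] with r hr
    have := hV (der p) (memLp_der p) 1 one_pos (c * d) (by rw [mul_one]) r hr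
    rwa [one_pow, one_mul, div_one] at this
  rw [integral_add ((integrable_hardy (three_le N) (memLp_der p)).const_mul _)
    ((integrable_V_dual_sq hH p).const_mul _), integral_const_mul, integral_const_mul] at key
  have h7 : CV * ∫ r, tailInt (der p) r ^ 2 / r ^ 2 ∂(rMeas N) ≤ CV * (hardyConst N * d ^ 2) :=
    mul_le_mul_of_nonneg_left (hardy (three_le N) (memLp_der p)) hCV.le
  rw [norm_sq_eq hH.V_nonneg]
  have hA : energyA p = d ^ 2 + W := rfl
  rw [hA]
  rw [← hW] at key
  have hx : 0 ≤ d ^ 2 := sq_nonneg _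
  have e1 : d ^ 2 + ∫ r, V r * val p r ^ 2 ∂(rMeas N)
    ≤ d ^ 2 + CV * hardyConst N * d ^ 2 + (1 + 2 * c ^ 2 * d ^ 2) * W := by
      have : (1 + 2 * (c * d) ^ 2) * W = (1 + 2 * c ^ 2 * d ^ 2) * W := by ring
      linarith
  refine e1.trans ?_
  have hk : 0 ≤ CV * hardyConst N := by positivity
  have hc2 : 0 ≤ c ^ 2 := sq_nonneg _
  generalize CV * hardyConst N = k at *
  generalize c ^ 2 = l at *
  generalize d ^ 2 = x at *
  have e2 : (2 + k + 2 * l) * (1 + (x + W)) * (x + W)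
    = x + k * x + (1 + 2 * l * x) * W + (x + W + k * W + 2 * l * x + 2 * l * W
      + (2 + k) * (x + W) * (x + W) + 2 * l * (x * x + x * W + W * W)) := by ring
  rw [e2]
  have : 0 ≤ x + W + k * W + 2 * l * x + 2 * l * W
      + (2 + k) * (x + W) * (x + W) + 2 * l * (x * x + x * W + W * W) := by positivity
  linarith

theorem integral_K_primG_le (hH : HypH V K) (gb : GrowthBound N V K g a b σ C R m)
    (hg : HypG g q₁ q₂) (p : RadSpace N V) :
    ∫ r, K r * primG g (dualChange (val p r)) ∂(rMeas N)
      ≤ (nearConst N a R m * ‖p‖ ^ a + tailConst N b σ C R * ‖p‖ ^ b * ‖p‖) * ‖p‖ := by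
  refine le_trans (integral_mono_ae (integrable_K_primG hH gb hg p)
    (integrable_K_abs hH gb hg.continuous_bFun p p) ?_)
    (integral_K_abs_le hH gb hg.continuous_bFun p p)
  filter_upwards [rMeas_ae_pos (one_le_dim N)] with r hr
  exact mul_le_mul_of_nonneg_left (hg.primG_comp_le _) (hH.K_pos r hr).le

theorem integral_K_primG_nonneg (hH : HypH V K) (hg : HypG g q₁ q₂) (p : RadSpace N V) :
    0 ≤ ∫ r, K r * primG g (dualChange (val p r)) ∂(rMeas N) := by
  refine integral_nonneg_of_ae ?_
  filter_upwards [rMeas_ae_pos (one_le_dim N)] with r hr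
  exact mul_nonneg (hH.K_pos r hr).le (hg.primG_comp_nonneg _)

/-- On a small sphere the energy is at most `1`, hence at least a fixed multiple of `ρ²`, whereas
the nonlinear term is of order `ρ^{a+1} + ρ^{b+2}` with both exponents above `2`. -/
theorem exists_sphere_bound (hH : HypH V K) (gb : GrowthBound N V K g a b σ C R m)
    (hg : HypG g q₁ q₂) :
    ∃ ρ > 0, ∃ c > 0, ∀ p : RadSpace N V, ‖p‖ = ρ → c ≤ radI K g p := by
  obtain ⟨C₀, hC₀, hA⟩ := exists_norm_sq_le_energyA (N := N) hH
  have ha := gb.one_lt_a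
  have hb := gb.two_lt_b
  have hlim : Tendsto (fun ρ : ℝ => nearConst N a R m * ρ ^ (a - 1) + tailConst N b σ C R * ρ ^ b)
      (𝓝[>] 0) (𝓝 0) := by
    have h1 : ContinuousAt (fun ρ : ℝ => nearConst N a R m * ρ ^ (a - 1)
        + tailConst N b σ C R * ρ ^ b) 0 :=
      ((Real.continuousAt_rpow_const _ _ (Or.inr (by linarith))).const_mul _).add
        ((Real.continuousAt_rpow_const _ _ (Or.inr (by linarith))).const_mul _)
    have h2 := h1.tendsto
    rw [Real.zero_rpow (by linarith), Real.zero_rpow (by linarith)] at h2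
    simp only [mul_zero, add_zero] at h2
    exact h2.mono_left nhdsWithin_le_nhds
  -- Half of the lower bound `ρ² / (4 C₀)` for the quadratic part is spent on the nonlinear term.
  have hev := (hlim.eventually_lt_const (u := 1 / (8 * C₀)) (by positivity)).and
    (Ioc_mem_nhdsGT (one_pos (α := ℝ)))
  obtain ⟨ρ, h1, h2, h3⟩ := hev.exists
  refine ⟨ρ, h2, ρ ^ 2 / (8 * C₀), by positivity, fun p hp => ?_⟩
  have hAle : energyA p ≤ 1 := (energyA_le hH p).trans (by rw [hp]; nlinarith)
  have hA0 := energyA_nonneg hH p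
  have h4 : ρ ^ 2 ≤ 2 * C₀ * energyA p := by
    have := hA p
    rw [hp] at this
    refine this.trans ?_
    have : C₀ * (1 + energyA p) ≤ 2 * C₀ := by nlinarith
    gcongr
  have h5 := integral_K_primG_le hH gb hg p
  rw [hp] at h5
  have e1 : ρ ^ a = ρ ^ (a - 1) * ρ := by
    rw [← Real.rpow_add_one h2.ne']; congr 1; ring
  have h6 : (nearConst N a R m * ρ ^ a + tailConst N b σ C R * ρ ^ b * ρ) * ρ
      ≤ 1 / (8 * C₀) * ρ ^ 2 := by
    rw [e1]
    calc _ = (nearConst N a R m * ρ ^ (a - 1) + tailConst N b σ C R * ρ ^ b) * ρ ^ 2 := by ring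
      _ ≤ _ := by gcongr
  rw [radI_eq hH]
  have h7 : ρ ^ 2 / (4 * C₀) ≤ 1 / 2 * energyA p := by
    rw [div_le_iff₀ (by positivity)]; linarith
  have h8 : ρ ^ 2 / (4 * C₀) = ρ ^ 2 / (8 * C₀) + 1 / (8 * C₀) * ρ ^ 2 := by field_simp; ring
  linarith

/-! ### Elements of the radial space vanishing at infinity -/

/-- On a bounded interval `V r²` is bounded, near `0` by hypothesis and elsewhere by continuity, so
Hardy's inequality controls the weighted term. This supplies test elements of the radial space. -/
theorem memLp_sqrt_V_mul (hH : HypH V K) {ψ : ℝ → ℝ} (hψ : MemLp ψ 2 (rMeas N))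
    {R₀ : ℝ} (h0 : ∀ r, R₀ ≤ r → tailInt ψ r = 0) :
    MemLp (fun r => √(V r) * tailInt ψ r) 2 (rMeas N) := by
  obtain ⟨CV, hCV, hV⟩ := hH.V_bound
  have hcont : ContinuousOn (fun r => √(V r) * tailInt ψ r) (Ioi 0) :=
    (Real.continuous_sqrt.comp_continuousOn hH.V_cont).mul (continuousOn_tailInt (three_le N) hψ)
  obtain ⟨M, hM⟩ := (isCompact_Icc (a := (1 : ℝ)) (b := R₀)).exists_bound_of_continuousOn
    ((hH.V_cont.mono fun r hr => mem_Ioi.2 (one_pos.trans_le hr.1)).mul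
      (continuousOn_pow 2))
  rw [memLp_two_iff_integrable_sq (rMeas_aestronglyMeasurable (one_le_dim N) hcont)]
  refine integrable_of_abs_le (hcont.pow 2)
    ((integrable_hardy (three_le N) hψ).const_mul (max CV M)) fun r hr => ?_
  have hv := hH.V_nonneg r hr
  rw [abs_of_nonneg (by positivity), mul_pow, Real.sq_sqrt hv]
  rcases lt_or_ge r R₀ with hR | hR
  · have h1 : V r * r ^ 2 ≤ max CV M := by
      rcases lt_or_ge r 1 with h | h
      · refine le_trans ?_ (le_max_left _ _)
        exact (le_div_iff₀ (by positivity)).1 (hV r ⟨hr, h⟩)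
      · exact (le_abs_self _).trans ((hM r ⟨h, hR.le⟩).trans (le_max_right _ _))
    calc V r * tailInt ψ r ^ 2 = V r * r ^ 2 * (tailInt ψ r ^ 2 / r ^ 2) := by field_simp
      _ ≤ _ := by gcongr
  · rw [h0 r hR]; simp

/-- The element of the radial space with derivative `ψ`, when `tailInt ψ` vanishes near
infinity. -/
def mkVan (hH : HypH V K) {ψ : ℝ → ℝ} (hψ : MemLp ψ 2 (rMeas N))
    {R₀ : ℝ} (h0 : ∀ r, R₀ ≤ r → tailInt ψ r = 0) : RadSpace N V :=
  mkRad ψ hψ (memLp_sqrt_V_mul hH hψ h0)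

/-- The primitive of `-1` on `(1, 2]`: equal to `1` up to `1`, then decreasing linearly to `0`. -/
theorem exists_bump (hH : HypH V K) : ∃ φ : RadSpace N V,
    ∀ r ∈ Ioc (0 : ℝ) 1, val φ r = 1 := by
  set ψ : ℝ → ℝ := fun r => (Ioc (1 : ℝ) 2).indicator (fun _ => -1) r with hψdef
  have hψ : MemLp ψ 2 (rMeas N) := by
    refine memLp_indicator_const 2 measurableSet_Ioc _ (Or.inr ?_)
    have h1 : IntegrableOn (fun _ => (1 : ℝ)) (Icc 1 2) (rMeas N) :=
      rMeas_integrableOn_Icc (one_le_dim N) one_pos continuousOn_const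
    have h2 := (integrableOn_const_iff (by simp)).1 h1
    have h3 : rMeas N (Icc 1 2) < ⊤ := by simpa using h2
    exact ((measure_mono Ioc_subset_Icc_self).trans_lt h3).ne
  have e : ∀ r, tailInt ψ r = ∫ _ in Ioi r ∩ Ioc 1 2, (1 : ℝ) := fun r => by
    rw [tailInt, hψdef, setIntegral_indicator measurableSet_Ioc, ← integral_neg]
    simp
  have h0 : ∀ r, (2 : ℝ) ≤ r → tailInt ψ r = 0 := fun r hr => by
    rw [e]
    have : Ioi r ∩ Ioc 1 2 = ∅ := by
      ext x; simp only [mem_inter_iff, mem_Ioi, mem_Ioc, mem_empty_iff_false]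
      constructor
      · rintro ⟨h1, h2, h3⟩; linarith
      · exact False.elim
    rw [this]; simp
  refine ⟨mkVan hH hψ h0, fun r hr => ?_⟩
  rw [mkVan, val_mkRad _ _ hr.1, e]
  have : Ioi r ∩ Ioc (1 : ℝ) 2 = Ioc 1 2 :=
    inter_eq_right.2 fun x hx => hr.2.trans_lt hx.1
  rw [this]; simp; norm_num

/-- Along multiples of the bump function the quadratic part grows like `t²`, while the nonlinear
part, restricted to `[1/2, 1]` where the function is the constant `t`, grows at least like `t^θ`
with `θ > 2`. -/
theorem exists_radI_nonpos (hH : HypH V K) (gb : GrowthBound N V K g a b σ C R m)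
    (hg : HypG g q₁ q₂) (ρ : ℝ) : ∃ e : RadSpace N V, ρ < ‖e‖ ∧ radI K g e ≤ 0 := by
  obtain ⟨φ, hφ⟩ := exists_bump (N := N) hH
  obtain ⟨θ, hθ, c, hc, T, hT⟩ := hg.primG_lower
  have iK : IntegrableOn K (Icc (1 / 2) 1) (rMeas N) :=
    rMeas_integrableOn_Icc (one_le_dim N) (by norm_num)
      hH.K_cont
  set k₀ := ∫ r in Icc (1 / 2) 1, K r ∂(rMeas N) with hk₀
  have hk : 0 < k₀ := by
    rw [hk₀, setIntegral_pos_iff_support_of_nonneg_ae ?_ iK]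
    · have h1 : Icc (1 / 2 : ℝ) 1 ⊆ Function.support K ∩ Icc (1 / 2) 1 := fun r hr =>
        ⟨(hH.K_pos r (lt_of_lt_of_le (by norm_num) hr.1)).ne', hr⟩
      refine lt_of_lt_of_le ?_ (measure_mono h1)
      rw [pos_iff_ne_zero]
      intro h2
      have h3 := absolutelyContinuous_rMeas (one_le_dim N) h2
      rw [Measure.restrict_apply measurableSet_Icc, inter_eq_left.2] at h3
      · rw [Real.volume_Icc] at h3; norm_num at h3
      · exact fun r hr => lt_of_lt_of_le (by norm_num) hr.1
    · filter_upwards [ae_restrict_mem measurableSet_Icc] with r hr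
      exact (hH.K_pos r (lt_of_lt_of_le (by norm_num) hr.1)).le
  have hφ0 : 0 < ‖φ‖ := by
    rw [norm_pos_iff]
    rintro rfl
    have := hφ 1 ⟨one_pos, le_rfl⟩
    rw [val_zero one_pos] at this
    norm_num at this
  have hlim : Tendsto (fun t : ℝ => t ^ (θ - 2)) atTop atTop := tendsto_rpow_atTop (by linarith)
  obtain ⟨t, ht1, ht2, ht3, ht4⟩ := ((hlim.eventually_ge_atTop (1 / 2 * ‖φ‖ ^ 2 / (c * k₀))).and
    ((eventually_ge_atTop T).and ((eventually_gt_atTop 0).and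
      (eventually_gt_atTop (ρ / ‖φ‖))))).exists
  refine ⟨t • φ, ?_, ?_⟩
  · rw [norm_smul, Real.norm_eq_abs, abs_of_pos ht3]
    exact (div_lt_iff₀ hφ0).1 ht4
  · have h1 : c * t ^ θ * k₀ ≤ ∫ r, K r * primG g (dualChange (val (t • φ) r)) ∂(rMeas N) := by
      have i1 := integrable_K_primG hH gb hg (t • φ)
      refine le_trans ?_ (setIntegral_le_integral (s := Icc (1 / 2) 1) i1 ?_)
      · rw [hk₀, ← integral_const_mul]
        refine setIntegral_mono_on (iK.const_mul _) i1.integrableOn measurableSet_Icc fun r hr => ?_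
        have hr0 : 0 < r := lt_of_lt_of_le (by norm_num) hr.1
        rw [val_smul _ _ hr0, hφ r ⟨hr0, hr.2⟩, mul_one, mul_comm]
        exact mul_le_mul_of_nonneg_left (hT t ht2) (hH.K_pos r hr0).le
      · filter_upwards [rMeas_ae_pos (one_le_dim N)] with r hr
        exact mul_nonneg (hH.K_pos r hr).le (hg.primG_comp_nonneg _)
    have h2 := energyA_le hH (t • φ)
    rw [norm_smul, Real.norm_eq_abs, abs_of_pos ht3] at h2
    rw [radI_eq hH]
    have h3 : t ^ θ = t ^ (θ - 2) * t ^ 2 := by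
      rw [← Real.rpow_natCast t 2, ← Real.rpow_add ht3]; congr 1; push_cast; ring
    rw [div_le_iff₀ (by positivity)] at ht1
    rw [h3] at h1
    have h4 : 1 / 2 * ‖φ‖ ^ 2 * t ^ 2 ≤ t ^ (θ - 2) * (c * k₀) * t ^ 2 := by gcongr
    nlinarith

/-! ### Palais–Smale sequences -/

theorem radGrad_self (hH : HypH V K) (gb : GrowthBound N V K g a b σ C R m)
    (hg : HypG g q₁ q₂) (p : RadSpace N V) :
    radGrad K g p p = dnorm N (der p) ^ 2 + ∫ r, V r * (aFun (val p r) * val p r) ∂(rMeas N)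
      - ∫ r, K r * bFun g (val p r) * val p r ∂(rMeas N) := by
  rw [radGrad_apply, vGrad_apply hH, kGrad_apply hH gb hg.continuous_bFun,
    real_inner_self_eq_norm_sq, norm_sq_eq hH.V_nonneg, add_assoc,
    ← integral_add (integrable_V_sq hH p) (integrable_V_vDer hH p p)]
  congr 3; funext r; rw [vDer]; ring

theorem integrable_V_aFun (hH : HypH V K) (p : RadSpace N V) :
    Integrable (fun r => V r * (aFun (val p r) * val p r)) (rMeas N) := by
  refine ((integrable_V_vDer hH p p).add (integrable_V_sq hH p)).congr
    (Eventually.of_forall fun r => ?_)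
  simp only [Pi.add_apply, vDer]; ring

/-- By `f² ≤ 2 f f' t`. The right side is the part of the gradient, paired with the point itself,
that does not involve `K`; this excludes a zero weak limit. -/
theorem energyA_le_two_mul (hH : HypH V K) (p : RadSpace N V) :
    energyA p ≤ 2 * (dnorm N (der p) ^ 2
      + ∫ r, V r * (aFun (val p r) * val p r) ∂(rMeas N)) := by
  have h : ∫ r, V r * dualChange (val p r) ^ 2 ∂(rMeas N)
      ≤ 2 * ∫ r, V r * (aFun (val p r) * val p r) ∂(rMeas N) := by
    rw [← integral_const_mul]
    refine integral_mono_ae (integrable_V_dual_sq hH p) ((integrable_V_aFun hH p).const_mul 2) ?_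
    filter_upwards [rMeas_ae_pos (one_le_dim N)] with r hr
    have := mul_le_mul_of_nonneg_left (dualChange_sq_le_two_mul (val p r)) (hH.V_nonneg r hr)
    simp only [aFun]; linarith
  rw [energyA]
  linarith [sq_nonneg (dnorm N (der p))]

/-- The Ambrosetti–Rabinowitz argument: in `I(p) - I'(p) p / θ` the nonlinear terms have a
favourable sign and `f f' t ≤ f²` leaves `(1/2 - 1/θ)` times the energy. Since `θ ≥ 1` the factor `1
/ θ` in front of the gradient term may be dropped. -/
theorem radI_sub_le (hH : HypH V K) (gb : GrowthBound N V K g a b σ C R m)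
    (hg : HypG g q₁ q₂) : ∃ κ > 0, ∀ p : RadSpace N V,
      κ * energyA p ≤ radI K g p + ‖radGrad K g p‖ * ‖p‖ := by
  obtain ⟨θ, hθ, hG⟩ := hg.primG_le
  refine ⟨1 / 2 - 1 / θ, ?_, fun p => ?_⟩
  · rw [gt_iff_lt, sub_pos]; exact one_div_lt_one_div_of_lt two_pos hθ
  · have h1 : ∫ r, V r * (aFun (val p r) * val p r) ∂(rMeas N)
        ≤ ∫ r, V r * dualChange (val p r) ^ 2 ∂(rMeas N) := by
      refine integral_mono_ae (integrable_V_aFun hH p) (integrable_V_dual_sq hH p) ?_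
      filter_upwards [rMeas_ae_pos (one_le_dim N)] with r hr
      exact mul_le_mul_of_nonneg_left (dualChange_mul_dualSlope_mul_le _) (hH.V_nonneg r hr)
    have h2 : θ * ∫ r, K r * primG g (dualChange (val p r)) ∂(rMeas N)
        ≤ ∫ r, K r * bFun g (val p r) * val p r ∂(rMeas N) := by
      rw [← integral_const_mul]
      refine integral_mono_ae ((integrable_K_primG hH gb hg p).const_mul _)
        (integrable_K_bFun hH gb hg.continuous_bFun p p) ?_
      filter_upwards [rMeas_ae_pos (one_le_dim N)] with r hr
      have := mul_le_mul_of_nonneg_left (hG (val p r)).2 (hH.K_pos r hr).le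
      linarith
    have h3 := radGrad_self hH gb hg p
    have h4 : radGrad K g p p ≥ -(‖radGrad K g p‖ * ‖p‖) := by
      have := (radGrad K g p).le_opNorm p
      rw [Real.norm_eq_abs] at this
      linarith [neg_abs_le (radGrad K g p p)]
    have h5 : 0 ≤ ‖radGrad K g p‖ * ‖p‖ := by positivity
    have hA : energyA p = dnorm N (der p) ^ 2
      + ∫ r, V r * dualChange (val p r) ^ 2 ∂(rMeas N) := rfl
    have h6 : radGrad K g p p ≤ energyA p
        - θ * ∫ r, K r * primG g (dualChange (val p r)) ∂(rMeas N) := by linarith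
    have hθ0 : 0 < θ := by linarith
    rw [radI_eq hH]
    generalize ∫ r, K r * primG g (dualChange (val p r)) ∂(rMeas N) = k at *
    have h8 : radGrad K g p p / θ ≤ energyA p / θ - k := by
      rw [div_le_iff₀ hθ0, sub_mul, div_mul_cancel₀ _ hθ0.ne']; linarith
    have h9 : -(‖radGrad K g p‖ * ‖p‖) ≤ radGrad K g p p / θ := by
      rw [le_div_iff₀ hθ0]; nlinarith
    have h10 : (1 / 2 - 1 / θ) * energyA p = 1 / 2 * energyA p - energyA p / θ := by ring
    linarith

/-! ### Weak compactness and passage to the limit. -/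

/-- Evaluation at a point. -/
def evalAt (hV : ∀ r, 0 < r → 0 ≤ V r) {r : ℝ} (hr : 0 < r) : StrongDual ℝ (RadSpace N V) :=
  LinearMap.mkContinuous
    { toFun := fun p => val p r
      map_add' := fun p q => val_add p q hr
      map_smul' := fun c p => val_smul c p hr } (decayConst N * decay N r) fun p => by
    refine (abs_val_le hV p hr).trans (le_of_eq ?_); ring

/-- Sequential Banach–Alaoglu for separable spaces, transported to the space itself by the Riesz
isometry. -/
theorem exists_weak_limit {H : Type*} [NormedAddCommGroup H] [InnerProductSpace ℝ H]
    [CompleteSpace H] [TopologicalSpace.SeparableSpace H] {x : ℕ → H} {B : ℝ}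
    (hx : ∀ n, ‖x n‖ ≤ B) :
    ∃ p : H, ‖p‖ ≤ B ∧ ∃ φ : ℕ → ℕ, StrictMono φ ∧
      ∀ L : StrongDual ℝ H, Tendsto (fun n => L (x (φ n))) atTop (𝓝 (L p)) := by
  have hs := WeakDual.isSeqCompact_closedBall ℝ H 0 B
  obtain ⟨ℓ, hℓ, φ, hφ, hlim⟩ := hs (x := fun n => StrongDual.toWeakDual
    (InnerProductSpace.toDual ℝ H (x n))) fun n => by
      show InnerProductSpace.toDual ℝ H (x n) ∈ Metric.closedBall 0 B
      rw [mem_closedBall_zero_iff, LinearIsometryEquiv.norm_map]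
      exact hx n
  refine ⟨(InnerProductSpace.toDual ℝ H).symm (WeakDual.toStrongDual ℓ), ?_, φ, hφ,
    fun L => ?_⟩
  · rw [LinearIsometryEquiv.norm_map]
    have : WeakDual.toStrongDual ℓ ∈ Metric.closedBall 0 B := hℓ
    rwa [mem_closedBall_zero_iff] at this
  · have h1 : Tendsto (fun n => inner ℝ (x (φ n)) ((InnerProductSpace.toDual ℝ H).symm L)) atTop
        (𝓝 (ℓ ((InnerProductSpace.toDual ℝ H).symm L))) :=
      (WeakDual.eval_continuous _).continuousAt.tendsto.comp hlim
    have e1 : ∀ y : H, inner ℝ y ((InnerProductSpace.toDual ℝ H).symm L) = L y := fun y => by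
      rw [real_inner_comm, InnerProductSpace.toDual_symm_apply]
    have e2 : L ((InnerProductSpace.toDual ℝ H).symm (WeakDual.toStrongDual ℓ))
        = ℓ ((InnerProductSpace.toDual ℝ H).symm L) := by
      rw [← e1, InnerProductSpace.toDual_symm_apply]; rfl
    rw [e2]
    simpa only [e1] using h1

theorem separableSpace_radSpace (N : ℕ) [Fact (3 ≤ N)] (V : ℝ → ℝ) :
    TopologicalSpace.SeparableSpace (RadSpace N V) := by
  have h0 : Fact ((2 : ℝ≥0∞) ≠ ⊤) := ⟨ENNReal.ofNat_ne_top⟩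
  have h1 : SecondCountableTopology (Lp ℝ 2 (rMeas N)) := inferInstance
  have h2 : SecondCountableTopology (WithLp 2 (Lp ℝ 2 (rMeas N) × Lp ℝ 2 (rMeas N))) :=
    (WithLp.homeomorphProd 2 (Lp ℝ 2 (rMeas N)) (Lp ℝ 2 (rMeas N))).secondCountableTopology
  have h3 : SecondCountableTopology (RadSpace N V) :=
    TopologicalSpace.Subtype.secondCountableTopology _
  infer_instance

/-- There is no common dominating function for `V |yₙ| |q|`. By Young's inequality, subtracting `δ V
yₙ²` leaves a positive part dominated by `V q² / δ`, and what was subtracted has integral at most `δ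
B²`. -/
theorem tendsto_integral_V_abs (hH : HypH V K) {y : ℕ → RadSpace N V} {B : ℝ}
    (hy : ∀ n, ‖y n‖ ≤ B) (hlim : ∀ r, 0 < r → Tendsto (fun n => val (y n) r) atTop (𝓝 0))
    (q : RadSpace N V) :
    Tendsto (fun n => ∫ r, V r * (|val (y n) r| * |val q r|) ∂(rMeas N)) atTop (𝓝 0) := by
  have hV := hH.V_nonneg
  have hB : 0 ≤ B := (norm_nonneg _).trans (hy 0)
  refine tendsto_order.2 ⟨fun u hu => Eventually.of_forall fun n => hu.trans_le ?_, fun ε hε => ?_⟩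
  · refine integral_nonneg_of_ae ?_
    filter_upwards [rMeas_ae_pos (one_le_dim N)] with r hr
    have := hV r hr
    simp only [Pi.zero_apply]; positivity
  · set δ : ℝ := ε / (2 * (B ^ 2 + 1)) with hδ
    have hδ0 : 0 < δ := by positivity
    set h : ℕ → ℝ → ℝ := fun n r => max 0 (V r * (|val (y n) r| * |val q r|)
      - δ * (V r * val (y n) r ^ 2)) with hh
    have hc : ∀ n, ContinuousOn (h n) (Ioi 0) := fun n =>
      continuousOn_const.sup ((hH.V_cont.mul ((continuousOn_val _).abs.mul
        (continuousOn_val _).abs)).sub (continuousOn_const.mul (hH.V_cont.mul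
          ((continuousOn_val _).pow 2))))
    have hdom : ∀ n r, 0 < r → |h n r| ≤ 1 / δ * (V r * val q r ^ 2) := fun n r hr => by
      have hv := hV r hr
      rw [hh, abs_of_nonneg (le_max_left _ _)]
      refine max_le (by positivity) ?_
      have : |val (y n) r| * |val q r| ≤ δ * val (y n) r ^ 2 + 1 / δ * val q r ^ 2 := by
        rw [← sq_abs (val (y n) r), ← sq_abs (val q r)]
        generalize |val (y n) r| = s
        generalize |val q r| = t
        have h1 : 0 ≤ (δ * s - t / 2) ^ 2 / δ := by positivity
        have h2 : (δ * s - t / 2) ^ 2 / δ = δ * s ^ 2 + 1 / δ * t ^ 2 - s * t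
          - 3 / 4 * (1 / δ * t ^ 2) := by field_simp; ring
        have h3 : 0 ≤ 3 / 4 * (1 / δ * t ^ 2) := by positivity
        linarith
      nlinarith [mul_le_mul_of_nonneg_left this hv]
    have h0 : Tendsto (fun n => ∫ r, h n r ∂(rMeas N)) atTop (𝓝 (∫ r, (0 : ℝ) ∂(rMeas N))) := by
      refine tendsto_integral_of_dominated_convergence (fun r => 1 / δ * (V r * val q r ^ 2))
        (fun n => rMeas_aestronglyMeasurable (one_le_dim N) (hc n))
        ((integrable_V_sq hH q).const_mul _) (fun n => ?_) ?_
      · filter_upwards [rMeas_ae_pos (one_le_dim N)] with r hr using hdom n r hr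
      · filter_upwards [rMeas_ae_pos (one_le_dim N)] with r hr
        have h1 := hlim r hr
        have h2 := (((h1.abs.mul_const |val q r|).const_mul (V r)).sub
          (((h1.pow 2).const_mul (V r)).const_mul δ))
        have h3 := (tendsto_const_nhds (x := (0 : ℝ))).max h2
        simpa using h3
    rw [integral_zero] at h0
    filter_upwards [h0.eventually_lt_const (half_pos hε)] with n hn
    have ih : Integrable (h n) (rMeas N) := integrable_of_abs_le (hc n)
      ((integrable_V_sq hH q).const_mul _) (hdom n)
    have h1 : ∫ r, V r * (|val (y n) r| * |val q r|) ∂(rMeas N)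
        ≤ ∫ r, (h n r + δ * (V r * val (y n) r ^ 2)) ∂(rMeas N) := by
      refine integral_mono (integrable_V_abs hV _ _) (ih.add ((integrable_V_sq hH _).const_mul _))
        fun r => ?_
      have := le_max_right 0 (V r * (|val (y n) r| * |val q r|) - δ * (V r * val (y n) r ^ 2))
      simp only [hh]; linarith
    rw [integral_add ih ((integrable_V_sq hH _).const_mul _), integral_const_mul] at h1
    have h2 : δ * ∫ r, V r * val (y n) r ^ 2 ∂(rMeas N) ≤ δ * B ^ 2 := by
      refine mul_le_mul_of_nonneg_left ((integral_V_sq_le hV _).trans ?_) hδ0.le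
      have := hy n
      gcongr
    have h3 : δ * B ^ 2 ≤ ε / 2 := by
      rw [hδ, div_mul_eq_mul_div, div_le_div_iff₀ (by positivity) two_pos]; nlinarith
    linarith

/-- The functional has a nonzero critical point on the radial space. -/
theorem exists_radGrad_eq_zero (hH : HypH V K) (gb : GrowthBound N V K g a b σ C R m)
    (hg : HypG g q₁ q₂) (hb0 : bFun g 0 = 0) :
    ∃ p : RadSpace N V, p ≠ 0 ∧ radGrad K g p = 0 := by
  have hV := hH.V_nonneg
  obtain ⟨ρ, hρ, c, hc, hsph⟩ := exists_sphere_bound (N := N) hH gb hg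
  obtain ⟨e, he, hIe⟩ := exists_radI_nonpos (N := N) hH gb hg ρ
  have hI0 : radI K g (0 : RadSpace N V) ≤ 0 := by
    rw [radI_eq hH]
    have h1 := energyA_le hH (0 : RadSpace N V)
    rw [norm_zero] at h1
    have h2 := integral_K_primG_nonneg hH hg (0 : RadSpace N V)
    linarith
  obtain ⟨B, hPS⟩ := mountain_pass (hasDerivAt_radI hH gb hg) (continuous_radGrad hH gb hg) hI0
    hρ hc hsph he hIe
  obtain ⟨κ, hκ, hbd⟩ := radI_sub_le (N := N) hH gb hg
  obtain ⟨C₀, hC₀, hA⟩ := exists_norm_sq_le_energyA (N := N) hH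
  have hnorm : ∀ p : RadSpace N V, ‖p‖ ≤ (1 + C₀) * (1 + energyA p) := fun p => by
    have h1 := hA p
    have h2 := energyA_nonneg hH p
    refine abs_le_of_sq_le_sq' (h1.trans ?_) (by positivity) |>.2
    have : 0 ≤ C₀ * energyA p := by positivity
    nlinarith [mul_nonneg hC₀.le h2, mul_nonneg (mul_nonneg hC₀.le hC₀.le) h2]
  -- With gradient norm at most `ε₀` and `‖x‖ ≤ (1 + C₀)(1 + energyA x)`, the error term is at most
  -- `κ / 2 · (1 + energyA x)` and is absorbed by the left side, which bounds the energy.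
  set ε₀ := κ / (2 * (1 + C₀)) with hε₀
  have hε₀0 : 0 < ε₀ := by positivity
  choose x hx1 hx2 hx3 using fun n : ℕ => hPS (min ε₀ (1 / ((n : ℝ) + 1)))
    (lt_min hε₀0 (by positivity))
  set M := (|B| + κ / 2) / (κ / 2) with hM
  have hAb : ∀ n, energyA (x n) ≤ M := fun n => by
    have h1 := hbd (x n)
    have h2 := (hx3 n).trans (min_le_left _ _)
    have h3 := hnorm (x n)
    have h4 : ‖radGrad K g (x n)‖ * ‖x n‖ ≤ ε₀ * ((1 + C₀) * (1 + energyA (x n))) := by gcongr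
    have h5 : ε₀ * ((1 + C₀) * (1 + energyA (x n))) = κ / 2 * (1 + energyA (x n)) := by
      rw [hε₀]; field_simp
    rw [hM, le_div_iff₀ (by positivity)]
    have := le_abs_self B
    have := hx2 n
    linarith
  have hxb : ∀ n, ‖x n‖ ≤ (1 + C₀) * (1 + M) := fun n => (hnorm _).trans (by
    have := hAb n
    gcongr)
  have := separableSpace_radSpace N V
  obtain ⟨p, hp, φ, hφ, hw⟩ := exists_weak_limit hxb
  have hpt : ∀ r, 0 < r → Tendsto (fun n => val (x (φ n)) r) atTop (𝓝 (val p r)) := fun r hr =>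
    hw (evalAt hV hr)
  have hk := tendsto_kGrad hH gb hg.continuous_bFun (fun n => hxb (φ n)) hp hpt
  have hgr : Tendsto (fun n => ‖radGrad K g (x (φ n))‖) atTop (𝓝 0) := by
    have h1 : Tendsto (fun n : ℕ => 1 / ((n : ℝ) + 1)) atTop (𝓝 0) :=
      tendsto_one_div_add_atTop_nhds_zero_nat
    exact squeeze_zero (fun n => norm_nonneg (radGrad K g (x (φ n))))
      (fun n => (hx3 _).trans (min_le_right _ _)) (h1.comp hφ.tendsto_atTop)
  refine ⟨p, ?_, ?_⟩
  -- If the weak limit were zero, complete continuity would make the nonlinear gradient tend to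
  -- zero, and pairing the full gradient with the sequence would drive the energy to zero; but `c ≤
  -- I ≤ ½ energyA` along the sequence.
  · rintro rfl
    have hk0 : kGrad K g (0 : RadSpace N V) = 0 := by
      ext q
      rw [kGrad_apply hH gb hg.continuous_bFun]
      refine integral_eq_zero_of_ae ?_
      filter_upwards [rMeas_ae_pos (one_le_dim N)] with r hr
      simp [val_zero hr, hb0]
    rw [hk0] at hk
    have hk1 : Tendsto (fun n => ‖kGrad K g (x (φ n))‖) atTop (𝓝 0) := by
      have := ((continuous_norm (E := StrongDual ℝ (RadSpace N V))).tendsto 0).comp hk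
      exact this.trans (le_of_eq (congrArg 𝓝 ContinuousLinearMap.opNorm_zero))
    have h1 : ∀ n, energyA (x (φ n)) ≤ 2 * ((‖radGrad K g (x (φ n))‖
        + ‖kGrad K g (x (φ n))‖) * ((1 + C₀) * (1 + M))) := fun n => by
      refine (energyA_le_two_mul hH _).trans ?_
      have e1 := radGrad_self hH gb hg (x (φ n))
      rw [← kGrad_apply hH gb hg.continuous_bFun] at e1
      have e2 := (le_abs_self _).trans ((radGrad K g (x (φ n))).le_opNorm (x (φ n)))
      have e3 := (le_abs_self _).trans ((kGrad K g (x (φ n))).le_opNorm (x (φ n)))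
      have e4 := hxb (φ n)
      have e5 : (‖radGrad K g (x (φ n))‖ + ‖kGrad K g (x (φ n))‖) * ‖x (φ n)‖
        ≤ (‖radGrad K g (x (φ n))‖ + ‖kGrad K g (x (φ n))‖) * ((1 + C₀) * (1 + M)) := by gcongr
      linarith
    have h2 : Tendsto (fun n => 2 * ((‖radGrad K g (x (φ n))‖
        + ‖kGrad K g (x (φ n))‖) * ((1 + C₀) * (1 + M)))) atTop (𝓝 0) := by
      simpa using ((hgr.add hk1).mul_const ((1 + C₀) * (1 + M))).const_mul 2
    obtain ⟨n, hn⟩ := (h2.eventually_lt_const hc).exists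
    have h3 := hx1 (φ n)
    rw [radI_eq hH] at h3
    have h4 := integral_K_primG_nonneg hH hg (x (φ n))
    have h5 := h1 n
    linarith
  · ext q
    have h1 : Tendsto (fun n => radGrad K g (x (φ n)) q) atTop (𝓝 0) := by
      refine squeeze_zero_norm (fun n => (radGrad K g (x (φ n))).le_opNorm q) ?_
      simpa using hgr.mul_const ‖q‖
    have h2 : Tendsto (fun n => inner ℝ (x (φ n)) q) atTop (𝓝 (inner ℝ p q)) := by
      simpa only [innerSL_apply_apply, real_inner_comm] using hw (innerSL ℝ q)
    have h3 : Tendsto (fun n => kGrad K g (x (φ n)) q) atTop (𝓝 (kGrad K g p q)) :=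
      ((ContinuousLinearMap.apply ℝ ℝ q).continuous.tendsto _).comp hk
    -- The Lipschitz bound for the integrand together with pointwise convergence gives weak
    -- continuity, although the sequence need not converge in norm.
    have h4 : Tendsto (fun n => vGrad (x (φ n)) q) atTop (𝓝 (vGrad p q)) := by
      refine tendsto_iff_norm_sub_tendsto_zero.2 ?_
      have h5 := (tendsto_integral_V_abs hH (y := fun n => x (φ n) - p)
        (fun n => (norm_sub_le _ _).trans (add_le_add (hxb (φ n)) hp))
        (fun r hr => by
          simp only [val_sub _ _ hr]
          simpa using (hpt r hr).sub_const (val p r)) q).const_mul 2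
      rw [mul_zero] at h5
      refine squeeze_zero (fun _ => norm_nonneg _) (fun n => ?_) h5
      rw [vGrad_apply hH, vGrad_apply hH, Real.norm_eq_abs,
        ← integral_sub (integrable_V_vDer hH _ q) (integrable_V_vDer hH p q), ← integral_const_mul]
      refine abs_integral_le_of_abs_le ((integrable_V_abs hV _ q).const_mul 2) fun r hr => ?_
      have := abs_V_vDer_sub_le hH (x (φ n)) p q hr
      rwa [mul_sub, sub_mul] at this
    exact tendsto_nhds_unique ((h2.add h4).sub h3) h1

end Energy

/-! ## Regularity and positivity of critical points -/

theorem memLp_of_eq_zero_off {N : ℕ} (hN : 1 ≤ N) {f : ℝ → ℝ} (hf : ContinuousOn f (Ioi 0))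
    {a b : ℝ} (ha : 0 < a) (h0 : ∀ r, r ∉ Icc a b → f r = 0) : MemLp f 2 (rMeas N) := by
  rw [memLp_two_iff_integrable_sq (rMeas_aestronglyMeasurable hN hf)]
  have h1 : IntegrableOn (fun r => f r ^ 2) (Icc a b) (rMeas N) :=
    rMeas_integrableOn_Icc hN ha (hf.pow 2)
  refine (integrableOn_iff_integrable_of_support_subset fun r hr => ?_).1 h1
  by_contra h
  exact hr (by simp [h0 r h])

theorem tailInt_eq_zero {ψ : ℝ → ℝ} {b : ℝ} (h0 : ∀ r, b < r → ψ r = 0) {r : ℝ} (hr : b ≤ r) :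
    tailInt ψ r = 0 := by
  rw [tailInt, setIntegral_congr_fun measurableSet_Ioi (g := fun _ => (0 : ℝ))
    fun s (hs : r < s) => h0 s (hr.trans_lt hs)]
  simp

theorem hasDerivAt_tailInt_of_continuous {ξ : ℝ → ℝ} (hc : Continuous ξ) (hi : Integrable ξ)
    (r : ℝ) : HasDerivAt (tailInt ξ) (ξ r) r := by
  have e : tailInt ξ = fun r => tailInt ξ 0 + ∫ s in (0 : ℝ)..r, ξ s := by
    funext r
    have := intervalIntegral.integral_interval_add_Ioi (f := ξ) (a := 0) (b := r) (μ := volume)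
      hi.integrableOn hi.integrableOn
    simp only [tailInt]; linarith
  rw [e]
  exact (intervalIntegral.integral_hasDerivAt_right (hc.intervalIntegrable _ _)
    hc.aestronglyMeasurable.stronglyMeasurableAtFilter hc.continuousAt).const_add _

theorem hasDerivAt_tailInt {N : ℕ} (hN : 3 ≤ N) {ψ : ℝ → ℝ} (hψ : MemLp ψ 2 (rMeas N))
    (hc : ContinuousOn ψ (Ioi 0)) {r : ℝ} (hr : 0 < r) : HasDerivAt (tailInt ψ) (ψ r) r := by
  have h1 : HasDerivAt (fun s => tailInt ψ r + ∫ x in r..s, ψ x) (ψ r) r :=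
    (intervalIntegral.integral_hasDerivAt_right (by simp)
      (hc.stronglyMeasurableAtFilter isOpen_Ioi r hr) (hc.continuousAt (Ioi_mem_nhds hr))).const_add _
  refine h1.congr_of_eventuallyEq ?_
  filter_upwards [Ioi_mem_nhds hr] with s hs
  rw [← tailInt_sub hN hψ hr hs]; ring

theorem tendsto_tailInt_atTop {N : ℕ} (hN : 3 ≤ N) {ψ : ℝ → ℝ} (hψ : MemLp ψ 2 (rMeas N)) :
    Tendsto (tailInt ψ) atTop (𝓝 0) := by
  have hN' : (3 : ℝ) ≤ N := by exact_mod_cast hN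
  have h1 : Tendsto (fun r => decayConst N * dnorm N ψ * decay N r) atTop (𝓝 0) := by
    have h2 : Tendsto (decay N) atTop (𝓝 0) := by
      have := tendsto_rpow_neg_atTop (y := ((N : ℝ) - 2) / 2) (by linarith)
      refine this.congr fun r => ?_
      rw [decay, neg_div]
    simpa using h2.const_mul (decayConst N * dnorm N ψ)
  refine squeeze_zero_norm' ?_ h1
  filter_upwards [eventually_gt_atTop 0] with r hr using abs_tailInt_le hN hψ hr

/-- A `C¹` function on `(0, ∞)` that vanishes at infinity is recovered from its derivative. -/
theorem tailInt_eq_of_hasDerivAt {N : ℕ} (hN : 3 ≤ N) {u u' : ℝ → ℝ}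
    (hd : ∀ r, 0 < r → HasDerivAt u (u' r) r) (hc : ContinuousOn u' (Ioi 0))
    (h2 : MemLp u' 2 (rMeas N)) (h0 : Tendsto u atTop (𝓝 0)) {r : ℝ} (hr : 0 < r) :
    tailInt u' r = u r := by
  have h1 : ∀ᶠ s in atTop, tailInt u' s - u s = tailInt u' r - u r := by
    filter_upwards [eventually_gt_atTop r] with s hs
    have h3 := tailInt_sub hN h2 hr (hr.trans hs)
    rw [intervalIntegral.integral_eq_sub_of_hasDerivAt (f := u)] at h3
    · linarith
    · intro x hx
      rw [uIcc_of_le hs.le] at hx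
      exact hd x (hr.trans_le hx.1)
    · refine (hc.mono fun x hx => ?_).intervalIntegrable
      rw [uIcc_of_le hs.le] at hx
      exact hr.trans_le hx.1
  have h4 := ((tendsto_tailInt_atTop hN h2).sub h0).congr' h1
  rw [sub_zero] at h4
  have := tendsto_nhds_unique h4 tendsto_const_nhds
  linarith

theorem exists_bound_test {N : ℕ} (hN : 1 ≤ N) {ξ : ℝ → ℝ} (hξ : Continuous ξ)
    (hξc : HasCompactSupport ξ) (hξs : tsupport ξ ⊆ Ioi 0) :
    ∃ R > 0, (∀ r, R < r → ξ r = 0) ∧ MemLp ξ 2 (rMeas N) := by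
  obtain ⟨R₀, hR₀⟩ := hξc.isBounded.subset_closedBall 0
  have hξ0 : ∀ r, max R₀ 1 < r → ξ r = 0 := fun r hr => by
    by_contra hne
    have h1 := hR₀ (subset_tsupport ξ hne)
    rw [mem_closedBall_zero_iff, Real.norm_eq_abs] at h1
    have := le_max_left R₀ 1
    linarith [le_abs_self r]
  refine ⟨max R₀ 1, lt_max_of_lt_right one_pos, hξ0, ?_⟩
  by_cases hne : (tsupport ξ).Nonempty
  · obtain ⟨a, ha, ha'⟩ := hξc.exists_isLeast hne
    refine memLp_of_eq_zero_off hN hξ.continuousOn (hξs ha) (b := max R₀ 1) fun r hr => ?_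
    by_contra h3
    refine hr ⟨ha' (subset_tsupport ξ h3), ?_⟩
    by_contra h4
    exact h3 (hξ0 r (not_le.1 h4))
  · have : ξ = 0 := by
      funext r
      by_contra h3
      exact hne ⟨r, subset_tsupport ξ h3⟩
    rw [this]; exact MemLp.zero

/-- `C²` regularity for the radial equation in divergence form. -/
theorem exists_hasDerivAt_of_weak {N : ℕ} (hN : 3 ≤ N) {ψ F : ℝ → ℝ} (hψ : MemLp ψ 2 (rMeas N))
    (hF : ContinuousOn F (Ioi 0)) (hF1 : IntegrableOn (fun r => r ^ (N - 1) * F r) (Ioc 0 1))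
    (h : ∀ ξ : ℝ → ℝ, ContDiff ℝ ∞ ξ → HasCompactSupport ξ → tsupport ξ ⊆ Ioi 0 →
      ∫ r, ψ r * ξ r ∂(rMeas N) = ∫ r, F r * tailInt ξ r ∂(rMeas N)) :
    ∃ ψ₀ : ℝ → ℝ, ψ =ᵐ[rMeas N] ψ₀ ∧
      ∀ r, 0 < r → HasDerivAt ψ₀ (-((N - 1 : ℝ) / r * ψ₀ r) - F r) r := by
  have hN1 : 1 ≤ N := by omega
  set Φ : ℝ → ℝ := fun r => r ^ (N - 1) * F r with hΦ
  have hΦc : ContinuousOn Φ (Ioi 0) := (continuousOn_pow _).mul hF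
  have hΦi : ∀ R, 0 < R → IntervalIntegrable Φ volume 0 R := fun R hR => by
    have h1 : IntervalIntegrable Φ volume 0 1 :=
      (intervalIntegrable_iff_integrableOn_Ioc_of_le zero_le_one).2 hF1
    refine h1.trans (hΦc.mono fun x hx => ?_).intervalIntegrable
    exact (lt_min one_pos hR).trans_le hx.1
  -- The primitive can start at `0` because `r^{N-1} F` is integrable there; the equation becomes
  -- `r^{N-1} ψ = -P`.
  set P : ℝ → ℝ := fun r => ∫ s in (0 : ℝ)..r, Φ s with hP
  have hPd : ∀ r, 0 < r → HasDerivAt P (Φ r) r := fun r hr =>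
    intervalIntegral.integral_hasDerivAt_right (hΦi r hr)
      (hΦc.stronglyMeasurableAtFilter isOpen_Ioi r hr) (hΦc.continuousAt (Ioi_mem_nhds hr))
  have hPc : ∀ R, 0 < R → ContinuousOn P (uIcc 0 R) := fun R hR =>
    intervalIntegral.continuousOn_primitive_interval'
      (hΦi R hR) left_mem_uIcc
  have hPc' : ContinuousOn P (Ioi 0) := fun r hr => (hPd r hr).continuousAt.continuousWithinAt
  have hψloc : LocallyIntegrableOn ψ (Ioi 0) := fun x hx =>
    ⟨Ioi (x / 2), mem_nhdsWithin_of_mem_nhds (Ioi_mem_nhds (half_lt_self hx)),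
      integrableOn_Ioi hN hψ (half_pos hx)⟩
  have hloc : LocallyIntegrableOn (fun r => r ^ (N - 1) * ψ r + P r) (Ioi 0) :=
    (hψloc.continuousOn_mul (continuousOn_pow _) isOpen_Ioi.isLocallyClosed).add
      (hPc'.locallyIntegrableOn measurableSet_Ioi)
  -- Du Bois-Reymond without an integration constant: `ξ` is the derivative of the test element,
  -- whose primitive need only vanish at infinity and not at `0`, so no zero mean condition
  -- restricts `ξ`.
  have hae := isOpen_Ioi.ae_eq_zero_of_integral_contDiff_smul_eq_zero hloc
    fun ξ hξ hξc hξs => ?_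
  · refine ⟨fun r => -P r / r ^ (N - 1), (rMeas_ae_iff hN1).2 ?_, fun r hr => ?_⟩
    · rw [ae_restrict_iff' measurableSet_Ioi]
      filter_upwards [hae] with r hr hr0
      have hp : 0 < r ^ (N - 1) := pow_pos hr0 _
      rw [eq_div_iff hp.ne']
      linarith [hr hr0]
    · have h1 := ((hPd r hr).neg.div (hasDerivAt_pow (N - 1) r) (pow_pos hr _).ne')
      refine h1.congr_deriv ?_
      obtain ⟨n, rfl⟩ : ∃ n, N = n + 2 := ⟨N - 2, by omega⟩
      simp only [hΦ, Nat.add_succ_sub_one, Pi.neg_apply]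
      push_cast
      field_simp
      ring
  · have hξi : Integrable ξ := hξ.continuous.integrable_of_hasCompactSupport hξc
    obtain ⟨R, hR, hξ0, hξmem⟩ := exists_bound_test hN1 hξ.continuous hξc hξs
    have hq0 : ∀ r, R ≤ r → tailInt ξ r = 0 := fun r hr => tailInt_eq_zero hξ0 hr
    have hqd := hasDerivAt_tailInt_of_continuous hξ.continuous hξi
    have hqc : Continuous (tailInt ξ) := continuous_iff_continuousAt.2 fun r => (hqd r).continuousAt
    have restr : ∀ f : ℝ → ℝ, (∀ r, R < r → f r = 0) →
        ∫ r in Ioi 0, f r = ∫ r in (0 : ℝ)..R, f r := fun f hf => by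
      rw [intervalIntegral.integral_of_le hR.le]
      refine (setIntegral_eq_of_subset_of_forall_sdiff_eq_zero measurableSet_Ioi
        (fun x hx => hx.1) fun x hx => hf x ?_)
      by_contra hle
      exact hx.2 ⟨hx.1, not_lt.1 hle⟩
    -- The boundary terms vanish: at `0` because `P 0 = 0`, at `R` because the primitive of `ξ`
    -- vanishes there.
    have ibp := intervalIntegral.integral_deriv_mul_eq_sub_of_hasDerivAt (a := 0) (b := R)
      (hPc R hR) hqc.continuousOn (fun x hx => hPd x (by
        rw [min_eq_left hR.le] at hx; exact hx.1)) (fun x _ => hqd x) (hΦi R hR)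
      (hξ.continuous.intervalIntegrable _ _)
    have hP0 : P 0 = 0 := by simp [hP]
    rw [hq0 R le_rfl, hP0, mul_zero, zero_mul, sub_zero,
      intervalIntegral.integral_add ((hΦi R hR).mul_continuousOn hqc.continuousOn)
        ((hξ.continuous.intervalIntegrable 0 R).continuousOn_mul (hPc R hR))] at ibp
    have h1 := h ξ hξ hξc hξs
    rw [rMeas_integral hN1, rMeas_integral hN1] at h1
    have h2 := mul_left_cancel₀ (sphereArea_pos hN1).ne' h1
    have e1 : ∫ r in Ioi 0, r ^ (N - 1) * (F r * tailInt ξ r)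
        = ∫ r in (0 : ℝ)..R, Φ r * tailInt ξ r := by
      rw [← restr _ fun r hr => by rw [hq0 r hr.le, mul_zero]]
      simp only [hΦ, mul_assoc]
    have e2 : ∫ r in Ioi 0, P r * ξ r = ∫ r in (0 : ℝ)..R, P r * ξ r :=
      restr _ fun r hr => by rw [hξ0 r hr, mul_zero]
    have i1 : IntegrableOn (fun r => r ^ (N - 1) * (ψ r * ξ r)) (Ioi 0) :=
      (rMeas_integrable_iff hN1).1 (hψ.integrable_mul hξmem)
    have i2 : IntegrableOn (fun r => P r * ξ r) (Ioi 0) := by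
      have h3 : IntegrableOn (fun r => P r * ξ r) (Ioc 0 R) :=
        (intervalIntegrable_iff_integrableOn_Ioc_of_le hR.le).1
          ((hξ.continuous.intervalIntegrable 0 R).continuousOn_mul (hPc R hR))
      refine h3.of_forall_sdiff_eq_zero measurableSet_Ioi fun x hx => ?_
      rw [hξ0 x, mul_zero]
      by_contra hle
      exact hx.2 ⟨hx.1, not_lt.1 hle⟩
    have e3 : ∫ r, ξ r • (r ^ (N - 1) * ψ r + P r)
        = ∫ r in Ioi 0, (r ^ (N - 1) * (ψ r * ξ r) + P r * ξ r) := by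
      rw [← setIntegral_eq_integral_of_forall_compl_eq_zero (s := Ioi 0)]
      · refine integral_congr_ae (Eventually.of_forall fun r => ?_)
        simp only [smul_eq_mul]; ring
      · intro x hx
        have : ξ x = 0 := by
          by_contra h3
          exact hx (hξs (subset_tsupport ξ h3))
        rw [this, zero_smul]
    rw [e3, integral_add i1 i2, h2, e1, e2]
    exact ibp

section Regularity

variable {N : ℕ} [hN : Fact (3 ≤ N)] {V K g : ℝ → ℝ} {a b σ C R : ℝ} {m : ℝ → ℝ} {q₁ q₂ : ℝ}

theorem exists_rad (hH : HypH V K) {u u' : ℝ → ℝ} (hd : ∀ r, 0 < r → HasDerivAt u (u' r) r)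
    (hc : ContinuousOn u' (Ioi 0)) (h2 : MemLp u' 2 (rMeas N)) (h0 : Tendsto u atTop (𝓝 0))
    (hV : Integrable (fun r => V r * u r ^ 2) (rMeas N)) :
    ∃ q : RadSpace N V, der q =ᵐ[rMeas N] u' ∧ ∀ r, 0 < r → val q r = u r := by
  have hu : ContinuousOn u (Ioi 0) := fun r hr => (hd r hr).continuousAt.continuousWithinAt
  have e : ∀ r, 0 < r → tailInt u' r = u r := fun r hr =>
    tailInt_eq_of_hasDerivAt (three_le N) hd hc h2 h0 hr
  have hv : MemLp (fun r => √(V r) * tailInt u' r) 2 (rMeas N) := by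
    have h1 : MemLp (fun r => √(V r) * u r) 2 (rMeas N) := by
      have hm : ContinuousOn (fun r => √(V r) * u r) (Ioi 0) :=
        (Real.continuous_sqrt.comp_continuousOn hH.V_cont).mul hu
      rw [memLp_two_iff_integrable_sq (rMeas_aestronglyMeasurable (one_le_dim N) hm)]
      refine hV.congr ?_
      filter_upwards [rMeas_ae_pos (one_le_dim N)] with r hr
      rw [mul_pow, Real.sq_sqrt (hH.V_nonneg r hr)]
    refine h1.ae_eq ?_
    filter_upwards [rMeas_ae_pos (one_le_dim N)] with r hr
    rw [e r hr]
  exact ⟨mkRad u' h2 hv, der_mkRad h2 hv, fun r hr => by rw [val_mkRad h2 hv hr, e r hr]⟩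

theorem radGrad_eq (hH : HypH V K) (gb : GrowthBound N V K g a b σ C R m)
    (hb : Continuous (bFun g)) (p q : RadSpace N V) :
    radGrad K g p q = ∫ r, der p r * der q r ∂(rMeas N)
      + ∫ r, V r * aFun (val p r) * val q r ∂(rMeas N)
      - ∫ r, K r * bFun g (val p r) * val q r ∂(rMeas N) := by
  rw [radGrad_apply, vGrad_apply hH, kGrad_apply hH gb hb, inner_eq hH.V_nonneg, add_assoc,
    ← integral_add (integrable_V_mul hH.V_nonneg p q) (integrable_V_vDer hH p q)]
  congr 3; funext r; rw [vDer]; ring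

theorem integrable_V_aFun_mul (hH : HypH V K) (p q : RadSpace N V) :
    Integrable (fun r => V r * aFun (val p r) * val q r) (rMeas N) := by
  refine ((integrable_V_vDer hH p q).add (integrable_V_mul hH.V_nonneg p q)).congr
    (Eventually.of_forall fun r => ?_)
  simp only [Pi.add_apply, vDer]; ring

/-- Testing the critical point equation with primitives of smooth compactly supported `ξ` gives the
weak form of `(r^{N-1} u')' = -r^{N-1} F`, where `F` is continuous on `(0, ∞)`; hence `u'` has a
differentiable representative. -/
theorem critical_regularity (hH : HypH V K) (gb : GrowthBound N V K g a b σ C R m)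
    (hb : Continuous (bFun g)) {p : RadSpace N V} (hp : radGrad K g p = 0) :
    ∃ u' : ℝ → ℝ, der p =ᵐ[rMeas N] u' ∧ (∀ r, 0 < r → HasDerivAt (val p) (u' r) r) ∧
      ∀ r, 0 < r → HasDerivAt u' (-((N - 1 : ℝ) / r * u' r)
        - (K r * bFun g (val p r) - V r * aFun (val p r))) r := by
  set F : ℝ → ℝ := fun r => K r * bFun g (val p r) - V r * aFun (val p r) with hF
  have hFc : ContinuousOn F (Ioi 0) := (hH.K_cont.mul (continuousOn_comp_val hb p)).sub
    (hH.V_cont.mul (continuousOn_comp_val continuous_aFun p))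
  have hFq : ∀ q : RadSpace N V, Integrable (fun r => F r * val q r) (rMeas N) := fun q => by
    refine ((integrable_K_bFun hH gb hb p q).sub (integrable_V_aFun_mul hH p q)).congr
      (Eventually.of_forall fun r => ?_)
    simp only [Pi.sub_apply, hF]; ring
  -- `F` is integrable against every element of the radial space, in particular against the bump
  -- function, which is `1` on `(0, 1]`.
  have hF1 : IntegrableOn (fun r => r ^ (N - 1) * F r) (Ioc 0 1) := by
    obtain ⟨φ, hφ⟩ := exists_bump (N := N) hH
    have h1 := (((rMeas_integrable_iff (one_le_dim N)).1 (hFq φ)).mono_set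
      (s := Ioc (0 : ℝ) 1) fun x hx => hx.1)
    refine h1.congr_fun (fun r hr => ?_) measurableSet_Ioc
    simp only; rw [hφ r hr, mul_one]
  obtain ⟨u', h1, h2⟩ := exists_hasDerivAt_of_weak (three_le N) (memLp_der p) hFc hF1
    fun ξ hξ hξc hξs => by
      obtain ⟨R', -, hξ0, hξmem⟩ := exists_bound_test (one_le_dim N) hξ.continuous hξc hξs
      have hq0 : ∀ r, R' ≤ r → tailInt ξ r = 0 := fun r hr => tailInt_eq_zero hξ0 hr
      set q : RadSpace N V := mkVan hH hξmem hq0 with hq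
      have h3 := radGrad_eq hH gb hb p q
      rw [hp, zero_apply, add_sub_assoc, ← integral_sub (integrable_V_aFun_mul hH p q)
        (integrable_K_bFun hH gb hb p q)] at h3
      have e1 : ∫ r, der p r * der q r ∂(rMeas N) = ∫ r, der p r * ξ r ∂(rMeas N) := by
        refine integral_congr_ae ?_
        filter_upwards [der_mkRad hξmem (memLp_sqrt_V_mul hH hξmem hq0)] with r hr
        rw [hq, mkVan, hr]
      have e2 : ∫ r, F r * tailInt ξ r ∂(rMeas N) = -∫ r, (V r * aFun (val p r) * val q r
          - K r * bFun g (val p r) * val q r) ∂(rMeas N) := by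
        rw [← integral_neg]
        refine integral_congr_ae ?_
        filter_upwards [rMeas_ae_pos (one_le_dim N)] with r hr
        rw [hq, mkVan, val_mkRad _ _ hr, hF]; ring
      rw [e2]; linarith
  have hu'c : ContinuousOn u' (Ioi 0) := fun r hr => (h2 r hr).continuousAt.continuousWithinAt
  have hmem : MemLp u' 2 (rMeas N) := (memLp_der p).ae_eq h1
  refine ⟨u', h1, fun r hr => ?_, h2⟩
  refine (hasDerivAt_tailInt (three_le N) hmem hu'c hr).congr_of_eventuallyEq ?_
  filter_upwards [Ioi_mem_nhds hr] with s hs using tailInt_congr (one_le_dim N) h1 hs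

/-! ### Nonnegativity by testing with the negative part. -/

/-- A bounded increasing function vanishing on `[0, ∞)`. -/
def negCut (t : ℝ) : ℝ := -(min t 0 ^ 2 / (1 + min t 0 ^ 2))

/-- The derivative of `negCut`. -/
def negCutDer (t : ℝ) : ℝ := -(2 * min t 0) / (1 + min t 0 ^ 2) ^ 2

theorem hasDerivAt_min_sq (t : ℝ) : HasDerivAt (fun t : ℝ => min t 0 ^ 2) (2 * min t 0) t := by
  rcases lt_trichotomy t 0 with h | h | h
  · rw [min_eq_left h.le]
    have := hasDerivAt_pow 2 t
    refine (this.congr_of_eventuallyEq ?_).congr_deriv (by simp)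
    filter_upwards [Iio_mem_nhds h] with s hs
    rw [min_eq_left (le_of_lt hs)]
  · subst h
    rw [min_self, mul_zero, hasDerivAt_iff_isLittleO_nhds_zero]
    refine Asymptotics.IsBigO.trans_isLittleO (g := fun h : ℝ => h ^ 2) ?_
      (Asymptotics.isLittleO_pow_id one_lt_two)
    refine Asymptotics.IsBigO.of_bound 1 (Eventually.of_forall fun s => ?_)
    simp only [zero_add, min_self, smul_zero, sub_zero, one_mul, Real.norm_eq_abs, abs_pow, sq_abs]
    norm_num
    rcases le_total s 0 with hs | hs
    · rw [min_eq_left hs]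
    · rw [min_eq_right hs]; simpa using sq_nonneg s
  · rw [min_eq_right h.le, mul_zero]
    refine (hasDerivAt_const t (0 : ℝ)).congr_of_eventuallyEq ?_
    filter_upwards [Ioi_mem_nhds h] with s hs
    rw [min_eq_right (le_of_lt hs)]; simp

theorem hasDerivAt_negCut (t : ℝ) : HasDerivAt negCut (negCutDer t) t := by
  have h := hasDerivAt_min_sq t
  refine ((h.div (h.const_add 1) (by positivity)).neg).congr_deriv ?_
  rw [negCutDer]; field_simp; ring

theorem continuous_negCutDer : Continuous negCutDer := by
  unfold negCutDer
  refine Continuous.div (by fun_prop) (by fun_prop) fun t => by positivity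

theorem negCutDer_nonneg (t : ℝ) : 0 ≤ negCutDer t := by
  have := min_le_right t 0
  exact div_nonneg (by linarith) (by positivity)

theorem negCutDer_le_one (t : ℝ) : negCutDer t ≤ 1 := by
  rw [negCutDer, div_le_one (by positivity)]
  nlinarith [sq_nonneg (min t 0 + 1), sq_nonneg (min t 0), sq_nonneg (min t 0 ^ 2)]

theorem negCut_of_nonneg {t : ℝ} (ht : 0 ≤ t) : negCut t = 0 := by simp [negCut, min_eq_right ht]

theorem negCut_of_neg {t : ℝ} (ht : t < 0) : negCut t < 0 := by
  rw [negCut, min_eq_left ht.le, neg_lt_zero]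
  have := sq_pos_of_neg ht
  positivity

theorem negCut_sq_le (t : ℝ) : negCut t ^ 2 ≤ t ^ 2 := by
  rcases le_or_gt 0 t with h | h
  · rw [negCut_of_nonneg h]; simpa using sq_nonneg t
  · rw [negCut, min_eq_left h.le, neg_sq]
    have h0 : 0 ≤ t ^ 2 / (1 + t ^ 2) := by positivity
    refine (pow_le_pow_left₀ h0 (?_ : _ ≤ |t|) 2).trans_eq (sq_abs t)
    rw [div_le_iff₀ (by positivity), ← sq_abs t]
    nlinarith [abs_nonneg t, sq_nonneg (|t| - 1), mul_nonneg (abs_nonneg t) (sq_nonneg (|t| - 1))]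

/-- Critical points for a nonlinearity that vanishes on `(-∞, 0]` are nonnegative. -/
theorem val_nonneg_of_critical (hH : HypH V K) (gb : GrowthBound N V K g a b σ C R m)
    (hb : Continuous (bFun g)) (hb0 : ∀ t ≤ 0, bFun g t = 0) {p : RadSpace N V}
    (hp : radGrad K g p = 0) {r : ℝ} (hr : 0 < r) : 0 ≤ val p r := by
  obtain ⟨u', h1, h2, h3⟩ := critical_regularity hH gb hb hp
  have hu'c : ContinuousOn u' (Ioi 0) := fun r hr => (h3 r hr).continuousAt.continuousWithinAt
  have hmem : MemLp u' 2 (rMeas N) := (memLp_der p).ae_eq h1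
  have hnc : Continuous negCut :=
    continuous_iff_continuousAt.2 fun t => (hasDerivAt_negCut t).continuousAt
  have hdc : ContinuousOn (fun r => negCutDer (val p r) * u' r) (Ioi 0) :=
    (continuousOn_comp_val continuous_negCutDer p).mul hu'c
  -- The test element replaces `min u 0` by a `C¹` function of `u`, so that the ordinary chain rule
  -- applies; its derivative lies in `[0, 1]`, which keeps the test element in the radial space.
  obtain ⟨q, hq1, hq2⟩ := exists_rad hH (u := fun r => negCut (val p r))
    (u' := fun r => negCutDer (val p r) * u' r)
    (fun r hr => (hasDerivAt_negCut _).comp r (h2 r hr)) hdc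
    (hmem.mono (rMeas_aestronglyMeasurable (one_le_dim N) hdc) (Eventually.of_forall fun r => by
      rw [norm_mul, Real.norm_eq_abs, abs_of_nonneg (negCutDer_nonneg _)]
      exact mul_le_of_le_one_left (norm_nonneg _) (negCutDer_le_one _)))
    (by
      have h4 := (hnc.tendsto 0).comp (tendsto_tailInt_atTop (three_le N) (memLp_der p))
      rwa [negCut_of_nonneg le_rfl] at h4)
    (integrable_of_abs_le (hH.V_cont.mul (continuousOn_comp_val (hnc.pow 2) p))
      (integrable_V_sq hH p) fun r hr => by
        have hv := hH.V_nonneg r hr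
        rw [abs_of_nonneg (by positivity)]
        exact mul_le_mul_of_nonneg_left (negCut_sq_le _) hv)
  have h4 := radGrad_eq hH gb hb p q
  rw [hp, zero_apply] at h4
  have e1 : ∫ r, K r * bFun g (val p r) * val q r ∂(rMeas N) = 0 := by
    refine integral_eq_zero_of_ae ?_
    filter_upwards [rMeas_ae_pos (one_le_dim N)] with r hr
    rw [hq2 r hr]
    rcases le_total (val p r) 0 with h | h
    · rw [hb0 _ h]; simp
    · rw [negCut_of_nonneg h]; simp
  have e2 : 0 ≤ ∫ r, V r * aFun (val p r) * val q r ∂(rMeas N) := by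
    refine integral_nonneg_of_ae ?_
    filter_upwards [rMeas_ae_pos (one_le_dim N)] with r hr
    have hv := hH.V_nonneg r hr
    rw [hq2 r hr, Pi.zero_apply]
    rcases le_or_gt 0 (val p r) with h | h
    · rw [negCut_of_nonneg h, mul_zero]
    · have h5 : aFun (val p r) ≤ 0 := by
        have h6 := dualChange_nonneg (t := -val p r) (by linarith)
        rw [dualChange_neg] at h6
        exact mul_nonpos_of_nonpos_of_nonneg (by linarith) (dualSlope_pos _).le
      exact mul_nonneg_of_nonpos_of_nonpos (mul_nonpos_of_nonneg_of_nonpos hv h5)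
        (negCut_of_neg h).le
  -- A factor in `[0, 1]` dominates its square. As the `V` term is nonnegative and the `K` term
  -- vanishes, the test element has zero gradient, so by the decay estimate it is zero.
  have e3 : dnorm N (der q) ^ 2 ≤ ∫ r, der p r * der q r ∂(rMeas N) := by
    rw [dnorm_sq]
    refine integral_mono_ae ((memLp_der q).integrable_sq) (integrable_der_mul p q) ?_
    filter_upwards [h1, hq1] with r e e'
    rw [e, e']
    have h5 := negCutDer_nonneg (val p r)
    have h6 := negCutDer_le_one (val p r)
    nlinarith [mul_nonneg (mul_nonneg h5 (sub_nonneg.2 h6)) (sq_nonneg (u' r))]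
  have e4 : dnorm N (der q) = 0 := by
    have := dnorm_nonneg N (der q)
    nlinarith
  have h5 := abs_val_le_dnorm q hr
  rw [e4, hq2 r hr] at h5
  simp only [mul_zero, zero_mul] at h5
  have h6 := abs_nonpos_iff.1 h5
  by_contra h7
  exact (negCut_of_neg (not_le.1 h7)).ne h6

end Regularity

/-! ## The radial Sobolev space as a space of derivatives -/

section Radial

variable {N : ℕ}

theorem HasGradientAt_comp_norm {F : ℝ → ℝ} {c : ℝ} {x : EuclideanSpace ℝ (Fin N)} (hx : x ≠ 0)
    (hF : HasDerivAt F c ‖x‖) :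
    HasGradientAt (fun y : EuclideanSpace ℝ (Fin N) => F ‖y‖) (c • (‖x‖⁻¹ • x)) x := by
  have hx' : ‖x‖ ≠ 0 := norm_ne_zero_iff.2 hx
  have h1 : HasFDerivAt (fun y : EuclideanSpace ℝ (Fin N) => ‖y‖) (‖x‖⁻¹ • innerSL ℝ x) x := by
    have h2 := (hasStrictFDerivAt_norm_sq x).hasFDerivAt.sqrt (pow_ne_zero 2 hx')
    simp only [Real.sqrt_sq (norm_nonneg _)] at h2
    refine h2.congr_fderiv ?_
    ext y
    simp only [smul_apply, smul_eq_mul, nsmul_eq_mul, Nat.cast_ofNat]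
    field_simp
  have h3 := hF.comp_hasFDerivAt x h1
  rw [hasGradientAt_iff_hasFDerivAt]
  refine h3.congr_fderiv ?_
  ext y
  simp

/-- The radial vector field `x ↦ ψ(|x|) x / |x|`. -/
def radVec (ψ : ℝ → ℝ) (x : EuclideanSpace ℝ (Fin N)) : EuclideanSpace ℝ (Fin N) :=
  ψ ‖x‖ • (‖x‖⁻¹ • x)

theorem norm_radVec (ψ : ℝ → ℝ) {x : EuclideanSpace ℝ (Fin N)} (hx : x ≠ 0) :
    ‖radVec ψ x‖ = |ψ ‖x‖| := by
  rw [radVec, norm_smul, norm_smul, norm_inv, norm_norm, inv_mul_cancel₀ (norm_ne_zero_iff.2 hx),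
    mul_one, Real.norm_eq_abs]

theorem inner_radVec (ψ φ : ℝ → ℝ) {x : EuclideanSpace ℝ (Fin N)} (hx : x ≠ 0) :
    inner ℝ (radVec ψ x) (radVec φ x) = ψ ‖x‖ * φ ‖x‖ := by
  have hx' : ‖x‖ ≠ 0 := norm_ne_zero_iff.2 hx
  simp only [radVec, inner_smul_left, inner_smul_right, real_inner_self_eq_norm_sq, conj_trivial]
  field_simp

theorem ae_ne_zero_euclidean (hN : 1 ≤ N) : ∀ᵐ x : EuclideanSpace ℝ (Fin N), x ≠ 0 := by
  filter_upwards [ae_comp_norm (rMeas_ae_pos hN)] with x hx using norm_pos_iff.1 hx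

theorem aestronglyMeasurable_radVec {ψ : ℝ → ℝ} (hψ : AEStronglyMeasurable ψ (rMeas N)) :
    AEStronglyMeasurable (radVec ψ : EuclideanSpace ℝ (Fin N) → _) volume := by
  have h1 : AEStronglyMeasurable (fun x : EuclideanSpace ℝ (Fin N) => ψ ‖x‖) volume :=
    hψ.comp_measurable (measurable_norm_euclidean N)
  exact h1.smul (by fun_prop : Measurable fun x : EuclideanSpace ℝ (Fin N) => ‖x‖⁻¹ • x).aestronglyMeasurable

theorem eLpNorm_radVec (hN : 1 ≤ N) {ψ : ℝ → ℝ} (hψ : AEStronglyMeasurable ψ (rMeas N)) :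
    eLpNorm (radVec ψ : EuclideanSpace ℝ (Fin N) → _) 2 volume = eLpNorm ψ 2 (rMeas N) := by
  rw [← eLpNorm_comp_norm hψ]
  refine eLpNorm_congr_norm_ae ?_
  filter_upwards [ae_ne_zero_euclidean hN] with x hx
  rw [norm_radVec ψ hx, Real.norm_eq_abs]

theorem memLp_radVec (hN : 1 ≤ N) {ψ : ℝ → ℝ} (hψ : MemLp ψ 2 (rMeas N)) :
    MemLp (radVec ψ : EuclideanSpace ℝ (Fin N) → _) 2 volume :=
  ⟨aestronglyMeasurable_radVec hψ.1, by rw [eLpNorm_radVec hN hψ.1]; exact hψ.2⟩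

theorem radVec_sub (ψ φ : ℝ → ℝ) :
    (radVec (ψ - φ) : EuclideanSpace ℝ (Fin N) → _) = radVec ψ - radVec φ := by
  funext x; simp [radVec, sub_smul]

theorem radVec_congr {ψ φ : ℝ → ℝ} (h : ψ =ᵐ[rMeas N] φ) :
    (radVec ψ : EuclideanSpace ℝ (Fin N) → _) =ᵐ[volume] radVec φ := by
  filter_upwards [ae_comp_norm h] with x hx
  rw [radVec, radVec, hx]

theorem tailInt_sub_fun (hN : 3 ≤ N) {ψ φ : ℝ → ℝ} (hψ : MemLp ψ 2 (rMeas N))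
    (hφ : MemLp φ 2 (rMeas N)) {r : ℝ} (hr : 0 < r) :
    tailInt (ψ - φ) r = tailInt ψ r - tailInt φ r := by
  have := tailInt_add hN (hψ.sub hφ) hφ hr
  rw [sub_add_cancel] at this
  linarith

theorem eLpNorm_two_eq {ψ : ℝ → ℝ} (hψ : MemLp ψ 2 (rMeas N)) :
    eLpNorm ψ 2 (rMeas N) = ENNReal.ofReal (dnorm N ψ) := by
  rw [hψ.eLpNorm_eq_integral_rpow_norm two_ne_zero ENNReal.ofNat_ne_top, dnorm, Real.sqrt_eq_rpow]
  simp

theorem tendsto_dnorm_sub {ψ : ℕ → ℝ → ℝ} {φ : ℝ → ℝ} (hψ : ∀ n, MemLp (ψ n) 2 (rMeas N))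
    (hφ : MemLp φ 2 (rMeas N)) (h : Tendsto (fun n => eLpNorm (ψ n - φ) 2 (rMeas N)) atTop (𝓝 0)) :
    Tendsto (fun n => dnorm N (ψ n - φ)) atTop (𝓝 0) := by
  have h1 := (ENNReal.tendsto_toReal ENNReal.zero_ne_top).comp h
  rw [ENNReal.toReal_zero] at h1
  refine h1.congr fun n => ?_
  rw [Function.comp, eLpNorm_two_eq ((hψ n).sub hφ), ENNReal.toReal_ofReal (dnorm_nonneg _ _)]

theorem tendsto_tailInt_of_eLpNorm (hN : 3 ≤ N) {ψ : ℕ → ℝ → ℝ} {φ : ℝ → ℝ}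
    (hψ : ∀ n, MemLp (ψ n) 2 (rMeas N)) (hφ : MemLp φ 2 (rMeas N))
    (h : Tendsto (fun n => eLpNorm (ψ n - φ) 2 (rMeas N)) atTop (𝓝 0)) {r : ℝ} (hr : 0 < r) :
    Tendsto (fun n => tailInt (ψ n) r) atTop (𝓝 (tailInt φ r)) := by
  refine tendsto_iff_norm_sub_tendsto_zero.2 ?_
  have h1 := ((tendsto_dnorm_sub hψ hφ h).const_mul (decayConst N)).mul_const (decay N r)
  simp only [mul_zero, zero_mul] at h1
  refine squeeze_zero (fun _ => norm_nonneg _) (fun n => ?_) h1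
  rw [← tailInt_sub_fun hN (hψ n) hφ hr]
  exact abs_tailInt_le hN ((hψ n).sub hφ) hr

/-! ### Profiles of radial test functions -/

/-- Restricting to a line through the origin gives a smooth profile on all of `ℝ`, equal on `(0, ∞)`
to the primitive of its own derivative. -/
theorem IsRadialTest.exists_profile (hN : 3 ≤ N) {φ : EuclideanSpace ℝ (Fin N) → ℝ}
    (hφ : IsRadialTest φ) : ∃ F : ℝ → ℝ, ContDiff ℝ ∞ F ∧ HasCompactSupport F ∧
      (∀ x, φ x = F ‖x‖) ∧ MemLp (deriv F) 2 (rMeas N) ∧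
      (∀ r, 0 < r → tailInt (deriv F) r = F r) ∧ ∀ x, x ≠ 0 → gradient φ x = radVec (deriv F) x := by
  have hN1 : 1 ≤ N := by omega
  set e : EuclideanSpace ℝ (Fin N) := EuclideanSpace.single ⟨0, hN1⟩ 1 with he
  have hen : ‖e‖ = 1 := by simp [he]
  set F : ℝ → ℝ := fun r => φ (r • e) with hF
  have hFs : ContDiff ℝ ∞ F := hφ.smooth.comp (contDiff_id.smul contDiff_const)
  have hFc : HasCompactSupport F := by
    obtain ⟨R, hR⟩ := hφ.compact.isBounded.subset_closedBall 0
    refine HasCompactSupport.of_support_subset_isCompact (isCompact_Icc (a := -R) (b := R))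
      fun r hr => ?_
    have h1 := hR (subset_tsupport φ hr)
    rw [mem_closedBall_zero_iff, norm_smul, hen, mul_one, Real.norm_eq_abs] at h1
    exact abs_le.1 h1
  have hFx : ∀ x, φ x = F ‖x‖ := fun x => hφ.radial _ _ (by simp [norm_smul, hen])
  have hdc : Continuous (deriv F) := hFs.continuous_deriv (by simp)
  have hd : ∀ r, HasDerivAt F (deriv F r) r := fun r =>
    (hFs.differentiable (by simp) r).hasDerivAt
  have hmem : MemLp (deriv F) 2 (rMeas N) := by
    rw [memLp_two_iff_integrable_sq (rMeas_aestronglyMeasurable hN1 hdc.continuousOn),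
      rMeas_integrable_iff hN1]
    refine (Continuous.integrable_of_hasCompactSupport (by fun_prop) ?_).integrableOn
    have := hFc.deriv
    refine HasCompactSupport.mul_left (f := fun r : ℝ => r ^ (N - 1)) ?_
    exact this.comp_left (g := fun t : ℝ => t ^ 2) (by simp)
  refine ⟨F, hFs, hFc, hFx, hmem, fun r hr => ?_, fun x hx => ?_⟩
  · refine tailInt_eq_of_hasDerivAt hN (fun r _ => hd r) hdc.continuousOn hmem ?_ hr
    have := hFc.is_zero_at_infty
    exact this.mono_left atTop_le_cocompact
  · have h1 := HasGradientAt_comp_norm hx (hd ‖x‖)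
    rw [show φ = fun y => F ‖y‖ from funext hFx]
    exact h1.gradient

/-- Elements of `D_r^{1,2}` are primitives of radial derivatives. -/
theorem HasRadialGrad.exists_tailInt (hN : 3 ≤ N) {u : EuclideanSpace ℝ (Fin N) → ℝ}
    {v : EuclideanSpace ℝ (Fin N) → EuclideanSpace ℝ (Fin N)} (h : HasRadialGrad u v) :
    ∃ ψ : ℝ → ℝ, MemLp ψ 2 (rMeas N) ∧ u =ᵐ[volume] (fun x => tailInt ψ ‖x‖) ∧
      v =ᵐ[volume] radVec ψ := by
  have hN1 : 1 ≤ N := by omega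
  obtain ⟨hu, hv, φ, hφ, hφu, hφv⟩ := h
  choose F hFs hFc hFx hFm hFt hFg using fun n => (hφ n).exists_profile hN
  have hgr : ∀ n, gradient (φ n) =ᵐ[volume] radVec (deriv (F n)) := fun n => by
    filter_upwards [ae_ne_zero_euclidean hN1] with x hx using hFg n x hx
  have hv1 : Tendsto (fun n => eLpNorm (radVec (deriv (F n)) - v) 2 volume) atTop (𝓝 0) :=
    hφv.congr fun n => eLpNorm_congr_ae ((hgr n).sub EventuallyEq.rfl)
  -- For radial fields the `L²` norm on `ℝ^N` is that of the radial derivative, so the derivatives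
  -- of the profiles have a limit in `L²`. Its primitive is identified with `u` because the decay
  -- estimate makes the profiles converge pointwise, and its radial field with `v` by uniqueness of
  -- limits.
  have hcau : CauchySeq fun n => (hFm n).toLp (deriv (F n)) := by
    rw [EMetric.cauchySeq_iff]
    intro ε hε
    obtain ⟨n₀, hn₀⟩ := eventually_atTop.1 (hv1.eventually_lt_const (ENNReal.half_pos hε.ne'))
    refine ⟨n₀, fun n hn k hk => ?_⟩
    rw [Lp.edist_toLp_toLp, ← eLpNorm_radVec hN1 ((hFm n).sub (hFm k)).1, radVec_sub]
    have e : (radVec (deriv (F n)) : EuclideanSpace ℝ (Fin N) → _) - radVec (deriv (F k))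
        = (radVec (deriv (F n)) - v) - (radVec (deriv (F k)) - v) := by abel
    rw [e]
    refine (eLpNorm_sub_le ((memLp_radVec hN1 (hFm n)).sub hv).1
      ((memLp_radVec hN1 (hFm k)).sub hv).1 one_le_two).trans_lt ?_
    exact (ENNReal.add_lt_add (hn₀ n hn) (hn₀ k hk)).trans_eq (ENNReal.add_halves ε)
  obtain ⟨f, hf⟩ := cauchySeq_tendsto_of_complete hcau
  set ψ : ℝ → ℝ := ⇑f with hψdef
  have hψm : MemLp ψ 2 (rMeas N) := Lp.memLp f
  have hψ1 : Tendsto (fun n => eLpNorm (deriv (F n) - ψ) 2 (rMeas N)) atTop (𝓝 0) := by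
    have h1 := (tendsto_iff_edist_tendsto_0.1 hf)
    refine h1.congr fun n => ?_
    rw [Lp.edist_def]
    exact eLpNorm_congr_ae ((hFm n).coeFn_toLp.sub EventuallyEq.rfl)
  refine ⟨ψ, hψm, ?_, ?_⟩
  · have hms : ∀ n, AEStronglyMeasurable (φ n) volume := fun n =>
      (hφ n).smooth.continuous.aestronglyMeasurable
    have hp0 : sobolevExp N ≠ 0 := by
      have hN' : (3 : ℝ) ≤ N := by exact_mod_cast hN
      rw [sobolevExp, Ne, ENNReal.ofReal_eq_zero, not_le]
      exact div_pos (by linarith) (by linarith)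
    obtain ⟨ns, hns, hae⟩ := (tendstoInMeasure_of_tendsto_eLpNorm hp0 hms hu.1
      hφu).exists_seq_tendsto_ae
    filter_upwards [hae, ae_comp_norm (rMeas_ae_pos hN1)] with x hx hx0
    have h1 := (tendsto_tailInt_of_eLpNorm hN hFm hψm hψ1 hx0).comp hns.tendsto_atTop
    refine tendsto_nhds_unique hx (h1.congr fun n => ?_)
    rw [Function.comp, hFt _ _ hx0, hFx]
  · have h1 : Tendsto (fun n => eLpNorm (radVec (deriv (F n)) - radVec ψ :
        EuclideanSpace ℝ (Fin N) → _) 2 volume) atTop (𝓝 0) := hψ1.congr fun n => by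
      rw [← radVec_sub, eLpNorm_radVec hN1 ((hFm n).sub hψm).1]
    have hms : ∀ n, AEStronglyMeasurable (radVec (deriv (F n)) : EuclideanSpace ℝ (Fin N) → _)
      volume := fun n => aestronglyMeasurable_radVec (hFm n).1
    exact tendstoInMeasure_ae_unique
      (tendstoInMeasure_of_tendsto_eLpNorm two_ne_zero hms hv.1 hv1)
      (tendstoInMeasure_of_tendsto_eLpNorm two_ne_zero hms (memLp_radVec hN1 hψm).1 h1)

/-! ### The Sobolev inequality for radial functions -/

/-- The bound for the critical power integral. -/
def sobolevBound (N : ℕ) (d : ℝ) : ℝ :=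
  (decayConst N * d) ^ (4 / ((N : ℝ) - 2)) * (hardyConst N * d ^ 2)

/-- The critical exponent is `2 + 4 / (N - 2)`, and the decay raised to `4 / (N - 2)` is exactly
`r^{-2}`; so Hardy's inequality implies the radial Sobolev inequality. -/
theorem lintegral_tailInt_le (hN : 3 ≤ N) {ψ : ℝ → ℝ} (hψ : MemLp ψ 2 (rMeas N)) :
    ∫⁻ r, ‖tailInt ψ r‖ₑ ^ (2 * N / (N - 2) : ℝ) ∂(rMeas N)
      ≤ ENNReal.ofReal (sobolevBound N (dnorm N ψ)) := by
  have hN' : (3 : ℝ) ≤ N := by exact_mod_cast hN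
  have hc := decayConst_nonneg N
  have hd := dnorm_nonneg N ψ
  set A := (decayConst N * dnorm N ψ) ^ (4 / ((N : ℝ) - 2)) with hA
  have hA0 : 0 ≤ A := by positivity
  have h1 : ∫⁻ r, ‖tailInt ψ r‖ₑ ^ (2 * N / (N - 2) : ℝ) ∂(rMeas N)
      ≤ ∫⁻ r, ENNReal.ofReal A * ENNReal.ofReal (tailInt ψ r ^ 2 / r ^ 2) ∂(rMeas N) := by
    refine lintegral_mono_ae ?_
    filter_upwards [rMeas_ae_pos (by omega)] with r hr
    rw [← ofReal_norm, ENNReal.ofReal_rpow_of_nonneg (norm_nonneg _)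
      (div_nonneg (by linarith) (by linarith)), ← ENNReal.ofReal_mul hA0]
    refine ENNReal.ofReal_le_ofReal ?_
    have hp : (2 * N / (N - 2) : ℝ) = 4 / ((N : ℝ) - 2) + 2 := by
      have : (N : ℝ) - 2 ≠ 0 := by linarith
      field_simp; ring
    have hq : 0 < 4 / ((N : ℝ) - 2) := div_pos (by norm_num) (by linarith)
    rw [hp, Real.rpow_add' (norm_nonneg _) (by linarith), Real.norm_eq_abs, Real.rpow_two, sq_abs]
    have h2 := Real.rpow_le_rpow (abs_nonneg _) (abs_tailInt_le hN hψ hr) hq.le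
    have hD := decay_pos N hr
    rw [Real.mul_rpow (by positivity) hD.le] at h2
    have h3 : decay N r ^ (4 / ((N : ℝ) - 2)) = (r ^ 2)⁻¹ := by
      rw [decay, ← Real.rpow_mul hr.le]
      have : -((N : ℝ) - 2) / 2 * (4 / (N - 2)) = -2 := by
        have : (N : ℝ) - 2 ≠ 0 := by linarith
        field_simp; norm_num
      rw [this, Real.rpow_neg hr.le, Real.rpow_two]
    rw [h3] at h2
    calc _ ≤ A * (r ^ 2)⁻¹ * tailInt ψ r ^ 2 := by gcongr
      _ = _ := by ring
  refine h1.trans ?_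
  rw [lintegral_const_mul' _ _ ENNReal.ofReal_ne_top, sobolevBound, ENNReal.ofReal_mul hA0]
  exact mul_le_mul_right (hardy_lintegral_rMeas hN hψ) _

theorem eLpNorm_tailInt_le (hN : 3 ≤ N) {ψ : ℝ → ℝ} (hψ : MemLp ψ 2 (rMeas N)) :
    eLpNorm (fun x : EuclideanSpace ℝ (Fin N) => tailInt ψ ‖x‖) (sobolevExp N) volume
      ≤ ENNReal.ofReal (sobolevBound N (dnorm N ψ)) ^ (1 / (2 * N / (N - 2) : ℝ)) := by
  have hN' : (3 : ℝ) ≤ N := by exact_mod_cast hN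
  have hp : 0 < (2 * N / (N - 2) : ℝ) := div_pos (by linarith) (by linarith)
  rw [eLpNorm_comp_norm (aestronglyMeasurable_tailInt hN hψ), sobolevExp,
    eLpNorm_eq_lintegral_rpow_enorm_toReal (by simpa using hp) ENNReal.ofReal_ne_top,
    ENNReal.toReal_ofReal hp.le]
  exact ENNReal.rpow_le_rpow (lintegral_tailInt_le hN hψ) (by positivity)

theorem memLp_tailInt (hN : 3 ≤ N) {ψ : ℝ → ℝ} (hψ : MemLp ψ 2 (rMeas N)) :
    MemLp (fun x : EuclideanSpace ℝ (Fin N) => tailInt ψ ‖x‖) (sobolevExp N) volume := by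
  refine ⟨(aestronglyMeasurable_tailInt hN hψ).comp_measurable (measurable_norm_euclidean N),
    (eLpNorm_tailInt_le hN hψ).trans_lt ?_⟩
  have hN' : (3 : ℝ) ≤ N := by exact_mod_cast hN
  have hp : 0 < (2 * N / (N - 2) : ℝ) := div_pos (by linarith) (by linarith)
  exact ENNReal.rpow_lt_top_of_nonneg (by positivity) ENNReal.ofReal_ne_top

/-! ### Density of test functions -/

/-- Square integrable classes represented by smooth functions with compact support
in `(0, ∞)`. -/
def testSubmodule (N : ℕ) : Submodule ℝ (Lp ℝ 2 (rMeas N)) where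
  carrier := {f | ∃ ξ : ℝ → ℝ, ContDiff ℝ ∞ ξ ∧ HasCompactSupport ξ ∧ tsupport ξ ⊆ Ioi 0 ∧
    f =ᵐ[rMeas N] ξ}
  zero_mem' := ⟨0, contDiff_const, HasCompactSupport.zero, by simp, Lp.coeFn_zero _ _ _⟩
  add_mem' := by
    rintro f f' ⟨ξ, h1, h2, h3, h4⟩ ⟨ξ', h1', h2', h3', h4'⟩
    exact ⟨ξ + ξ', h1.add h1', h2.add h2', (tsupport_add ξ ξ').trans (union_subset h3 h3'),
      (Lp.coeFn_add f f').trans (h4.add h4')⟩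
  smul_mem' := by
    rintro c f ⟨ξ, h1, h2, h3, h4⟩
    exact ⟨c • ξ, h1.const_smul c, HasCompactSupport.smul_left (f := fun _ : ℝ => c) h2,
      (tsupport_smul_subset_right (fun _ : ℝ => c) ξ).trans h3,
      (Lp.coeFn_smul c f).trans (h4.const_smul c)⟩

/-- The orthogonal complement is zero by the fundamental lemma of the calculus of variations,
applied to `r^{N-1} f`. -/
theorem testSubmodule_dense (hN : 3 ≤ N) : (testSubmodule N).topologicalClosure = ⊤ := by
  have hN1 : 1 ≤ N := by omega
  rw [Submodule.topologicalClosure_eq_top_iff, Submodule.eq_bot_iff]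
  intro f hf
  rw [Submodule.mem_orthogonal] at hf
  have hfm : MemLp f 2 (rMeas N) := Lp.memLp f
  have hfloc : LocallyIntegrableOn f (Ioi 0) := fun x hx =>
    ⟨Ioi (x / 2), mem_nhdsWithin_of_mem_nhds (Ioi_mem_nhds (half_lt_self hx)),
      integrableOn_Ioi hN hfm (half_pos hx)⟩
  have hloc : LocallyIntegrableOn (fun r => r ^ (N - 1) * f r) (Ioi 0) :=
    hfloc.continuousOn_mul (continuousOn_pow _) isOpen_Ioi.isLocallyClosed
  have hae := isOpen_Ioi.ae_eq_zero_of_integral_contDiff_smul_eq_zero hloc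
    fun ξ hξ hξc hξs => by
      obtain ⟨R, hR, hξ0, hξm⟩ := exists_bound_test hN1 hξ.continuous hξc hξs
      have h1 := hf (hξm.toLp ξ) ⟨ξ, hξ, hξc, hξs, hξm.coeFn_toLp⟩
      rw [L2.inner_def] at h1
      have h2 : ∫ r, ξ r * f r ∂(rMeas N) = 0 := by
        rw [← h1]
        refine integral_congr_ae ?_
        filter_upwards [hξm.coeFn_toLp] with r hr
        rw [hr]; simp [mul_comm]
      rw [rMeas_integral hN1] at h2
      have h3 := (mul_eq_zero.1 h2).resolve_left (sphereArea_pos hN1).ne'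
      rw [← setIntegral_eq_integral_of_forall_compl_eq_zero (s := Ioi 0)]
      · refine Eq.trans (integral_congr_ae (Eventually.of_forall fun r => ?_)) h3
        simp only [smul_eq_mul]; ring
      · intro x hx
        have : ξ x = 0 := by
          by_contra h3
          exact hx (hξs (subset_tsupport ξ h3))
        rw [this, zero_smul]
  rw [Lp.eq_zero_iff_ae_eq_zero, EventuallyEq, rMeas_ae_iff hN1,
    ae_restrict_iff' measurableSet_Ioi]
  filter_upwards [hae] with r hr hr0
  exact (mul_eq_zero.1 (hr hr0)).resolve_left (pow_pos hr0 _).ne'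

theorem exists_test_seq (hN : 3 ≤ N) {ψ : ℝ → ℝ} (hψ : MemLp ψ 2 (rMeas N)) :
    ∃ ξ : ℕ → ℝ → ℝ, (∀ n, ContDiff ℝ ∞ (ξ n) ∧ HasCompactSupport (ξ n) ∧ tsupport (ξ n) ⊆ Ioi 0) ∧
      Tendsto (fun n => eLpNorm (ξ n - ψ) 2 (rMeas N)) atTop (𝓝 0) := by
  have h1 : hψ.toLp ψ ∈ (testSubmodule N).topologicalClosure := by
    rw [testSubmodule_dense hN]; trivial
  obtain ⟨f, hf, hlim⟩ := mem_closure_iff_seq_limit.1 h1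
  choose ξ hξ1 hξ2 hξ3 hξ4 using hf
  refine ⟨ξ, fun n => ⟨hξ1 n, hξ2 n, hξ3 n⟩, ?_⟩
  refine (tendsto_iff_edist_tendsto_0.1 hlim).congr fun n => ?_
  rw [Lp.edist_def]
  exact eLpNorm_congr_ae ((hξ4 n).sub hψ.coeFn_toLp)

/-- The norm is not smooth at the origin, but there the primitive is constant, because `ξ` vanishes
near `0`. -/
theorem isRadialTest_tailInt {ξ : ℝ → ℝ} (hξ : ContDiff ℝ ∞ ξ) (hξc : HasCompactSupport ξ)
    (hξs : tsupport ξ ⊆ Ioi 0) :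
    IsRadialTest fun x : EuclideanSpace ℝ (Fin N) => tailInt ξ ‖x‖ := by
  have hξi : Integrable ξ := hξ.continuous.integrable_of_hasCompactSupport hξc
  have hd := hasDerivAt_tailInt_of_continuous hξ.continuous hξi
  have hsm : ContDiff ℝ ∞ (tailInt ξ) := by
    rw [contDiff_infty_iff_deriv]
    refine ⟨fun r => (hd r).differentiableAt, ?_⟩
    rwa [show deriv (tailInt ξ) = ξ from funext fun r => (hd r).deriv]
  obtain ⟨R, hR, hξ0, -⟩ := exists_bound_test le_rfl hξ.continuous hξc hξs
  refine ⟨contDiff_iff_contDiffAt.2 fun x => ?_, ?_, fun x y h => by simp only [h]⟩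
  · rcases eq_or_ne x 0 with rfl | hx
    · have h0 : (0 : ℝ) ∉ tsupport ξ := fun h => lt_irrefl (0 : ℝ) (mem_Ioi.1 (hξs h))
      have h1 : ∀ᶠ r in 𝓝 (0 : ℝ), ξ r = 0 := by
        filter_upwards [(isClosed_tsupport ξ).isOpen_compl.mem_nhds h0] with r hr
        exact image_eq_zero_of_notMem_tsupport hr
      obtain ⟨δ, hδ, hδ'⟩ := Metric.eventually_nhds_iff_ball.1 h1
      have h2 : ∀ᶠ x : EuclideanSpace ℝ (Fin N) in 𝓝 0, tailInt ξ ‖x‖ = tailInt ξ 0 := by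
        filter_upwards [Metric.ball_mem_nhds 0 hδ] with x hx
        rw [mem_ball_zero_iff] at hx
        refine (convex_ball (0 : ℝ) δ).is_const_of_fderivWithin_eq_zero (𝕜 := ℝ) (f := tailInt ξ)
          (fun r _ => (hd r).differentiableAt.differentiableWithinAt) (fun r hr => ?_)
          (by simpa using hx) (by simpa using hδ)
        rw [fderivWithin_of_isOpen Metric.isOpen_ball hr]
        ext
        simp [(hd r).deriv, hδ' r hr]
      exact contDiffAt_const.congr_of_eventuallyEq h2
    · exact hsm.contDiffAt.comp x (contDiffAt_norm ℝ hx)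
  · refine HasCompactSupport.of_support_subset_isCompact (isCompact_closedBall 0 R) fun x hx => ?_
    rw [mem_closedBall_zero_iff]
    by_contra h
    exact hx (tailInt_eq_zero hξ0 (not_le.1 h).le)

/-- Approximating `ψ` by test functions in `L²` is enough: the Sobolev bound carries the
approximation over to the primitives. -/
theorem hasRadialGrad_tailInt (hN : 3 ≤ N) {ψ : ℝ → ℝ} (hψ : MemLp ψ 2 (rMeas N))
    {u : EuclideanSpace ℝ (Fin N) → ℝ} (hu : u =ᵐ[volume] fun x => tailInt ψ ‖x‖) :
    HasRadialGrad u (radVec ψ) := by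
  have hN1 : 1 ≤ N := by omega
  have hN' : (3 : ℝ) ≤ N := by exact_mod_cast hN
  obtain ⟨ξ, hξ, hlim⟩ := exists_test_seq hN hψ
  have hξm : ∀ n, MemLp (ξ n) 2 (rMeas N) := fun n => by
    obtain ⟨R, -, -, h⟩ := exists_bound_test hN1 (hξ n).1.continuous (hξ n).2.1 (hξ n).2.2
    exact h
  refine ⟨(memLp_tailInt hN hψ).ae_eq hu.symm, memLp_radVec hN1 hψ,
    fun n x => tailInt (ξ n) ‖x‖, fun n => isRadialTest_tailInt (hξ n).1 (hξ n).2.1 (hξ n).2.2,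
    ?_, ?_⟩
  · have h1 : ∀ n, eLpNorm ((fun x => tailInt (ξ n) ‖x‖) - u) (sobolevExp N) volume
        ≤ ENNReal.ofReal (sobolevBound N (dnorm N (ξ n - ψ))) ^ (1 / (2 * N / (N - 2) : ℝ)) :=
      fun n => by
        refine le_trans (le_of_eq (eLpNorm_congr_ae ?_)) (eLpNorm_tailInt_le hN ((hξm n).sub hψ))
        filter_upwards [hu, ae_comp_norm (rMeas_ae_pos hN1)] with x hx hx0
        rw [Pi.sub_apply, hx, tailInt_sub_fun hN (hξm n) hψ hx0]
    have hq : 0 < 4 / ((N : ℝ) - 2) := div_pos (by norm_num) (by linarith)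
    have hp : 0 < 1 / (2 * N / (N - 2) : ℝ) :=
      one_div_pos.2 (div_pos (by linarith) (by linarith))
    have h2 : Tendsto (fun d => sobolevBound N d) (𝓝 0) (𝓝 0) := by
      have h3 : ContinuousAt (sobolevBound N) 0 := by
        unfold sobolevBound
        refine ContinuousAt.mul (ContinuousAt.rpow_const (by fun_prop) (Or.inr hq.le)) (by fun_prop)
      have h4 : sobolevBound N 0 = 0 := by simp [sobolevBound]
      have := h3.tendsto
      rwa [h4] at this
    have h3 := h2.comp (tendsto_dnorm_sub hξm hψ hlim)
    have h4 := (ENNReal.continuous_rpow_const (y := 1 / (2 * N / (N - 2) : ℝ))).tendsto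
      (ENNReal.ofReal 0) |>.comp ((ENNReal.continuous_ofReal.tendsto 0).comp h3)
    rw [ENNReal.ofReal_zero, ENNReal.zero_rpow_of_pos hp] at h4
    exact tendsto_of_tendsto_of_tendsto_of_le_of_le tendsto_const_nhds h4 (fun _ => bot_le) h1
  · refine hlim.congr fun n => ?_
    rw [← eLpNorm_radVec hN1 ((hξm n).sub hψ).1, radVec_sub]
    refine eLpNorm_congr_ae ?_
    filter_upwards [ae_ne_zero_euclidean hN1] with x hx
    have h1 := HasGradientAt_comp_norm hx (hasDerivAt_tailInt_of_continuous (hξ n).1.continuous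
      ((hξ n).1.continuous.integrable_of_hasCompactSupport (hξ n).2.1) ‖x‖)
    rw [Pi.sub_apply, Pi.sub_apply, h1.gradient]; rfl

/-- The bridge between the space of functions on `ℝ^N` and the analysis on the half line. -/
theorem mem_D12r_iff (hN : 3 ≤ N) {u : EuclideanSpace ℝ (Fin N) → ℝ} :
    u ∈ D12r N ↔ ∃ ψ, MemLp ψ 2 (rMeas N) ∧ u =ᵐ[volume] fun x => tailInt ψ ‖x‖ := by
  refine ⟨fun ⟨v, hv⟩ => ?_, fun ⟨ψ, hψ, hu⟩ => ⟨_, hasRadialGrad_tailInt hN hψ hu⟩⟩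
  obtain ⟨ψ, h1, h2, -⟩ := hv.exists_tailInt hN
  exact ⟨ψ, h1, h2⟩

theorem ae_eq_of_comp_norm (hN : 3 ≤ N) {F G : ℝ → ℝ} (hF : ContinuousOn F (Ioi 0))
    (hG : ContinuousOn G (Ioi 0))
    (h : (fun x : EuclideanSpace ℝ (Fin N) => F ‖x‖) =ᵐ[volume] fun x => G ‖x‖) {r : ℝ}
    (hr : 0 < r) : F r = G r := by
  have hN1 : 1 ≤ N := by omega
  refine eq_of_ae_eq_of_continuousOn hN1 hF hG ?_ hr
  -- The `L¹` norm serves only to carry the null set from `ℝ^N` to the half line.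
  have h1 := eLpNorm_comp_norm (N := N) (p := 1) ((rMeas_aestronglyMeasurable hN1 hF).sub
    (rMeas_aestronglyMeasurable hN1 hG))
  have h2 : eLpNorm (fun x : EuclideanSpace ℝ (Fin N) => (F - G) ‖x‖) 1 volume = 0 := by
    rw [eLpNorm_congr_ae (g := 0), eLpNorm_zero]
    filter_upwards [h] with x hx
    simp [hx]
  rw [h2] at h1
  have h3 := (eLpNorm_eq_zero_iff ((rMeas_aestronglyMeasurable hN1 hF).sub
    (rMeas_aestronglyMeasurable hN1 hG)) one_ne_zero).1 h1.symm
  filter_upwards [h3] with s hs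
  exact sub_eq_zero.1 hs

/-- The gradient picked by choice is the radial field of some derivative whose primitive agrees with
that of `ψ`, and primitives determine derivatives. -/
theorem wgrad_ae (hN : 3 ≤ N) {ψ : ℝ → ℝ} (hψ : MemLp ψ 2 (rMeas N))
    {u : EuclideanSpace ℝ (Fin N) → ℝ} (hu : u =ᵐ[volume] fun x => tailInt ψ ‖x‖) :
    wgrad u =ᵐ[volume] radVec ψ := by
  have h : ∃ v, HasRadialGrad u v := ⟨_, hasRadialGrad_tailInt hN hψ hu⟩
  rw [wgrad, dif_pos h]
  obtain ⟨φ, h1, h2, h3⟩ := h.choose_spec.exists_tailInt hN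
  refine h3.trans (radVec_congr ?_)
  refine ae_eq_of_tailInt_eq hN h1 hψ fun r hr => ?_
  exact ae_eq_of_comp_norm hN (continuousOn_tailInt hN h1) (continuousOn_tailInt hN hψ)
    (h2.symm.trans hu) hr

theorem integral_wgrad_sq (hN : 3 ≤ N) {ψ : ℝ → ℝ} (hψ : MemLp ψ 2 (rMeas N))
    {u : EuclideanSpace ℝ (Fin N) → ℝ} (hu : u =ᵐ[volume] fun x => tailInt ψ ‖x‖) :
    ∫ x, ‖wgrad u x‖ ^ 2 = dnorm N ψ ^ 2 := by
  have hN1 : 1 ≤ N := by omega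
  rw [dnorm_sq, ← integral_comp_norm (F := fun r => ψ r ^ 2) (hψ.1.pow 2)]
  refine integral_congr_ae ?_
  filter_upwards [wgrad_ae hN hψ hu, ae_ne_zero_euclidean hN1] with x hx hx0
  rw [hx, norm_radVec ψ hx0, sq_abs]

theorem norm12_eq (hN : 3 ≤ N) {ψ : ℝ → ℝ} (hψ : MemLp ψ 2 (rMeas N))
    {u : EuclideanSpace ℝ (Fin N) → ℝ} (hu : u =ᵐ[volume] fun x => tailInt ψ ‖x‖) :
    norm12 u = dnorm N ψ := by
  rw [norm12, integral_wgrad_sq hN hψ hu, Real.sqrt_sq (dnorm_nonneg _ _)]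

end Radial

/-! ## The space `E` and its critical points -/

section SpaceE

variable {N : ℕ} [hN : Fact (3 ≤ N)] {V K g : ℝ → ℝ} {a b σ C R : ℝ} {m : ℝ → ℝ} {q₁ q₂ : ℝ}

theorem integrable_V_dual_comp_norm_iff (hH : HypH V K) {ψ : ℝ → ℝ} (hψ : MemLp ψ 2 (rMeas N))
    {u : EuclideanSpace ℝ (Fin N) → ℝ} (hu : u =ᵐ[volume] fun x => tailInt ψ ‖x‖) :
    Integrable (fun x => V ‖x‖ * dualChange (u x) ^ 2) volume
      ↔ Integrable (fun r => V r * dualChange (tailInt ψ r) ^ 2) (rMeas N) := by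
  rw [← integrable_comp_norm_iff (F := fun r => V r * dualChange (tailInt ψ r) ^ 2)]
  · refine integrable_congr ?_
    filter_upwards [hu] with x hx
    rw [hx]
  · exact rMeas_aestronglyMeasurable (one_le_dim N) (hH.V_cont.mul
      ((continuous_dualChange.comp_continuousOn (continuousOn_tailInt (three_le N) hψ)).pow 2))

/-- The nontrivial inclusion of `E` in the Hilbert space: `V u²` is dominated by a Hardy term and a
multiple of `V f(u)²`, both integrable. -/
theorem exists_rad_of_mem_spaceE (hH : HypH V K) {u : EuclideanSpace ℝ (Fin N) → ℝ}
    (hu : u ∈ spaceE N V) : ∃ p : RadSpace N V, u =ᵐ[volume] fun x => val p ‖x‖ := by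
  obtain ⟨ψ, hψ, huψ⟩ := (mem_D12r_iff (three_le N)).1 hu.1
  have hi := (integrable_V_dual_comp_norm_iff hH hψ huψ).1 hu.2
  obtain ⟨CV, hCV, hV⟩ := exists_V_sq_le (N := N) hH
  have hc : ContinuousOn (fun r => √(V r) * tailInt ψ r) (Ioi 0) :=
    (Real.continuous_sqrt.comp_continuousOn hH.V_cont).mul (continuousOn_tailInt (three_le N) hψ)
  have hv : MemLp (fun r => √(V r) * tailInt ψ r) 2 (rMeas N) := by
    rw [memLp_two_iff_integrable_sq (rMeas_aestronglyMeasurable (one_le_dim N) hc)]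
    refine integrable_of_abs_le (hc.pow 2)
      (((integrable_hardy (three_le N) hψ).const_mul CV).add (hi.const_mul
        (1 + 2 * (decayConst N * dnorm N ψ) ^ 2))) fun r hr => ?_
    have := hV ψ hψ 1 one_pos (decayConst N * dnorm N ψ) (by rw [mul_one]) r hr
    rw [one_pow, one_mul, div_one] at this
    rwa [abs_of_nonneg (by positivity), mul_pow, Real.sq_sqrt (hH.V_nonneg r hr)]
  refine ⟨mkRad ψ hψ hv, ?_⟩
  filter_upwards [huψ, ae_comp_norm (rMeas_ae_pos (one_le_dim N))] with x hx hx0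
  rw [hx, val_mkRad hψ hv hx0]

theorem mem_spaceE (hH : HypH V K) (p : RadSpace N V) {u : EuclideanSpace ℝ (Fin N) → ℝ}
    (hu : u =ᵐ[volume] fun x => val p ‖x‖) : u ∈ spaceE N V :=
  ⟨(mem_D12r_iff (three_le N)).2 ⟨der p, memLp_der p, hu⟩,
    (integrable_V_dual_comp_norm_iff hH (memLp_der p) hu).2 (integrable_V_dual_sq hH p)⟩

theorem integrable_K_primG_comp (hH : HypH V K) (gb : GrowthBound N V K g a b σ C R m)
    (hg : HypG g q₁ q₂) (p : RadSpace N V) {u : EuclideanSpace ℝ (Fin N) → ℝ}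
    (hu : u =ᵐ[volume] fun x => val p ‖x‖) :
    Integrable (fun x => K ‖x‖ * primG g (dualChange (u x))) volume := by
  have h1 := integrable_K_primG hH gb hg p
  refine ((integrable_comp_norm_iff h1.1).2 h1).congr ?_
  filter_upwards [hu] with x hx
  rw [hx]

theorem functionalI_eq (hH : HypH V K) (gb : GrowthBound N V K g a b σ C R m)
    (hg : HypG g q₁ q₂) (p : RadSpace N V) {u : EuclideanSpace ℝ (Fin N) → ℝ}
    (hu : u =ᵐ[volume] fun x => val p ‖x‖) : functionalI V K g u = radI K g p := by
  have e1 : ∫ x, V ‖x‖ * dualChange (u x) ^ 2 = ∫ r, V r * dualChange (val p r) ^ 2 ∂(rMeas N) := by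
    rw [← integral_comp_norm (integrable_V_dual_sq hH p).1]
    refine integral_congr_ae ?_
    filter_upwards [hu] with x hx
    rw [hx]
  have e2 : ∫ x, K ‖x‖ * primG g (dualChange (u x))
      = ∫ r, K r * primG g (dualChange (val p r)) ∂(rMeas N) := by
    rw [← integral_comp_norm (integrable_K_primG hH gb hg p).1]
    refine integral_congr_ae ?_
    filter_upwards [hu] with x hx
    rw [hx]
  rw [functionalI, radI_eq hH, energyA, integral_wgrad_sq (three_le N) (memLp_der p) hu, e1, e2]
  ring

/-- Convexity of `f²`, which vanishes at `0`. -/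
theorem dualChange_sq_mul_le {t k : ℝ} (ht : 0 ≤ t) (hk : 0 < k) (htk : t ≤ k) (y : ℝ) :
    dualChange (t * y) ^ 2 ≤ t / k * dualChange (k * y) ^ 2 := by
  have hconv : ConvexOn ℝ univ fun t => 1 / 2 * dualChange t ^ 2 := by
    refine MonotoneOn.convexOn_of_deriv convex_univ
      (fun t _ => (hasDerivAt_dualChange_sq t).continuousAt.continuousWithinAt)
      (fun t _ => (hasDerivAt_dualChange_sq t).differentiableAt.differentiableWithinAt) ?_
    rw [show deriv (fun t => 1 / 2 * dualChange t ^ 2) = aFun from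
      funext fun t => (hasDerivAt_dualChange_sq t).deriv]
    exact (monotone_of_hasDerivAt_nonneg hasDerivAt_aFun fun t => by
      simp only [Pi.zero_apply]; positivity).monotoneOn _
  have h := hconv.2 (mem_univ (k * y)) (mem_univ 0) (show 0 ≤ t / k by positivity)
    (show 0 ≤ 1 - t / k by rw [sub_nonneg, div_le_one hk]; exact htk) (by ring)
  have e : (t / k) • (k * y) + (1 - t / k) • (0 : ℝ) = t * y := by
    simp only [smul_eq_mul]; field_simp; ring
  rw [e] at h
  simp only [dualChange_zero, smul_eq_mul] at h
  linarith

theorem normO_nonneg (hH : HypH V K) (u : EuclideanSpace ℝ (Fin N) → ℝ) : 0 ≤ normO V u := by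
  refine Real.iInf_nonneg fun k => ?_
  have hk : 0 < (k : ℝ) := k.2
  have : 0 ≤ ∫ x, V ‖x‖ * dualChange ((k : ℝ) * u x) ^ 2 := by
    refine integral_nonneg_of_ae ?_
    filter_upwards [ae_comp_norm (rMeas_ae_pos (one_le_dim N))] with x hx
    exact mul_nonneg (hH.V_nonneg _ hx) (sq_nonneg _)
  positivity

theorem integrable_V_dual_mul_sq (hH : HypH V K) (p : RadSpace N V) (k : ℝ) :
    Integrable (fun r => V r * dualChange (k * val p r) ^ 2) (rMeas N) := by
  refine integrable_of_abs_le (hH.V_cont.mul (continuousOn_comp_val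
    (φ := fun t => dualChange (k * t) ^ 2)
    ((continuous_dualChange.comp (continuous_const_mul k)).pow 2) p))
    ((integrable_V_sq hH p).const_mul (k ^ 2)) fun r hr => ?_
  have := hH.V_nonneg r hr
  rw [abs_of_nonneg (by positivity)]
  have h2 := mul_le_mul_of_nonneg_left (dualChange_sq_le_sq (k * val p r)) this
  rw [mul_pow] at h2
  linarith

/-- The norm of `E` dominates the Hilbert norm. -/
theorem exists_norm_le_normE (hH : HypH V K) : ∃ C > 0, ∀ (p : RadSpace N V)
    (h : EuclideanSpace ℝ (Fin N) → ℝ), (h =ᵐ[volume] fun x => val p ‖x‖) →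
      ‖p‖ ≤ C * normE V h := by
  obtain ⟨CV, hCV, hV⟩ := exists_V_sq_le (N := N) hH
  have hh := hardyConst_nonneg N
  have hc := decayConst_nonneg N
  set C := 2 + CV * hardyConst N + 2 * decayConst N ^ 2 with hC
  have hC1 : 1 ≤ C := by
    have : 0 ≤ CV * hardyConst N + 2 * decayConst N ^ 2 := by positivity
    rw [hC]; linarith
  have hC0 : 0 < C := by linarith
  refine ⟨C, hC0, fun p h hp => ?_⟩
  rw [← div_le_iff₀' hC0]
  -- Working at every scale `s` above the norm makes `s` positive and avoids the question whether
  -- the infimum is attained.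
  refine le_of_forall_gt_imp_ge_of_dense fun s hs => ?_
  rw [div_le_iff₀' hC0]
  set d := dnorm N (der p) with hd
  have hd0 : 0 ≤ d := dnorm_nonneg _ _
  have h12 : norm12 h = d := norm12_eq (three_le N) (memLp_der p) hp
  have hO := normO_nonneg hH h
  rw [normE, h12] at hs
  have hds : d ≤ s := by linarith
  have hs0 : 0 < s := by linarith
  obtain ⟨⟨k, hk⟩, hks⟩ := exists_lt_of_ciInf_lt (show normO V h < s by linarith)
  simp only at hks
  have hk0 : 0 < k := hk
  have e1 : ∫ x, V ‖x‖ * dualChange (k * h x) ^ 2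
      = ∫ r, V r * dualChange (k * val p r) ^ 2 ∂(rMeas N) := by
    rw [← integral_comp_norm (integrable_V_dual_mul_sq hH p k).1]
    refine integral_congr_ae ?_
    filter_upwards [hp] with x hx
    rw [hx]
  rw [e1] at hks
  set J := ∫ r, V r * dualChange (k * val p r) ^ 2 ∂(rMeas N) with hJ
  have hJ0 : 0 ≤ J := by
    refine integral_nonneg_of_ae ?_
    filter_upwards [rMeas_ae_pos (one_le_dim N)] with r hr
    exact mul_nonneg (hH.V_nonneg r hr) (sq_nonneg _)
  rw [one_div, inv_mul_lt_iff₀ hk0] at hks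
  have htk : 1 / s ≤ k := by
    rw [div_le_iff₀ hs0]; linarith
  -- From `(1 + J) / k < s` one has `1 / s ≤ k` and `J ≤ k s`, so convexity bounds the modular of `h
  -- / s` by `J / (k s) ≤ 1`: the Amemiya norm dominates the Luxemburg norm.
  have hJs : ∫ r, V r * dualChange (1 / s * val p r) ^ 2 ∂(rMeas N) ≤ 1 := by
    calc _ ≤ ∫ r, 1 / s / k * (V r * dualChange (k * val p r) ^ 2) ∂(rMeas N) := by
          refine integral_mono_ae (integrable_V_dual_mul_sq hH p _)
            ((integrable_V_dual_mul_sq hH p k).const_mul _) ?_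
          filter_upwards [rMeas_ae_pos (one_le_dim N)] with r hr
          have := mul_le_mul_of_nonneg_left (dualChange_sq_mul_le (by positivity) hk0 htk
            (val p r)) (hH.V_nonneg r hr)
          linarith
      _ = 1 / s / k * J := by rw [integral_const_mul]
      _ ≤ 1 / s / k * (k * s) := by gcongr; linarith
      _ = 1 := by field_simp
  have key : ∫ r, V r * val p r ^ 2 ∂(rMeas N)
      ≤ ∫ r, (CV * (tailInt (der p) r ^ 2 / r ^ 2) + s ^ 2 * (1 + 2 * decayConst N ^ 2)
        * (V r * dualChange (1 / s * val p r) ^ 2)) ∂(rMeas N) := by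
    refine integral_mono_ae (integrable_V_sq hH p)
      (((integrable_hardy (three_le N) (memLp_der p)).const_mul _).add
        ((integrable_V_dual_mul_sq hH p _).const_mul _)) ?_
    filter_upwards [rMeas_ae_pos (one_le_dim N)] with r hr
    have := hV (der p) (memLp_der p) s hs0 (decayConst N) (by gcongr) r hr
    rwa [show tailInt (der p) r / s = 1 / s * val p r by rw [val]; ring] at this
  rw [integral_add ((integrable_hardy (three_le N) (memLp_der p)).const_mul _)
    ((integrable_V_dual_mul_sq hH p _).const_mul _), integral_const_mul, integral_const_mul] at key
  have h7 : CV * ∫ r, tailInt (der p) r ^ 2 / r ^ 2 ∂(rMeas N) ≤ CV * (hardyConst N * d ^ 2) :=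
    mul_le_mul_of_nonneg_left (hardy (three_le N) (memLp_der p)) hCV.le
  have h8 : d ^ 2 ≤ s ^ 2 := by gcongr
  have h9 : CV * (hardyConst N * d ^ 2) ≤ CV * (hardyConst N * s ^ 2) := by gcongr
  have h10 : s ^ 2 * (1 + 2 * decayConst N ^ 2)
      * ∫ r, V r * dualChange (1 / s * val p r) ^ 2 ∂(rMeas N)
      ≤ s ^ 2 * (1 + 2 * decayConst N ^ 2) * 1 := by gcongr
  have h11 : ‖p‖ ^ 2 ≤ C * s ^ 2 := by
    rw [norm_sq_eq hH.V_nonneg, hC]; linarith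
  refine abs_le_of_sq_le_sq' (h11.trans ?_) (by positivity) |>.2
  rw [mul_pow]
  have : C ≤ C ^ 2 := by nlinarith
  gcongr

/-- The mean value theorem along the segment and continuity of the gradient give an increment
`o(‖q‖)` in the Hilbert norm, which is also `o` of the norm of `E` since the latter dominates. -/
theorem isCriticalPoint_of_radGrad_eq_zero (hH : HypH V K) (gb : GrowthBound N V K g a b σ C R m)
    (hg : HypG g q₁ q₂) {p : RadSpace N V} (hp : radGrad K g p = 0)
    {u : EuclideanSpace ℝ (Fin N) → ℝ} (hu : u =ᵐ[volume] fun x => val p ‖x‖) :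
    IsCriticalPoint V K g u := by
  refine ⟨mem_spaceE hH p hu, fun ε hε => ?_⟩
  obtain ⟨C₁, hC₁, hCn⟩ := exists_norm_le_normE (N := N) hH
  have hcont := (continuous_radGrad hH gb hg (N := N)).continuousAt (x := p)
  obtain ⟨δ, hδ, hδ'⟩ := (Metric.continuousAt_iff (β := StrongDual ℝ (RadSpace N V))).1 hcont (ε / C₁) (by positivity)
  refine ⟨δ / C₁, by positivity, fun h hh hhδ => ?_⟩
  obtain ⟨q, hq⟩ := exists_rad_of_mem_spaceE hH hh
  have hqn := hCn q h hq
  have hqδ : ‖q‖ < δ := hqn.trans_lt ((lt_div_iff₀' hC₁).1 hhδ)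
  have huh : u + h =ᵐ[volume] fun x => val (p + q) ‖x‖ := by
    filter_upwards [hu, hq, ae_comp_norm (rMeas_ae_pos (one_le_dim N))] with x h1 h2 h3
    rw [Pi.add_apply, h1, h2, val_add _ _ h3]
  rw [functionalI_eq hH gb hg _ huh, functionalI_eq hH gb hg _ hu]
  obtain ⟨θ, hθ, hmv⟩ := exists_mean_value (hasDerivAt_radI hH gb hg) p q
  rw [hmv]
  have h1 : dist (p + θ • q) p < δ := by
    rw [dist_eq_norm, add_sub_cancel_left, norm_smul, Real.norm_eq_abs, abs_of_pos hθ.1]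
    nlinarith [hθ.2, norm_nonneg q]
  have h2 : ‖radGrad K g (p + θ • q)‖ < ε / C₁ := by
    have := hδ' h1
    rw [hp] at this
    exact (dist_zero_right (radGrad K g (p + θ • q))).symm.trans_lt this
  have h3 := (radGrad K g (p + θ • q)).le_opNorm q
  rw [Real.norm_eq_abs] at h3
  calc _ ≤ _ := h3
    _ ≤ ε / C₁ * (C₁ * normE V h) := by gcongr
    _ = _ := by field_simp

end SpaceE

/-! ## The radial Laplacian -/

theorem contDiffOn_two_of_hasDerivAt {f f' f'' : ℝ → ℝ} {s : Set ℝ} (hs : IsOpen s)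
    (h1 : ∀ r ∈ s, HasDerivAt f (f' r) r) (h2 : ∀ r ∈ s, HasDerivAt f' (f'' r) r)
    (h3 : ContinuousOn f'' s) : ContDiffOn ℝ 2 f s := by
  have e1 : ContDiffOn ℝ 1 f' s := by
    rw [show (1 : WithTop ℕ∞) = 0 + 1 from rfl, contDiffOn_succ_iff_deriv_of_isOpen hs]
    refine ⟨fun r hr => (h2 r hr).differentiableAt.differentiableWithinAt, by simp, ?_⟩
    rw [contDiffOn_zero]
    exact h3.congr fun r hr => (h2 r hr).deriv
  rw [show (2 : WithTop ℕ∞) = 1 + 1 from rfl, contDiffOn_succ_iff_deriv_of_isOpen hs]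
  exact ⟨fun r hr => (h1 r hr).differentiableAt.differentiableWithinAt, by simp,
    e1.congr fun r hr => (h1 r hr).deriv⟩

/-- The Laplacian of a radial function. -/
theorem laplacian_radial {N : ℕ} {w : EuclideanSpace ℝ (Fin N) → ℝ} {f f' f'' : ℝ → ℝ}
    (hw : ∀ x, x ≠ 0 → w x = f ‖x‖) (h1 : ∀ r, 0 < r → HasDerivAt f (f' r) r)
    (h2 : ∀ r, 0 < r → HasDerivAt f' (f'' r) r) {x : EuclideanSpace ℝ (Fin N)} (hx : x ≠ 0) :
    Laplacian.laplacian w x = f'' ‖x‖ + (N - 1) / ‖x‖ * f' ‖x‖ := by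
  have hr : 0 < ‖x‖ := norm_pos_iff.2 hx
  have hnear : ∀ {z : EuclideanSpace ℝ (Fin N)}, z ≠ 0 → ∀ᶠ y in 𝓝 z, y ≠ 0 := fun hz =>
    isOpen_ne.mem_nhds hz
  -- The gradient is written as the scalar `f'(|y|) / |y|` times the vector `y`; differentiating
  -- this product, the identity map contributes the dimension to the trace.
  have hgrad : ∀ y : EuclideanSpace ℝ (Fin N), y ≠ 0 →
      fderiv ℝ w y = (f' ‖y‖ / ‖y‖) • innerSL ℝ y := fun y hy => by
    have e1 := (HasGradientAt_comp_norm hy (h1 ‖y‖ (norm_pos_iff.2 hy))).hasFDerivAt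
    have e2 := e1.congr_of_eventuallyEq (f₁ := w) (by
      filter_upwards [hnear hy] with z hz using hw z hz)
    rw [e2.fderiv]
    ext z
    simp [div_eq_mul_inv, mul_assoc]
  have hA : HasDerivAt (fun r => f' r / r) ((f'' ‖x‖ * ‖x‖ - f' ‖x‖) / ‖x‖ ^ 2) ‖x‖ :=
    ((h2 _ hr).div (hasDerivAt_id _) hr.ne').congr_deriv (by simp)
  have hA' := (HasGradientAt_comp_norm hx hA).hasFDerivAt
  have hD := (hA'.smul (innerSL ℝ (E := EuclideanSpace ℝ (Fin N))).hasFDerivAt).congr_of_eventuallyEq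
    (f₁ := fderiv ℝ w) (by filter_upwards [hnear hx] with z hz using hgrad z hz)
  rw [InnerProductSpace.laplacian_eq_iteratedFDeriv_orthonormalBasis w
    (EuclideanSpace.basisFun (Fin N) ℝ)]
  simp only [iteratedFDeriv_two_apply, hD.fderiv, Matrix.cons_val_zero, Matrix.cons_val_one]
  have e3 : ∑ i : Fin N, x i ^ 2 = ‖x‖ ^ 2 := by
    rw [EuclideanSpace.norm_sq_eq]; simp
  simp only [add_apply, smul_apply, ContinuousLinearMap.smulRight_apply,
    EuclideanSpace.basisFun_apply, smul_eq_mul, InnerProductSpace.toDual_apply_apply,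
    inner_smul_left, EuclideanSpace.inner_single_right, conj_trivial, one_mul]
  have e4 : ∀ i : Fin N, f' ‖x‖ / ‖x‖ * innerSL ℝ (EuclideanSpace.single i (1 : ℝ))
        (EuclideanSpace.single i (1 : ℝ))
      + (f'' ‖x‖ * ‖x‖ - f' ‖x‖) / ‖x‖ ^ 2 * (‖x‖⁻¹ * x i) * innerSL ℝ x (EuclideanSpace.single i 1)
      = f' ‖x‖ / ‖x‖ + (f'' ‖x‖ * ‖x‖ - f' ‖x‖) / ‖x‖ ^ 2 * ‖x‖⁻¹ * x i ^ 2 := fun i => by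
    rw [innerSL_apply_apply, innerSL_apply_apply, EuclideanSpace.inner_single_right,
      EuclideanSpace.inner_single_right]
    simp; ring
  refine (Finset.sum_congr rfl fun i _ => e4 i).trans ?_
  rw [Finset.sum_add_distrib, ← Finset.mul_sum, e3]
  simp only [Finset.sum_const, Finset.card_univ, Fintype.card_fin, nsmul_eq_mul]
  field_simp
  ring

/-! ## Solutions of the quasilinear equation -/

section Solutions

variable {N : ℕ} [hN : Fact (3 ≤ N)] {V K g : ℝ → ℝ} {a b σ C R : ℝ} {m : ℝ → ℝ} {q₁ q₂ : ℝ}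

theorem hasDerivAt_dualChange' (t : ℝ) : HasDerivAt dualChange (dualSlope t) t :=
  hasDerivAt_dualChange t

/-- With `s = f'(u)` one has `w' = s u'` and `s' = -2 w s⁴ u'`; the radial equation for `u` then
gives both Laplacians, and `s² (1 + 2 w²) = 1` reduces their combination to the equation for `w`. -/
theorem isClassicalSolution_of_critical (hH : HypH V K) (gb : GrowthBound N V K g a b σ C R m)
    (hb : Continuous (bFun g)) {p : RadSpace N V} (hp : radGrad K g p = 0)
    {w : EuclideanSpace ℝ (Fin N) → ℝ} (hw : ∀ x, x ≠ 0 → w x = dualChange (val p ‖x‖)) :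
    IsClassicalSolution V K g w := by
  obtain ⟨u', -, h2, h3⟩ := critical_regularity hH gb hb hp
  set F : ℝ → ℝ := fun r => K r * bFun g (val p r) - V r * aFun (val p r) with hF
  have hFc : ContinuousOn F (Ioi 0) := (hH.K_cont.mul (continuousOn_comp_val hb p)).sub
    (hH.V_cont.mul (continuousOn_comp_val continuous_aFun p))
  have hu'c : ContinuousOn u' (Ioi 0) := fun r hr => (h3 r hr).continuousAt.continuousWithinAt
  set W : ℝ → ℝ := fun r => dualChange (val p r) with hW
  set s : ℝ → ℝ := fun r => dualSlope (val p r) with hs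
  set wd : ℝ → ℝ := fun r => s r * u' r with hwd
  set wd' : ℝ → ℝ := fun r => -2 * W r * s r ^ 4 * u' r * u' r
    + s r * (-((N - 1 : ℝ) / r * u' r) - F r) with hwd'
  have d1 : ∀ r, 0 < r → HasDerivAt W (wd r) r := fun r hr =>
    (hasDerivAt_dualChange' _).comp r (h2 r hr)
  have d2 : ∀ r, 0 < r → HasDerivAt wd (wd' r) r := fun r hr =>
    ((hasDerivAt_dualSlope _).comp r (h2 r hr)).mul (h3 r hr)
  have hWc : ContinuousOn W (Ioi 0) := continuousOn_comp_val continuous_dualChange p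
  have hsc : ContinuousOn s (Ioi 0) := continuousOn_comp_val continuous_dualSlope p
  have hwd'c : ContinuousOn wd' (Ioi 0) := by
    refine (((continuousOn_const.mul hWc).mul (hsc.pow 4)).mul hu'c |>.mul hu'c).add
      (hsc.mul (ContinuousOn.sub ?_ hFc))
    exact ((continuousOn_const.div continuousOn_id fun r hr => (ne_of_gt hr)).mul hu'c).neg
  constructor
  · have h5 : ContDiffOn ℝ 2 W (Ioi 0) := contDiffOn_two_of_hasDerivAt isOpen_Ioi
      (fun r hr => d1 r hr) (fun r hr => d2 r hr) hwd'c
    have h6 : ContDiffOn ℝ 2 (fun x : EuclideanSpace ℝ (Fin N) => W ‖x‖) {0}ᶜ :=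
      h5.comp (fun x hx => (contDiffAt_norm ℝ hx).contDiffWithinAt) fun x hx => norm_pos_iff.2 hx
    exact h6.congr fun x hx => hw x hx
  · intro x hx
    have hr : 0 < ‖x‖ := norm_pos_iff.2 hx
    have e1 := laplacian_radial hw d1 d2 hx
    have d3 : ∀ r, 0 < r → HasDerivAt (fun r => W r ^ 2) (2 * W r * wd r) r := fun r hr =>
      ((d1 r hr).pow 2).congr_deriv (by simp)
    have d4 : ∀ r, 0 < r → HasDerivAt (fun r => 2 * W r * wd r)
        (2 * wd r * wd r + 2 * W r * wd' r) r := fun r hr =>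
      (((d1 r hr).const_mul 2).mul (d2 r hr))
    have e2 := laplacian_radial (w := fun y => w y ^ 2) (fun y hy => by rw [hw y hy]) d3 d4 hx
    rw [e1, e2, hw x hx]
    change _ = K ‖x‖ * g (W ‖x‖)
    change -(wd' ‖x‖ + (N - 1) / ‖x‖ * wd ‖x‖) + V ‖x‖ * W ‖x‖ - W ‖x‖ * _ = _
    have e3 : s ‖x‖ ^ 2 * (1 + 2 * W ‖x‖ ^ 2) = 1 := dualSlope_sq _
    have e4 : F ‖x‖ = K ‖x‖ * (g (W ‖x‖) * s ‖x‖) - V ‖x‖ * (W ‖x‖ * s ‖x‖) := rfl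
    have hs0 : s ‖x‖ ≠ 0 := (dualSlope_pos _).ne'
    simp only [hwd, hwd', e4]
    generalize s ‖x‖ = s at *
    generalize W ‖x‖ = W at *
    generalize u' ‖x‖ = y at *
    generalize ‖x‖ = r at *
    generalize g W = G at *
    have hr0 : r ≠ 0 := hr.ne'
    -- The first order terms cancel and the quadratic gradient terms combine into a multiple of `s²
    -- (1 + 2 W²) - 1`, which is zero.
    have e5 : -(-2 * W * s ^ 4 * y * y
        + s * (-((N - 1 : ℝ) / r * y) - (K r * (G * s) - V r * (W * s)))
        + (N - 1) / r * (s * y)) + V r * W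
        - W * (2 * (s * y) * (s * y) + 2 * W * (-2 * W * s ^ 4 * y * y
          + s * (-((N - 1 : ℝ) / r * y) - (K r * (G * s) - V r * (W * s))))
          + (N - 1) / r * (2 * W * (s * y)))
        = 2 * W * s ^ 2 * y ^ 2 * (s ^ 2 * (1 + 2 * W ^ 2) - 1)
          + (s ^ 2 * (1 + 2 * W ^ 2)) * (K r * G - V r * W) + V r * W := by
      field_simp
      ring
    rw [e5, e3]; ring

/-- The critical point equation is tested with `h / f'(u) = h √(1 + 2 w²)`. In the terms with `V`
and `K` the factor `f'(u)` cancels, and the gradient term splits into the two gradient terms of the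
weak formulation. -/
theorem isWeakSolution_of_critical (hH : HypH V K) (gb : GrowthBound N V K g a b σ C R m)
    (hb : Continuous (bFun g)) {p : RadSpace N V} (hp : radGrad K g p = 0)
    {w : EuclideanSpace ℝ (Fin N) → ℝ} (hw : ∀ x, x ≠ 0 → w x = dualChange (val p ‖x‖)) :
    IsWeakSolution V K g w := by
  have hN1 := one_le_dim N
  have hN3 := three_le N
  obtain ⟨u', h1, h2, h3⟩ := critical_regularity hH gb hb hp
  have hu'c : ContinuousOn u' (Ioi 0) := fun r hr => (h3 r hr).continuousAt.continuousWithinAt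
  have hu'm : MemLp u' 2 (rMeas N) := (memLp_der p).ae_eq h1
  set W : ℝ → ℝ := fun r => dualChange (val p r) with hW
  set s : ℝ → ℝ := fun r => dualSlope (val p r) with hs
  set wd : ℝ → ℝ := fun r => s r * u' r with hwd
  have hWc : ContinuousOn W (Ioi 0) := continuousOn_comp_val continuous_dualChange p
  have hsc : ContinuousOn s (Ioi 0) := continuousOn_comp_val continuous_dualSlope p
  have hwdc : ContinuousOn wd (Ioi 0) := hsc.mul hu'c
  have hs0 : ∀ r, 0 < s r := fun r => dualSlope_pos _
  have hs1 : ∀ r, s r ≤ 1 := fun r => dualSlope_le_one _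
  have hsW : ∀ r, s r ^ 2 * (1 + 2 * W r ^ 2) = 1 := fun r => dualSlope_sq _
  have hWs : ∀ r, |W r| * s r ≤ 1 := fun r => abs_dualChange_mul_dualSlope_le _
  have d1 : ∀ r, 0 < r → HasDerivAt W (wd r) r := fun r hr =>
    (hasDerivAt_dualChange' _).comp r (h2 r hr)
  have hwdu : ∀ r, |wd r| ≤ |u' r| := fun r => by
    rw [hwd, abs_mul, abs_of_pos (hs0 r)]
    exact mul_le_of_le_one_left (abs_nonneg _) (hs1 r)
  have hwdm : MemLp wd 2 (rMeas N) :=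
    hu'm.mono (rMeas_aestronglyMeasurable hN1 hwdc) (Eventually.of_forall hwdu)
  have hW0 : Tendsto W atTop (𝓝 0) := by
    have h4 := (continuous_dualChange.tendsto 0).comp (tendsto_tailInt_atTop hN3 (memLp_der p))
    rwa [dualChange_zero] at h4
  have hWt : ∀ r, 0 < r → tailInt wd r = W r := fun r hr =>
    tailInt_eq_of_hasDerivAt hN3 d1 hwdc hwdm hW0 hr
  have hwW : ∀ᵐ x : EuclideanSpace ℝ (Fin N), w x = W ‖x‖ := by
    filter_upwards [ae_ne_zero_euclidean hN1] with x hx using hw x hx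
  have hwt : w =ᵐ[volume] fun x => tailInt wd ‖x‖ := by
    filter_upwards [ae_ne_zero_euclidean hN1] with x hx
    rw [hw x hx, hWt _ (norm_pos_iff.2 hx)]
  refine ⟨(mem_D12r_iff hN3).2 ⟨wd, hwdm, hwt⟩, ?_, fun h hh => ?_⟩
  · have h5 := integrable_V_dual_sq hH p
    refine ((integrable_comp_norm_iff h5.1).2 h5).congr ?_
    filter_upwards [hwW] with x hx
    rw [hx]
  obtain ⟨F, hFs, hFc, hFx, hFm, hFt, hFg⟩ := hh.exists_profile hN3
  have hFd : ∀ r, HasDerivAt F (deriv F r) r := fun r =>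
    (hFs.differentiable (by simp) r).hasDerivAt
  have hF'c : Continuous (deriv F) := hFs.continuous_deriv (by simp)
  obtain ⟨M, hM⟩ := hFc.exists_bound_of_continuous hFs.continuous
  obtain ⟨M', hM'⟩ := hFc.deriv.exists_bound_of_continuous hF'c
  obtain ⟨ρ, hρ⟩ : ∃ ρ : ℝ, ∀ r, ρ < r → F r = 0 ∧ deriv F r = 0 := by
    obtain ⟨ρ, hρ⟩ := hFc.isBounded.subset_closedBall 0
    refine ⟨ρ, fun r hr => ?_⟩
    have : r ∉ tsupport F := fun h => by
      have h1 := hρ h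
      rw [mem_closedBall_zero_iff, Real.norm_eq_abs] at h1
      linarith [le_abs_self r]
    exact ⟨image_eq_zero_of_notMem_tsupport this,
      image_eq_zero_of_notMem_tsupport fun h => this (tsupport_deriv_subset h)⟩
  have hM0 : 0 ≤ M := (norm_nonneg _).trans (hM 0)
  have hM'0 : 0 ≤ M' := (norm_nonneg _).trans (hM' 0)
  -- `W` may be unbounded at the origin; but `|W| ≤ |u|` and `F'` vanishes beyond `ρ`, so Hardy's
  -- inequality on `(0, ρ]` gives square integrability.
  have hWF : MemLp (fun r => W r * deriv F r) 2 (rMeas N) := by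
    have hc : ContinuousOn (fun r => W r * deriv F r) (Ioi 0) := hWc.mul hF'c.continuousOn
    rw [memLp_two_iff_integrable_sq (rMeas_aestronglyMeasurable hN1 hc)]
    refine integrable_of_abs_le (hc.pow 2)
      ((integrable_hardy hN3 (memLp_der p)).const_mul (M' ^ 2 * ρ ^ 2)) fun r hr => ?_
    rw [abs_of_nonneg (by positivity)]
    rcases le_or_gt r ρ with h | h
    · have e1 : W r ^ 2 ≤ val p r ^ 2 := dualChange_sq_le_sq _
      have e2 : deriv F r ^ 2 ≤ M' ^ 2 := by
        rw [← sq_abs]; exact pow_le_pow_left₀ (abs_nonneg _) (hM' r) 2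
      have e3 : r ^ 2 ≤ ρ ^ 2 := pow_le_pow_left₀ hr.le h 2
      change _ ≤ M' ^ 2 * ρ ^ 2 * (val p r ^ 2 / r ^ 2)
      calc (W r * deriv F r) ^ 2 = W r ^ 2 * deriv F r ^ 2 := by ring
        _ ≤ val p r ^ 2 * M' ^ 2 := by gcongr
        _ = M' ^ 2 * r ^ 2 * (val p r ^ 2 / r ^ 2) := by field_simp
        _ ≤ _ := by gcongr
    · rw [(hρ r h).2]
      have : 0 ≤ tailInt (der p) r ^ 2 / r ^ 2 := by positivity
      simp only [mul_zero, ne_eq, OfNat.ofNat_ne_zero, not_false_eq_true, zero_pow]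
      positivity
  set Q : ℝ → ℝ := fun r => F r / s r with hQ
  set Q' : ℝ → ℝ := fun r => deriv F r / s r + 2 * F r * W r * s r * wd r with hQ'
  have hQd : ∀ r, 0 < r → HasDerivAt Q (Q' r) r := fun r hr => by
    have e1 := (hFd r).div ((hasDerivAt_dualSlope _).comp r (h2 r hr)) (hs0 r).ne'
    refine e1.congr_deriv ?_
    have := (hs0 r).ne'
    change (deriv F r * s r - F r * (-2 * W r * s r ^ 4 * u' r)) / s r ^ 2 = _
    simp only [hQ', hwd]
    field_simp
    ring
  have hQ'c : ContinuousOn Q' (Ioi 0) :=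
    (hF'c.continuousOn.div hsc fun r _ => (hs0 r).ne').add
      ((((continuousOn_const.mul hFs.continuous.continuousOn).mul hWc).mul hsc).mul hwdc)
  -- The bound `|f| f' ≤ 1` compensates the possible growth of `W` at the origin.
  have hFWwd : ∀ r, |2 * F r * W r * s r * wd r| ≤ 2 * M * |u' r| := fun r => by
    rw [abs_mul, abs_mul, abs_mul, abs_mul, abs_two, abs_of_pos (hs0 r)]
    have e1 := hWs r
    have e2 : |F r| ≤ M := hM r
    calc _ = 2 * |F r| * (|W r| * s r) * |wd r| := by ring
      _ ≤ 2 * M * 1 * |u' r| := by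
        have := hwdu r
        have := (hs0 r).le
        gcongr
      _ = _ := by ring
  have hQ'm : MemLp Q' 2 (rMeas N) := by
    refine MemLp.add (f := fun r => deriv F r / s r) (g := fun r => 2 * F r * W r * s r * wd r) ?_ ?_
    · have hc : ContinuousOn (fun r => deriv F r / s r) (Ioi 0) :=
        hF'c.continuousOn.div hsc fun r _ => (hs0 r).ne'
      rw [memLp_two_iff_integrable_sq (rMeas_aestronglyMeasurable hN1 hc)]
      refine (hFm.integrable_sq.add (hWF.integrable_sq.const_mul 2)).congr
        (Eventually.of_forall fun r => ?_)
      have e1 := hsW r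
      have := (hs0 r).ne'
      simp only [Pi.add_apply]
      rw [div_pow, eq_div_iff (by positivity)]
      linear_combination (deriv F r) ^ 2 * e1
    · refine (hu'm.const_mul (2 * M)).mono (rMeas_aestronglyMeasurable hN1
        ((((continuousOn_const.mul hFs.continuous.continuousOn).mul hWc).mul hsc).mul hwdc))
        (Eventually.of_forall fun r => ?_)
      refine (hFWwd r).trans (le_of_eq ?_)
      rw [Real.norm_eq_abs, abs_mul, abs_of_nonneg (show (0 : ℝ) ≤ 2 * M by positivity)]
  have hQ0 : ∀ r, ρ < r → Q r = 0 := fun r hr => by rw [hQ]; simp [(hρ r hr).1]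
  have hQlim : Tendsto Q atTop (𝓝 0) := by
    refine tendsto_const_nhds.congr' ?_
    filter_upwards [eventually_gt_atTop ρ] with r hr using (hQ0 r hr).symm
  have hQt : ∀ r, 0 < r → tailInt Q' r = Q r := fun r hr =>
    tailInt_eq_of_hasDerivAt hN3 hQd hQ'c hQ'm hQlim hr
  -- The added `1` gives the strict inequalities `ρ < r` and `0 < r`, without any sign condition on
  -- `ρ`.
  have hQt0 : ∀ r, max ρ 0 + 1 ≤ r → tailInt Q' r = 0 := fun r hr => by
    have e1 := le_max_left ρ 0
    have e2 := le_max_right ρ 0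
    rw [hQt r (by linarith), hQ0 r (by linarith)]
  set q : RadSpace N V := mkVan hH hQ'm hQt0 with hq
  have hqd : der q =ᵐ[rMeas N] Q' := der_mkRad _ _
  have hqv : ∀ r, 0 < r → val q r = Q r := fun r hr => by
    rw [hq, mkVan, val_mkRad _ _ hr, hQt r hr]
  have hcrit := radGrad_eq hH gb hb p q
  rw [hp, zero_apply] at hcrit
  have iB : Integrable (fun r => 2 * W r * wd r ^ 2 * F r) (rMeas N) := by
    refine integrable_of_abs_le (((continuousOn_const.mul hWc).mul (hwdc.pow 2)).mul
      hFs.continuous.continuousOn) (hu'm.integrable_sq.const_mul (2 * M)) fun r _ => ?_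
    have e2 : |F r| ≤ M := hM r
    have e3 : |W r| * wd r ^ 2 ≤ u' r ^ 2 := by
      have : |W r| * wd r ^ 2 = (|W r| * s r) * s r * u' r ^ 2 := by rw [hwd]; ring
      rw [this]
      have e4 : (|W r| * s r) * s r ≤ 1 := mul_le_one₀ (hWs r) (hs0 r).le (hs1 r)
      nlinarith [sq_nonneg (u' r)]
    rw [abs_mul, abs_mul, abs_mul, abs_two, abs_of_nonneg (sq_nonneg (wd r))]
    calc _ = 2 * (|W r| * wd r ^ 2) * |F r| := by ring
      _ ≤ 2 * u' r ^ 2 * M := by gcongr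
      _ = _ := by ring
  -- Here `u' = w' √(1 + 2 w²)`, so differentiating `h √(1 + 2 w²)` produces both gradient terms.
  -- The second is integrable on its own, hence so is the first.
  have hAB : (fun r => der p r * der q r) =ᵐ[rMeas N]
      fun r => (1 + 2 * W r ^ 2) * (wd r * deriv F r) + 2 * W r * wd r ^ 2 * F r := by
    filter_upwards [h1, hqd] with r e1 e2
    have e3 := hsW r
    have := (hs0 r).ne'
    rw [e1, e2]
    simp only [hQ', hwd]
    field_simp
    linear_combination (-(u' r * deriv F r)) * e3
  have iA : Integrable (fun r => (1 + 2 * W r ^ 2) * (wd r * deriv F r)) (rMeas N) := by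
    refine (((integrable_der_mul p q).congr hAB).sub iB).congr (Eventually.of_forall fun r => ?_)
    simp
  have hCC : (fun r => V r * aFun (val p r) * val q r) =ᵐ[rMeas N] fun r => V r * W r * F r := by
    filter_upwards [rMeas_ae_pos hN1] with r hr
    have := (hs0 r).ne'
    rw [hqv r hr, hQ]
    change V r * (W r * s r) * (F r / s r) = _
    field_simp
  have iC := (integrable_V_aFun_mul hH p q).congr hCC
  have hDD : (fun r => K r * bFun g (val p r) * val q r) =ᵐ[rMeas N]
      fun r => K r * g (W r) * F r := by
    filter_upwards [rMeas_ae_pos hN1] with r hr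
    have := (hs0 r).ne'
    rw [hqv r hr, hQ]
    change K r * (g (W r) * s r) * (F r / s r) = _
    field_simp
  have iD := (integrable_K_bFun hH gb hb p q).congr hDD
  rw [integral_congr_ae hAB, integral_congr_ae hCC, integral_congr_ae hDD,
    integral_add iA iB] at hcrit
  have hwg := wgrad_ae hN3 hwdm hwt
  have tA : (fun x => (1 + 2 * w x ^ 2) * inner ℝ (wgrad w x) (gradient h x)) =ᵐ[volume]
      fun x => (1 + 2 * W ‖x‖ ^ 2) * (wd ‖x‖ * deriv F ‖x‖) := by
    filter_upwards [hwg, hwW, ae_ne_zero_euclidean hN1] with x e1 e2 e3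
    rw [e1, e2, hFg x e3, inner_radVec wd _ e3]
  have tB : (fun x => 2 * w x * ‖wgrad w x‖ ^ 2 * h x) =ᵐ[volume]
      fun x => 2 * W ‖x‖ * wd ‖x‖ ^ 2 * F ‖x‖ := by
    filter_upwards [hwg, hwW, ae_ne_zero_euclidean hN1] with x e1 e2 e3
    rw [e1, e2, hFx x, norm_radVec wd e3, sq_abs]
  have tC : (fun x => V ‖x‖ * w x * h x) =ᵐ[volume] fun x => V ‖x‖ * W ‖x‖ * F ‖x‖ := by
    filter_upwards [hwW] with x e2
    rw [e2, hFx x]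
  have tD : (fun x => K ‖x‖ * g (w x) * h x) =ᵐ[volume] fun x => K ‖x‖ * g (W ‖x‖) * F ‖x‖ := by
    filter_upwards [hwW] with x e2
    rw [e2, hFx x]
  refine ⟨((integrable_comp_norm_iff iA.1).2 iA).congr tA.symm,
    ((integrable_comp_norm_iff iB.1).2 iB).congr tB.symm,
    ((integrable_comp_norm_iff iC.1).2 iC).congr tC.symm,
    ((integrable_comp_norm_iff iD.1).2 iD).congr tD.symm, ?_⟩
  rw [integral_congr_ae tA, integral_congr_ae tB, integral_congr_ae tC, integral_congr_ae tD,
    integral_comp_norm iA.1, integral_comp_norm iB.1, integral_comp_norm iC.1,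
    integral_comp_norm iD.1]
  linarith

/-- A nonnegative nontrivial critical point. -/
theorem exists_nonneg_critical {α₀ β₀ αi βi : ℝ} (hH : HypH V K) (h₁ : HypOne V K α₀ β₀ αi βi)
    (h₂ : HypTwo N α₀ β₀ αi βi q₁ q₂) (hg : HypG g q₁ q₂) :
    ∃ p : RadSpace N V, p ≠ 0 ∧ radGrad K g p = 0 ∧ ∀ r, 0 < r → 0 ≤ val p r := by
  have hq2 : 4 < q₂ := (le_max_left _ _).trans_lt h₂.gt_infty
  have hgp := hg.truncate h₂.four_lt hq2
  -- The growth bounds are needed for both nonlinearities: for the truncated one to find the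
  -- critical point, for the original one to read the gradient as an integral.
  obtain ⟨a, b, σ, C, R, m, gb⟩ := exists_growthBound (three_le N) hH h₁ h₂ hg
  obtain ⟨a', b', σ', C', R', m', gb'⟩ := exists_growthBound (three_le N) hH h₁ h₂ hgp
  have hg0 : g 0 = 0 := by
    obtain ⟨C, hC, h⟩ := hg.growth
    have := h 0
    rw [abs_zero, Real.zero_rpow (by linarith [h₂.four_lt]), Real.zero_rpow (by linarith)] at this
    simpa using this
  have hb0 : ∀ t ≤ 0, bFun (fun t => g (max t 0)) t = 0 := fun t ht => by
    have h3 : dualChange t ≤ 0 := by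
      rw [← dualChange_zero]; exact strictMono_dualChange.monotone ht
    simp [bFun, max_eq_right h3, hg0]
  obtain ⟨p, hp0, hp⟩ := exists_radGrad_eq_zero (N := N) hH gb' hgp (hb0 0 le_rfl)
  have hnn : ∀ r, 0 < r → 0 ≤ val p r := fun r hr =>
    val_nonneg_of_critical hH gb' hgp.continuous_bFun hb0 hp hr
  refine ⟨p, hp0, ?_, hnn⟩
  -- On the range of a nonnegative function the truncation changes nothing, so the gradient of the
  -- original functional vanishes as well.
  have hk : kGrad K g p = kGrad K (fun t => g (max t 0)) p := by
    ext q
    rw [kGrad_apply hH gb hg.continuous_bFun, kGrad_apply hH gb' hgp.continuous_bFun]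
    refine integral_congr_ae ?_
    filter_upwards [rMeas_ae_pos (one_le_dim N)] with r hr
    simp only [bFun, max_eq_left (dualChange_nonneg (hnn r hr))]
  rw [radGrad, hk]; exact hp

theorem exists_val_ne_zero (hV : ∀ r, 0 < r → 0 ≤ V r) {p : RadSpace N V} (hp : p ≠ 0) :
    ∃ r, 0 < r ∧ val p r ≠ 0 := by
  by_contra! h
  have h1 : der p =ᵐ[rMeas N] fun _ => (0 : ℝ) := by
    refine ae_eq_of_tailInt_eq (three_le N) (memLp_der p) MemLp.zero fun r hr => ?_
    rw [show tailInt (fun _ => (0 : ℝ)) r = 0 by simp [tailInt]]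
    exact h r hr
  have h2 := norm_sq_eq hV p
  have h3 : ∫ r, V r * val p r ^ 2 ∂(rMeas N) = 0 := by
    refine integral_eq_zero_of_ae ?_
    filter_upwards [rMeas_ae_pos (one_le_dim N)] with r hr
    simp [h r hr]
  have h4 : ∫ r, der p r ^ 2 ∂(rMeas N) = 0 := by
    refine integral_eq_zero_of_ae ?_
    filter_upwards [h1] with r hr
    simp [hr]
  rw [h3, dnorm_sq, h4, add_zero] at h2
  exact hp (norm_eq_zero.1 (pow_eq_zero_iff two_ne_zero |>.1 h2))

end Solutions

end QuasilinearSchrodinger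

end

theorem theorem4p1 (N : ℕ) (hN : 3 ≤ N) (V K g : ℝ → ℝ) (α₀ β₀ αi βi q₁ q₂ : ℝ)
    (hH : HypH V K) (h₁ : HypOne V K α₀ β₀ αi βi) (h₂ : HypTwo N α₀ β₀ αi βi q₁ q₂)
    (hg : HypG g q₁ q₂) :
    (∀ v ∈ spaceE N V, Integrable (fun x => K ‖x‖ * primG g (dualChange (v x))) volume) ∧
    ∃ u : EuclideanSpace ℝ (Fin N) → ℝ,
      IsCriticalPoint V K g u ∧ ¬ (u =ᵐ[volume] 0) ∧ (∀ x, 0 ≤ u x) ∧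
      (∀ x, 0 ≤ dualChange (u x)) ∧
      IsClassicalSolution V K g (fun x => dualChange (u x)) ∧
      IsWeakSolution V K g (fun x => dualChange (u x)) := by
  have : Fact (3 ≤ N) := ⟨hN⟩
  obtain ⟨a, b, σ, C, R, m, gb⟩ := exists_growthBound hN hH h₁ h₂ hg
  refine ⟨fun v hv => ?_, ?_⟩
  · obtain ⟨p, hp⟩ := exists_rad_of_mem_spaceE hH hv
    exact integrable_K_primG_comp hH gb hg p hp
  obtain ⟨p, hp0, hp, hnn⟩ := exists_nonneg_critical (N := N) hH h₁ h₂ hg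
  -- The absolute value matters only at the origin, where the sign of `val p 0` is not known;
  -- elsewhere it has no effect.
  set u : EuclideanSpace ℝ (Fin N) → ℝ := fun x => |val p ‖x‖| with hu
  have hux : ∀ x, x ≠ 0 → u x = val p ‖x‖ := fun x hx => abs_of_nonneg (hnn _ (norm_pos_iff.2 hx))
  have huae : u =ᵐ[volume] fun x => val p ‖x‖ := by
    filter_upwards [ae_ne_zero_euclidean (one_le_dim N)] with x hx using hux x hx
  have hwx : ∀ x, x ≠ 0 → dualChange (u x) = dualChange (val p ‖x‖) := fun x hx => by
    rw [hux x hx]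
  refine ⟨u, isCriticalPoint_of_radGrad_eq_zero hH gb hg hp huae, fun h0 => ?_,
    fun x => abs_nonneg _, fun x => dualChange_nonneg (abs_nonneg _),
    isClassicalSolution_of_critical hH gb hg.continuous_bFun hp hwx,
    isWeakSolution_of_critical hH gb hg.continuous_bFun hp hwx⟩
  obtain ⟨r, hr, hne⟩ := exists_val_ne_zero hH.V_nonneg hp0
  exact hne (ae_eq_of_comp_norm hN (continuousOn_val p) continuousOn_const
    (huae.symm.trans h0) hr)
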